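/- **Setting.** Let $\mathfrak g=\mathfrak{spin}(3,1)_{\mathbb C}$ be the complex Lie algebra with basis $J_0,J_1,J_2,K_0,K_1,K_2$ and $[J_a,J_b]=i\varepsilon_{abc}J_c$, $[J_a,K_b]=i\varepsilon_{abc}K_c$, $[K_a,K_b]=-i\varepsilon_{abc}J_c$; put $J_\pm=J_1\pm iJ_2$, $K_\pm=K_1\pm iK_2$. The Casimirs are $\mathcal C_1=\sum_a J_aK_a$ and $\mathcal C_2=\sum_a (J_a^2-K_a^2)$. For $j\in\frac12\mathbb N_0$ let $\mathcal M_j=\{-j,-j+1,\dots,j\}$. For $\lambda\in\frac12\mathbb Z$, $\rho\in\mathbb C$, the $\mathfrak g$-module $V_{\lambda,\rho}$ has basis $|j,m\rangle$, $j\in|\lambda|+\mathbb N_0$ with $j\le j_{\max}$, $m\in\mathcal M_j$, and $$J_0|j,m\rangle=m|j,m\rangle,\qquad J_\pm|j,m\rangle=\sqrt{j\mp m}\sqrt{j\pm m+1}\,|j,m\pm1\rangle,$$ $$K_0|j,m\rangle=P^+(j)\sqrt{j+m+1}\sqrt{j-m+1}\,|j+1,m\rangle+P(j)\,m\,|j,m\rangle+P^-(j)\sqrt{j+m}\sqrt{j-m}\,|j-1,m\rangle,$$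 $$K_\pm|j,m\rangle=\mp P^+(j)\sqrt{j\pm m+1}\sqrt{j\pm m+2}\,|j+1,m\pm1\rangle+P(j)\sqrt{j\mp m}\sqrt{j\pm m+1}\,|j,m\pm1\rangle\pm P^-(j)\sqrt{j\mp m}\sqrt{j\mp m-1}\,|j-1,m\pm1\rangle,$$ where $P^-(j)=\dfrac{\sqrt{j+\lambda}\sqrt{j-\lambda}\sqrt{j+\rho}\sqrt{j-\rho}}{j\sqrt{2j+1}\sqrt{2j-1}}$ (and $P^-(0)=0$), $P^+(j)=P^-(j+1)$, $P(j)=\dfrac{i\lambda\rho}{j(j+1)}$ for $j\ne0$, $P(0)=0$, and $j_{\max}$ is the first $j\in|\lambda|+\mathbb N_0$ with $P^+(j)=0$ ($j_{\max}=\infty$ if there is none; then $V_{\lambda,\rho}$ is infinite-dimensional). For $\gamma\in\frac12\mathbb N_0$ and $A=\pm1$, $F^A_\gamma$ is the $(2\gamma+1)$-dimensional module with basis $|\gamma_A,\mu\rangle$, $\mu\in\mathcal M_\gamma$, on which $J_0,J_\pm$ act as on spin $\gamma$ and $K_0=iAJ_0$, $K_\pm=iAJ_\pm$; put $(\gamma_1,\gamma_2)=F^-_{\gamma_1}\otimes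 F^+_{\gamma_2}$. **Statement.** Let $\gamma_1,\gamma_2\in\frac12\mathbb N$, $\gamma_1,\gamma_2\ge\frac12$, $\lambda\in\frac12\mathbb Z$, $\rho\in\mathbb C$, with $V_{\lambda,\rho}$ infinite-dimensional. The two Casimirs are simultaneously diagonalisable on $(\gamma_1,\gamma_2)\otimes V_{\lambda,\rho}$ (there is a basis of common eigenvectors) if and only if $$\rho-\lambda\notin(-2\gamma_1,2\gamma_1)\cap\mathbb Z\quad\text{and}\quad\rho+\lambda\notin(-2\gamma_2,2\gamma_2)\cap\mathbb Z .$$ In this case the pairs $(c_1,c_2)$ of eigenvalues of $(\mathcal C_1,\mathcal C_2)$ on common eigenvectors are exactly the pairs $(i\Lambda\mathrm P,\ \Lambda^2+\mathrm P^2-1)$ with $$(\Lambda,\mathrm P)\in\{(\lambda+\nu_1+\nu_2,\ \rho-\nu_1+\nu_2):\nu_1\in\mathcal M_{\gamma_1},\ \nu_2\in\mathcal M_{\gamma_2}\},$$ and, as $\mathfrak g$-modules, $$(\gamma_1,\gamma_2)\otimes V_{\lambda,\rho}\;\cong\;\bigoplus_{\nu_1\in\mathcal M_{\gamma_1}}\bigoplus_{\nu_2\in\mathcal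 M_{\gamma_2}}V_{\lambda+\nu_1+\nu_2,\ \rho-\nu_1+\nu_2}.$$ Moreover, if the condition on $\rho\pm\lambda$ is not imposed, the pairs $(i\Lambda\mathrm P,\Lambda^2+\mathrm P^2-1)$ attached to different $(\nu_1,\nu_2)$ are not necessarily distinct: there are $\gamma_1,\gamma_2\ge\frac12$ and an infinite-dimensional $V_{\lambda,\rho}$ for which two of them coincide. -/

import Mathlib

set_option linter.unusedSimpArgs false
set_option linter.unusedTactic false
open scoped TensorProduct DirectSum

namespace Lorentz

/-- The complex Lie algebra `𝔰𝔭𝔦𝔫(3,1)_ℂ`: the element with coordinates `(x, y)` is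
`∑ₐ xₐ Jₐ + ∑ₐ yₐ Kₐ`. -/
@[ext] structure Spin31 where
  /-- coordinates along the rotation generators -/
  rot : Fin 3 → ℂ
  /-- coordinates along the boost generators -/
  boost : Fin 3 → ℂ

namespace Spin31

/-- The coordinates as an equivalence. -/
def equivProd : Spin31 ≃ (Fin 3 → ℂ) × (Fin 3 → ℂ) where
  toFun x := (x.rot, x.boost)
  invFun p := ⟨p.1, p.2⟩
  left_inv _ := rfl
  right_inv _ := rfl

instance : AddCommGroup Spin31 := equivProd.addCommGroup
noncomputable instance : Module ℂ Spin31 := equivProd.module ℂ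

@[simp] theorem add_rot (x y : Spin31) : (x + y).rot = x.rot + y.rot := rfl
@[simp] theorem add_boost (x y : Spin31) : (x + y).boost = x.boost + y.boost := rfl
@[simp] theorem smul_rot (c : ℂ) (x : Spin31) : (c • x).rot = c • x.rot := rfl
@[simp] theorem smul_boost (c : ℂ) (x : Spin31) : (c • x).boost = c • x.boost := rfl
@[simp] theorem zero_rot : (0 : Spin31).rot = 0 := rfl
@[simp] theorem zero_boost : (0 : Spin31).boost = 0 := rfl

open Matrix in
/-- The bracket determined by `[Jₐ,J_b] = i ε_{abc} J_c`, `[Jₐ,K_b] = i ε_{abc} K_c`,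
`[Kₐ,K_b] = -i ε_{abc} J_c`. -/
noncomputable instance : Bracket Spin31 Spin31 where
  bracket x y :=
    ⟨Complex.I • (crossProduct x.rot y.rot - crossProduct x.boost y.boost),
     Complex.I • (crossProduct x.rot y.boost + crossProduct x.boost y.rot)⟩

theorem lie_rot (x y : Spin31) :
    ⁅x, y⁆.rot = Complex.I • (crossProduct x.rot y.rot - crossProduct x.boost y.boost) := rfl
theorem lie_boost (x y : Spin31) :
    ⁅x, y⁆.boost = Complex.I • (crossProduct x.rot y.boost + crossProduct x.boost y.rot) := rfl

noncomputable instance : LieRing Spin31 where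
  add_lie x y z := by
    ext a <;> simp only [lie_rot, lie_boost, add_rot, add_boost, map_add, LinearMap.add_apply,
      Pi.add_apply, Pi.smul_apply, Pi.sub_apply, smul_eq_mul] <;> ring
  lie_add x y z := by
    ext a <;> simp only [lie_rot, lie_boost, add_rot, add_boost, map_add, LinearMap.add_apply,
      Pi.add_apply, Pi.smul_apply, Pi.sub_apply, smul_eq_mul] <;> ring
  lie_self x := by
    ext a <;> fin_cases a <;> simp [lie_rot, lie_boost, crossProduct] <;> ring
  leibniz_lie x y z := by
    ext a <;> fin_cases a <;> simp [lie_rot, lie_boost, crossProduct] <;> ring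

noncomputable instance : LieAlgebra ℂ Spin31 where
  lie_smul c x y := by
    ext a <;> simp only [lie_rot, lie_boost, smul_rot, smul_boost, map_smul, LinearMap.smul_apply,
      Pi.add_apply, Pi.smul_apply, Pi.sub_apply, smul_eq_mul] <;> ring

/-- The rotation generators `J₀, J₁, J₂`. -/
noncomputable def J (a : Fin 3) : Spin31 := ⟨Pi.single a 1, 0⟩

/-- The boost generators `K₀, K₁, K₂`. -/
noncomputable def K (a : Fin 3) : Spin31 := ⟨0, Pi.single a 1⟩

end Spin31

/-- The commutation relations of `𝔰𝔭𝔦𝔫(3,1)_ℂ` in terms of `J₀`, `J± = J₁ ± i J₂`, `K₀`,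
`K± = K₁ ± i K₂`, for endomorphisms of a vector space. -/
structure LadderRelations {W : Type*} [AddCommGroup W] [Module ℂ W]
    (J0 Jp Jm K0 Kp Km : Module.End ℂ W) : Prop where
  J0_Jp : J0 * Jp - Jp * J0 = Jp
  J0_Jm : J0 * Jm - Jm * J0 = -Jm
  Jp_Jm : Jp * Jm - Jm * Jp = (2 : ℂ) • J0
  J0_K0 : J0 * K0 - K0 * J0 = 0
  J0_Kp : J0 * Kp - Kp * J0 = Kp
  J0_Km : J0 * Km - Km * J0 = -Km
  Jp_K0 : Jp * K0 - K0 * Jp = -Kp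
  Jp_Kp : Jp * Kp - Kp * Jp = 0
  Jp_Km : Jp * Km - Km * Jp = (2 : ℂ) • K0
  Jm_K0 : Jm * K0 - K0 * Jm = Km
  Jm_Kp : Jm * Kp - Kp * Jm = -(2 : ℂ) • K0
  Jm_Km : Jm * Km - Km * Jm = 0
  K0_Kp : K0 * Kp - Kp * K0 = -Jp
  K0_Km : K0 * Km - Km * K0 = Jm
  Kp_Km : Kp * Km - Km * Kp = -(2 : ℂ) • J0

/-- The relations follow from those that generate them. -/
theorem LadderRelations.of_generating {W : Type*} [AddCommGroup W] [Module ℂ W]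
    {J0 Jp Jm K0 Kp Km : Module.End ℂ W}
    (h1 : J0 * Jp - Jp * J0 = Jp) (h2 : J0 * Jm - Jm * J0 = -Jm) (h3 : Jp * Jm - Jm * Jp = (2 : ℂ) • J0)
    (h4 : J0 * Kp - Kp * J0 = Kp) (h5 : Jp * Kp - Kp * Jp = 0) (h6 : Jm * Kp - Kp * Jm = -(2 : ℂ) • K0)
    (h7 : Jm * K0 - K0 * Jm = Km) (h8 : Jm * Km - Km * Jm = 0) (h9 : K0 * Kp - Kp * K0 = -Jp) :
    LadderRelations J0 Jp Jm K0 Kp Km := by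
  let _ : LieRing (Module.End ℂ W) := LieRing.ofAssociativeRing
  rw [← Ring.lie_def] at h1 h2 h3 h4 h5 h6 h7 h8 h9
  have two : (2 : ℂ) ≠ 0 := two_ne_zero
  have a1 : ⁅J0, K0⁆ = 0 := by
    have := leibniz_lie J0 Jm Kp
    rw [h6, h2, h4, neg_lie, h6] at this
    simpa using this
  have a2 : ⁅J0, Km⁆ = -Km := by
    have := leibniz_lie J0 Jm K0
    rw [h7, h2, a1, neg_lie, h7] at this
    simpa using this
  have a3 : ⁅Jp, K0⁆ = -Kp := by
    have := leibniz_lie Jp Jm Kp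
    rw [h6, h3, h5, smul_lie, h4, lie_smul, lie_zero, add_zero, neg_smul] at this
    have h : (2 : ℂ) • ⁅Jp, K0⁆ = (2 : ℂ) • (-Kp) := by rw [smul_neg, ← this, neg_neg]
    exact smul_right_injective _ two h
  have a4 : ⁅Jp, Km⁆ = (2 : ℂ) • K0 := by
    have := leibniz_lie Jp Jm K0
    rw [h7, h3, a3, smul_lie, a1, lie_neg, h6] at this
    rw [this]; module
  have a5 : ⁅Kp, Km⁆ = -(2 : ℂ) • J0 := by
    have := leibniz_lie Jm K0 Kp
    rw [h9, h7, h6, lie_smul, lie_self, lie_neg, ← lie_skew Jm Jp, h3, ← lie_skew Km Kp] at this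
    rw [smul_zero, add_zero, neg_neg] at this
    rw [← neg_neg ⁅Kp, Km⁆, ← this]; module
  have a6 : ⁅K0, Km⁆ = Jm := by
    have := leibniz_lie Jm Kp Km
    rw [a5, h6, h8, lie_zero, add_zero, lie_smul, ← lie_skew Jm J0, h2, smul_lie, neg_neg] at this
    exact smul_right_injective _ (neg_ne_zero.mpr two) this.symm
  exact ⟨h1, h2, h3, a1, h4, a2, a3, h5, a4, h7, h6, h8, h9, a6, a5⟩

/-- The linear map `𝔰𝔭𝔦𝔫(3,1)_ℂ → End W` under which `J₀, J±, K₀, K±` act by given operators,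
so that `J₁ = (J₊ + J₋)/2`, `J₂ = (J₊ - J₋)/(2i)`, and likewise for `K`. -/
noncomputable def ladderMap {W : Type*} [AddCommGroup W] [Module ℂ W]
    (J0 Jp Jm K0 Kp Km : Module.End ℂ W) : Spin31 →ₗ[ℂ] Module.End ℂ W where
  toFun x :=
    x.rot 0 • J0 + x.rot 1 • ((1 / 2 : ℂ) • (Jp + Jm))
      + x.rot 2 • ((1 / (2 * Complex.I) : ℂ) • (Jp - Jm))
    + (x.boost 0 • K0 + x.boost 1 • ((1 / 2 : ℂ) • (Kp + Km))
      + x.boost 2 • ((1 / (2 * Complex.I) : ℂ) • (Kp - Km)))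
  map_add' x y := by simp only [Spin31.add_rot, Spin31.add_boost, Pi.add_apply]; module
  map_smul' c x := by
    simp only [Spin31.smul_rot, Spin31.smul_boost, Pi.smul_apply, smul_eq_mul, RingHom.id_apply]
    module

theorem LadderRelations.map_lie {W : Type*} [AddCommGroup W] [Module ℂ W]
    {J0 Jp Jm K0 Kp Km : Module.End ℂ W} (h : LadderRelations J0 Jp Jm K0 Kp Km)
    (x y : Spin31) :
    ladderMap J0 Jp Jm K0 Kp Km ⁅x, y⁆ =
      ladderMap J0 Jp Jm K0 Kp Km x * ladderMap J0 Jp Jm K0 Kp Km y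
        - ladderMap J0 Jp Jm K0 Kp Km y * ladderMap J0 Jp Jm K0 Kp Km x := by
  obtain ⟨h1, h2, h3, h4, h5, h6, h7, h8, h9, h10, h11, h12, h13, h14, h15⟩ := h
  rw [sub_eq_iff_eq_add] at h1 h2 h3 h4 h5 h6 h7 h8 h9 h10 h11 h12 h13 h14 h15
  have hI : (1 / (2 * Complex.I) : ℂ) = -(1 / 2) * Complex.I := by
    rw [one_div, mul_inv, Complex.inv_I]; ring
  have I2 : Complex.I ^ 2 = -1 := Complex.I_sq
  simp only [ladderMap, LinearMap.coe_mk, AddHom.coe_mk, hI, mul_add, add_mul, mul_sub, sub_mul,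
    smul_mul_assoc, mul_smul_comm,
    h1, h2, h3, h4, h5, h6, h7, h8, h9, h10, h11, h12, h13, h14, h15]
  simp only [Spin31.lie_rot, Spin31.lie_boost, cross_apply, Pi.smul_apply, Pi.sub_apply,
    Pi.add_apply, smul_eq_mul, Matrix.cons_val]
  match_scalars <;> ring_nf <;> simp only [I2] <;> ring

/-! ### The infinite-dimensional and finite-dimensional modules `V_{λ,ρ}`

Half-integers are encoded by their doubles: `λ = k / 2` with `k : ℤ`. A basis vector `|j,m⟩` is
addressed by the integers `n = j - |λ|` and `i = j + m`. -/

/-- A square root of a complex number (principal branch). -/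
noncomputable def csqrt (z : ℂ) : ℂ := z ^ ((2 : ℂ)⁻¹)

/-- `P⁻_{λ,ρ}(j)`. -/
noncomputable def Pminus (lam ρ j : ℂ) : ℂ :=
  csqrt (j + lam) * csqrt (j - lam) * csqrt (j + ρ) * csqrt (j - ρ)
    / (j * csqrt (2 * j + 1) * csqrt (2 * j - 1))

/-- `P⁺_{λ,ρ}(j)`. -/
noncomputable def Pplus (lam ρ j : ℂ) : ℂ := Pminus lam ρ (j + 1)

/-- `P_{λ,ρ}(j)`. -/
noncomputable def Pzero (lam ρ j : ℂ) : ℂ :=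
  if j = 0 then 0 else Complex.I * lam * ρ / (j * (j + 1))

/-- The spin `j = |λ| + n`, where `λ = k / 2`. -/
noncomputable def jval (k n : ℤ) : ℝ := |(k : ℝ)| / 2 + n

/-- The magnetic number `m = i - j`. -/
noncomputable def mval (k n i : ℤ) : ℝ := i - jval k n

/-- The spin `|λ| + n` occurs in `V_{λ,ρ}`: it does not exceed the first spin `j_max ∈ |λ| + ℕ₀`
with `P⁺_{λ,ρ}(j_max) = 0` (if there is one). -/
def IsLevel (k : ℤ) (ρ : ℂ) (n : ℕ) : Prop :=
  ∀ n' : ℕ, n' < n → Pplus ((k : ℂ) / 2) ρ (jval k n' : ℂ) ≠ 0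

/-- Labels `(n, i)` of the basis vectors `|j,m⟩`, `j = |λ| + n`, `m = -j + i`, of `V_{λ,ρ}`. -/
structure BasisIdx (k : ℤ) (ρ : ℂ) : Type where
  /-- `n = j - |λ|` -/
  n : ℕ
  /-- `i = j + m` -/
  i : ℕ
  isLevel : IsLevel k ρ n
  le : i ≤ k.natAbs + 2 * n

/-- The underlying complex vector space of `V_{λ,ρ}`, `λ = k / 2`, with basis the `|j,m⟩`. -/
def V (k : ℤ) (ρ : ℂ) : Type := BasisIdx k ρ →₀ ℂ

namespace V

variable (k : ℤ) (ρ : ℂ)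

noncomputable instance : AddCommGroup (V k ρ) := inferInstanceAs (AddCommGroup (BasisIdx k ρ →₀ ℂ))
noncomputable instance : Module ℂ (V k ρ) := inferInstanceAs (Module ℂ (BasisIdx k ρ →₀ ℂ))

open Classical in
/-- The basis vector `|j,m⟩` with `j = |λ| + n`, `m = -j + i`, and `0` if there is none. -/
noncomputable def ket (n i : ℤ) : V k ρ :=
  if h : 0 ≤ n ∧ 0 ≤ i ∧ IsLevel k ρ n.toNat ∧ i.toNat ≤ k.natAbs + 2 * n.toNat then
    Finsupp.single (⟨n.toNat, i.toNat, h.2.2.1, h.2.2.2⟩ : BasisIdx k ρ) (1 : ℂ)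
  else 0

/-- The linear operator with prescribed values on the basis vectors. -/
noncomputable def op (f : ℤ → ℤ → V k ρ) : Module.End ℂ (V k ρ) :=
  Finsupp.linearCombination ℂ (fun p : BasisIdx k ρ => f p.n p.i)

/-- `J₀ |j,m⟩ = m |j,m⟩`. -/
noncomputable def J0 : Module.End ℂ (V k ρ) :=
  op k ρ fun n i => (mval k n i : ℂ) • ket k ρ n i

/-- `J₊ |j,m⟩ = √(j-m) √(j+m+1) |j,m+1⟩`. -/
noncomputable def Jp : Module.End ℂ (V k ρ) :=
  op k ρ fun n i =>
    let j := jval k n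
    let m := mval k n i
    ((√(j - m) * √(j + m + 1) : ℝ) : ℂ) • ket k ρ n (i + 1)

/-- `J₋ |j,m⟩ = √(j+m) √(j-m+1) |j,m-1⟩`. -/
noncomputable def Jm : Module.End ℂ (V k ρ) :=
  op k ρ fun n i =>
    let j := jval k n
    let m := mval k n i
    ((√(j + m) * √(j - m + 1) : ℝ) : ℂ) • ket k ρ n (i - 1)

/-- The action of `K₀` on `|j,m⟩`; the three terms are along `|j+1,m⟩`, `|j,m⟩`, `|j-1,m⟩`. -/
noncomputable def K0 : Module.End ℂ (V k ρ) :=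
  op k ρ fun n i =>
    let j := jval k n
    let m := mval k n i
    (Pplus (k / 2) ρ j * (√(j + m + 1) * √(j - m + 1) : ℝ)) • ket k ρ (n + 1) (i + 1)
      + (Pzero (k / 2) ρ j * m) • ket k ρ n i
      + (Pminus (k / 2) ρ j * (√(j + m) * √(j - m) : ℝ)) • ket k ρ (n - 1) (i - 1)

/-- The action of `K₊` on `|j,m⟩`; the three terms are along `|j+1,m+1⟩`, `|j,m+1⟩`,
`|j-1,m+1⟩`. -/
noncomputable def Kp : Module.End ℂ (V k ρ) :=
  op k ρ fun n i =>
    let j := jval k n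
    let m := mval k n i
    (-Pplus (k / 2) ρ j * (√(j + m + 1) * √(j + m + 2) : ℝ)) • ket k ρ (n + 1) (i + 2)
      + (Pzero (k / 2) ρ j * (√(j - m) * √(j + m + 1) : ℝ)) • ket k ρ n (i + 1)
      + (Pminus (k / 2) ρ j * (√(j - m) * √(j - m - 1) : ℝ)) • ket k ρ (n - 1) i

/-- The action of `K₋` on `|j,m⟩`; the three terms are along `|j+1,m-1⟩`, `|j,m-1⟩`,
`|j-1,m-1⟩`. -/
noncomputable def Km : Module.End ℂ (V k ρ) :=
  op k ρ fun n i =>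
    let j := jval k n
    let m := mval k n i
    (Pplus (k / 2) ρ j * (√(j - m + 1) * √(j - m + 2) : ℝ)) • ket k ρ (n + 1) i
      + (Pzero (k / 2) ρ j * (√(j + m) * √(j - m + 1) : ℝ)) • ket k ρ n (i - 1)
      + (-Pminus (k / 2) ρ j * (√(j + m) * √(j + m - 1) : ℝ)) • ket k ρ (n - 1) (i - 2)

theorem ket_eq_zero {n i : ℤ}
    (h : ¬(0 ≤ n ∧ 0 ≤ i ∧ IsLevel k ρ n.toNat ∧ i.toNat ≤ k.natAbs + 2 * n.toNat)) :
    ket k ρ n i = 0 := dif_neg h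

theorem op_ket (f : ℤ → ℤ → V k ρ) (n i : ℤ)
    (hf : ¬(0 ≤ n ∧ 0 ≤ i ∧ IsLevel k ρ n.toNat ∧ i.toNat ≤ k.natAbs + 2 * n.toNat) →
      f n i = 0) :
    op k ρ f (ket k ρ n i) = f n i := by
  by_cases h : 0 ≤ n ∧ 0 ≤ i ∧ IsLevel k ρ n.toNat ∧ i.toNat ≤ k.natAbs + 2 * n.toNat
  · have e : op k ρ f (ket k ρ n i) = f n.toNat i.toNat := by
      have e1 : ket k ρ n i =
          Finsupp.single (⟨n.toNat, i.toNat, h.2.2.1, h.2.2.2⟩ : BasisIdx k ρ) (1 : ℂ) := dif_pos h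
      rw [e1]
      exact (Finsupp.linearCombination_single ℂ _ _).trans (one_smul _ _)
    rw [e, Int.toNat_of_nonneg h.1, Int.toNat_of_nonneg h.2.1]
  · rw [ket_eq_zero k ρ h, map_zero, hf h]

/-- Square roots of integers, `0` for negative ones. -/
noncomputable def sr (x : ℤ) : ℂ := ((√(x : ℝ) : ℝ) : ℂ)

theorem sr_of_nonpos {x : ℤ} (h : x ≤ 0) : sr x = 0 := by
  rw [sr, Real.sqrt_eq_zero_of_nonpos (by exact_mod_cast h), Complex.ofReal_zero]

theorem sr_mul_self {x : ℤ} (h : 0 ≤ x) : sr x * sr x = x := by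
  rw [sr, ← Complex.ofReal_mul, Real.mul_self_sqrt (by exact_mod_cast h)]
  simp

theorem csqrt_zero : csqrt 0 = 0 := by simp [csqrt]

theorem csqrt_mul_self (z : ℂ) : csqrt z * csqrt z = z := by
  rw [← pow_two, csqrt]
  exact_mod_cast Complex.cpow_nat_inv_pow z two_ne_zero

/-- `2j - i = j - m` -/
theorem j_sub_m (n i : ℤ) : jval k n - mval k n i = ((|k| + 2 * n - i : ℤ) : ℝ) := by
  simp only [mval, jval]; push_cast; ring

theorem j_add_m (n i : ℤ) : jval k n + mval k n i = ((i : ℤ) : ℝ) := by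
  simp only [mval]; ring

theorem Pminus_bot : Pminus ((k : ℂ) / 2) ρ (jval k 0 : ℂ) = 0 := by
  have : (jval k 0 : ℂ) = |(k : ℝ)| / 2 := by simp [jval]
  rw [Pminus, this]
  rcases abs_cases (k : ℝ) with ⟨h, -⟩ | ⟨h, -⟩ <;> rw [h] <;> simp [csqrt_zero, neg_div]

theorem jval_add_one (n : ℤ) : ((jval k (n + 1) : ℝ) : ℂ) = jval k n + 1 := by
  simp [jval]; ring

theorem Pplus_eq (n : ℤ) : Pplus ((k : ℂ) / 2) ρ (jval k n) = Pminus (k / 2) ρ (jval k (n + 1)) := by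
  rw [Pplus, jval_add_one]

/-- `P⁻` at the spin `|λ| + n`. -/
noncomputable def pm (n : ℤ) : ℂ := Pminus ((k : ℂ) / 2) ρ (jval k n)

/-- `P` at the spin `|λ| + n`. -/
noncomputable def pz (n : ℤ) : ℂ := Pzero ((k : ℂ) / 2) ρ (jval k n)

theorem range_iff (n i : ℤ) :
    (0 ≤ n ∧ 0 ≤ i ∧ IsLevel k ρ n.toNat ∧ i.toNat ≤ k.natAbs + 2 * n.toNat) ↔
      0 ≤ n ∧ 0 ≤ i ∧ 0 ≤ |k| + 2 * n - i ∧ IsLevel k ρ n.toNat := by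
  rw [Int.abs_eq_natAbs]
  constructor
  · rintro ⟨a, b, c, d⟩; exact ⟨a, b, by omega, c⟩
  · rintro ⟨a, b, c, d⟩; exact ⟨a, b, d, by omega⟩

theorem ket_of_lt_zero {n i : ℤ} (h : i < 0) : ket k ρ n i = 0 :=
  ket_eq_zero k ρ (fun h' => by omega)

theorem ket_of_gt {n i : ℤ} (h : |k| + 2 * n - i < 0) : ket k ρ n i = 0 :=
  ket_eq_zero k ρ (fun h' => by rw [range_iff] at h'; omega)

theorem ket_of_level {n i : ℤ} (h : ¬ (0 ≤ n ∧ IsLevel k ρ n.toNat)) : ket k ρ n i = 0 :=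
  ket_eq_zero k ρ (fun h' => h ⟨h'.1, h'.2.2.1⟩)

theorem up_zero {n : ℤ} (i : ℤ) (h : ¬ (0 ≤ n ∧ IsLevel k ρ n.toNat)) :
    pm k ρ (n + 1) = 0 ∨ ket k ρ (n + 1) i = 0 := by
  by_cases h' : 0 ≤ n + 1 ∧ IsLevel k ρ (n + 1).toNat
  · left
    by_cases hn : n = -1
    · subst hn; exact Pminus_bot k ρ
    · exfalso
      refine h ⟨by omega, fun n' hn' => h'.2 n' (by omega)⟩
  · exact Or.inr (ket_of_level k ρ h')

theorem down_zero {n : ℤ} (i : ℤ) (h : ¬ (0 ≤ n ∧ IsLevel k ρ n.toNat)) :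
    pm k ρ n = 0 ∨ ket k ρ (n - 1) i = 0 := by
  by_cases h' : 0 ≤ n - 1 ∧ IsLevel k ρ (n - 1).toNat
  · left
    by_contra hp
    refine h ⟨by omega, fun n' hn' => ?_⟩
    rcases Nat.lt_or_ge n' (n - 1).toNat with h1 | h1
    · exact h'.2 n' h1
    · have : (n' : ℤ) = n - 1 := by omega
      rw [this, Pplus_eq]
      simpa [pm] using hp
  · exact Or.inr (ket_of_level k ρ h')

theorem not_range {n i : ℤ}
    (h : ¬(0 ≤ n ∧ 0 ≤ i ∧ IsLevel k ρ n.toNat ∧ i.toNat ≤ k.natAbs + 2 * n.toNat)) :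
    i < 0 ∨ |k| + 2 * n - i < 0 ∨ ¬ (0 ≤ n ∧ IsLevel k ρ n.toNat) := by
  rw [range_iff] at h
  by_contra! h'
  exact h ⟨h'.2.2.1, h'.1, h'.2.1, h'.2.2.2⟩

theorem mval_eq (n i : ℤ) : ((mval k n i : ℝ) : ℂ) = (i : ℂ) - (|k| + 2 * n : ℤ) / 2 := by
  have h : ((|(k : ℝ)| : ℝ) : ℂ) = ((|k| : ℤ) : ℂ) := by
    rw [← Int.cast_abs, Complex.ofReal_intCast]
  simp only [mval, jval]
  push_cast
  rw [h]
  push_cast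
  ring

theorem J0_ket (n i : ℤ) :
    J0 k ρ (ket k ρ n i) = ((i : ℂ) - (|k| + 2 * n : ℤ) / 2) • ket k ρ n i := by
  rw [J0, op_ket]
  · rw [mval_eq]
  · intro h; rw [ket_eq_zero k ρ h, smul_zero]

theorem Jp_ket (n i : ℤ) :
    Jp k ρ (ket k ρ n i) = (sr (|k| + 2 * n - i) * sr (i + 1)) • ket k ρ n (i + 1) := by
  have e : ∀ n i : ℤ, ((√(jval k n - mval k n i) * √(jval k n + mval k n i + 1) : ℝ) : ℂ)
      = sr (|k| + 2 * n - i) * sr (i + 1) := by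
    intro n i
    rw [j_sub_m, j_add_m]; simp [sr]
  rw [Jp, op_ket]
  · simp only [e]
  · intro h
    simp only [e]
    rcases not_range k ρ h with h | h | h
    · rcases eq_or_ne i (-1) with rfl | h1
      · simp [sr]
      · rw [ket_of_lt_zero k ρ (by omega), smul_zero]
    · rw [ket_of_gt k ρ (by omega), smul_zero]
    · rw [ket_of_level k ρ h, smul_zero]

theorem Jm_ket (n i : ℤ) :
    Jm k ρ (ket k ρ n i) = (sr i * sr (|k| + 2 * n - i + 1)) • ket k ρ n (i - 1) := by
  have e : ∀ n i : ℤ, ((√(jval k n + mval k n i) * √(jval k n - mval k n i + 1) : ℝ) : ℂ)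
      = sr i * sr (|k| + 2 * n - i + 1) := by
    intro n i
    rw [j_sub_m, j_add_m]; simp [sr]
  rw [Jm, op_ket]
  · simp only [e]
  · intro h
    simp only [e]
    rcases not_range k ρ h with h | h | h
    · rw [ket_of_lt_zero k ρ (by omega), smul_zero]
    · rcases eq_or_ne (|k| + 2 * n - i) (-1) with h1 | h1
      · rw [h1]; simp [sr]
      · rw [ket_of_gt k ρ (by omega), smul_zero]
    · rw [ket_of_level k ρ h, smul_zero]

theorem smul_ket_zero {c : ℂ} {v : V k ρ} (a : ℂ) (h : c = 0 ∨ v = 0) : (c * a) • v = 0 := by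
  rcases h with h | h <;> simp [h]

theorem K0_ket (n i : ℤ) :
    K0 k ρ (ket k ρ n i) =
      (pm k ρ (n + 1) * (sr (i + 1) * sr (|k| + 2 * n - i + 1))) • ket k ρ (n + 1) (i + 1)
      + (pz k ρ n * ((i : ℂ) - (|k| + 2 * n : ℤ) / 2)) • ket k ρ n i
      + (pm k ρ n * (sr i * sr (|k| + 2 * n - i))) • ket k ρ (n - 1) (i - 1) := by
  have e1 : ∀ n i : ℤ, ((√(jval k n + mval k n i + 1) * √(jval k n - mval k n i + 1) : ℝ) : ℂ)
      = sr (i + 1) * sr (|k| + 2 * n - i + 1) := by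
    intro n i
    rw [j_sub_m, j_add_m]; simp [sr]
  have e2 : ∀ n i : ℤ, ((√(jval k n + mval k n i) * √(jval k n - mval k n i) : ℝ) : ℂ)
      = sr i * sr (|k| + 2 * n - i) := by
    intro n i
    rw [j_sub_m, j_add_m]; simp [sr]
  have e3 : ∀ n i : ℤ, ((mval k n i : ℝ) : ℂ) = (i : ℂ) - (|k| + 2 * n : ℤ) / 2 := by
    intro n i; rw [mval_eq]
  rw [K0, op_ket]
  · simp only [e1, e2, e3, Pplus_eq, ← pm.eq_def, ← pz.eq_def]
  · intro h
    simp only [e1, e2, e3, Pplus_eq, ← pm.eq_def, ← pz.eq_def]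
    rw [ket_eq_zero k ρ h, smul_zero, add_zero]
    rcases not_range k ρ h with h | h | h
    · rw [ket_of_lt_zero k ρ (show i - 1 < 0 by omega), smul_zero, add_zero]
      rcases eq_or_ne i (-1) with rfl | h1
      · simp [sr]
      · rw [ket_of_lt_zero k ρ (by omega), smul_zero]
    · rw [ket_of_gt k ρ (n := n - 1) (by omega), smul_zero, add_zero]
      rcases eq_or_ne (|k| + 2 * n - i) (-1) with h1 | h1
      · rw [h1]; simp [sr]
      · rw [ket_of_gt k ρ (by omega), smul_zero]
    · rw [smul_ket_zero k ρ _ (up_zero k ρ _ h), smul_ket_zero k ρ _ (down_zero k ρ _ h), add_zero]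

theorem Kp_ket (n i : ℤ) :
    Kp k ρ (ket k ρ n i) =
      (pm k ρ (n + 1) * (-(sr (i + 1) * sr (i + 2)))) • ket k ρ (n + 1) (i + 2)
      + (pz k ρ n * (sr (|k| + 2 * n - i) * sr (i + 1))) • ket k ρ n (i + 1)
      + (pm k ρ n * (sr (|k| + 2 * n - i) * sr (|k| + 2 * n - i - 1))) • ket k ρ (n - 1) i := by
  have e1 : ∀ n i : ℤ, ((√(jval k n + mval k n i + 1) * √(jval k n + mval k n i + 2) : ℝ) : ℂ)
      = sr (i + 1) * sr (i + 2) := by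
    intro n i
    rw [j_add_m]; simp [sr]
  have e2 : ∀ n i : ℤ, ((√(jval k n - mval k n i) * √(jval k n + mval k n i + 1) : ℝ) : ℂ)
      = sr (|k| + 2 * n - i) * sr (i + 1) := by
    intro n i
    rw [j_sub_m, j_add_m]; simp [sr]
  have e3 : ∀ n i : ℤ, ((√(jval k n - mval k n i) * √(jval k n - mval k n i - 1) : ℝ) : ℂ)
      = sr (|k| + 2 * n - i) * sr (|k| + 2 * n - i - 1) := by
    intro n i
    rw [j_sub_m]; simp [sr]
  rw [Kp, op_ket]
  · simp only [e1, e2, e3, Pplus_eq, ← pm.eq_def, ← pz.eq_def, neg_mul, mul_neg]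
  · intro h
    simp only [e1, e2, e3, Pplus_eq, ← pm.eq_def, ← pz.eq_def, neg_mul_comm]
    rcases not_range k ρ h with h | h | h
    · rw [ket_of_lt_zero k ρ h, smul_zero, add_zero]
      rcases eq_or_ne i (-1) with rfl | h1
      · simp [sr]
      · rw [ket_of_lt_zero k ρ (show i + 1 < 0 by omega), smul_zero, add_zero]
        rcases eq_or_ne i (-2) with rfl | h2
        · simp [sr]
        · rw [ket_of_lt_zero k ρ (show i + 2 < 0 by omega), smul_zero]
    · rw [ket_of_gt k ρ (n := n - 1) (by omega), ket_of_gt k ρ (n := n + 1) (by omega),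
        ket_of_gt k ρ (n := n) (by omega)]
      simp
    · rw [smul_ket_zero k ρ _ (up_zero k ρ _ h), smul_ket_zero k ρ _ (down_zero k ρ _ h),
        ket_of_level k ρ h, smul_zero, add_zero, add_zero]

theorem Km_ket (n i : ℤ) :
    Km k ρ (ket k ρ n i) =
      (pm k ρ (n + 1) * (sr (|k| + 2 * n - i + 1) * sr (|k| + 2 * n - i + 2))) • ket k ρ (n + 1) i
      + (pz k ρ n * (sr i * sr (|k| + 2 * n - i + 1))) • ket k ρ n (i - 1)
      + (pm k ρ n * (-(sr i * sr (i - 1)))) • ket k ρ (n - 1) (i - 2) := by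
  have e1 : ∀ n i : ℤ, ((√(jval k n - mval k n i + 1) * √(jval k n - mval k n i + 2) : ℝ) : ℂ)
      = sr (|k| + 2 * n - i + 1) * sr (|k| + 2 * n - i + 2) := by
    intro n i
    rw [j_sub_m]; simp [sr]
  have e2 : ∀ n i : ℤ, ((√(jval k n + mval k n i) * √(jval k n - mval k n i + 1) : ℝ) : ℂ)
      = sr i * sr (|k| + 2 * n - i + 1) := by
    intro n i
    rw [j_sub_m, j_add_m]; simp [sr]
  have e3 : ∀ n i : ℤ, ((√(jval k n + mval k n i) * √(jval k n + mval k n i - 1) : ℝ) : ℂ)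
      = sr i * sr (i - 1) := by
    intro n i
    rw [j_add_m]; simp [sr]
  rw [Km, op_ket]
  · simp only [e1, e2, e3, Pplus_eq, ← pm.eq_def, ← pz.eq_def, neg_mul, mul_neg]
  · intro h
    simp only [e1, e2, e3, Pplus_eq, ← pm.eq_def, ← pz.eq_def, neg_mul_comm]
    rcases not_range k ρ h with h | h | h
    · rw [ket_of_lt_zero k ρ h, ket_of_lt_zero k ρ (show i - 1 < 0 by omega),
        ket_of_lt_zero k ρ (show i - 2 < 0 by omega)]
      simp
    · rw [ket_of_gt k ρ (n := n - 1) (by omega), smul_zero, add_zero]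
      rcases eq_or_ne (|k| + 2 * n - i) (-1) with h1 | h1
      · rw [h1]; simp [sr]
      · rw [ket_of_gt k ρ (n := n) (by omega), smul_zero, add_zero]
        rcases eq_or_ne (|k| + 2 * n - i) (-2) with h2 | h2
        · rw [h2]; simp [sr]
        · rw [ket_of_gt k ρ (n := n + 1) (by omega), smul_zero]
    · rw [smul_ket_zero k ρ _ (up_zero k ρ _ h), smul_ket_zero k ρ _ (down_zero k ρ _ h),
        ket_of_level k ρ h, smul_zero, add_zero, add_zero]

theorem end_ext {S T : Module.End ℂ (V k ρ)}
    (h : ∀ n i : ℤ, 0 ≤ n → 0 ≤ i → 0 ≤ |k| + 2 * n - i → S (ket k ρ n i) = T (ket k ρ n i)) :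
    S = T := by
  refine Finsupp.lhom_ext' fun p => LinearMap.ext_ring ?_
  have e : ket k ρ p.n p.i = Finsupp.single p (1 : ℂ) := by
    have hp : 0 ≤ (p.n : ℤ) ∧ 0 ≤ (p.i : ℤ) ∧ IsLevel k ρ (p.n : ℤ).toNat ∧
      (p.i : ℤ).toNat ≤ k.natAbs + 2 * (p.n : ℤ).toNat :=
        ⟨by omega, by omega, by simpa using p.isLevel, by simpa using p.le⟩
    exact dif_pos hp
  have := h p.n p.i (by omega) (by omega) (by have := p.le; rw [Int.abs_eq_natAbs]; omega)
  rw [e] at this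
  exact this

theorem sr_sq {x : ℤ} (h : 0 ≤ x) : sr x ^ 2 = x := by rw [pow_two, sr_mul_self h]

theorem sr_mul_pred {x : ℤ} (h : 0 ≤ x) : sr x * sr (x - 1) ^ 2 = sr x * (x - 1) := by
  rcases h.eq_or_lt with rfl | h
  · simp [sr]
  · rw [sr_sq (by omega)]; push_cast; ring

theorem rel1 : J0 k ρ * Jp k ρ - Jp k ρ * J0 k ρ = Jp k ρ := by
  refine end_ext k ρ fun n i hn hi hu => ?_
  simp only [Module.End.mul_apply, LinearMap.sub_apply, J0_ket, Jp_ket, map_smul]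
  match_scalars
  ring

theorem rel2 : J0 k ρ * Jm k ρ - Jm k ρ * J0 k ρ = -Jm k ρ := by
  refine end_ext k ρ fun n i hn hi hu => ?_
  simp only [Module.End.mul_apply, LinearMap.sub_apply, J0_ket, Jm_ket, map_smul,
    LinearMap.neg_apply]
  match_scalars
  ring

theorem rel3 : Jp k ρ * Jm k ρ - Jm k ρ * Jp k ρ = (2 : ℂ) • J0 k ρ := by
  refine end_ext k ρ fun n i hn hi hu => ?_
  obtain ⟨u, hk⟩ : ∃ u, |k| = u + i - 2 * n := ⟨|k| + 2 * n - i, by ring⟩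
  simp only [Module.End.mul_apply, LinearMap.sub_apply, J0_ket, Jm_ket, Jp_ket, K0_ket, Kp_ket,
    Km_ket, map_smul, map_add, LinearMap.smul_apply, LinearMap.zero_apply, smul_add, smul_smul]
  have hu' : 0 ≤ u := by omega
  have i0 := sr_sq hi
  have i1 := sr_sq (x := 1 + i) (by omega)
  have i2 := sr_sq (x := 2 + i) (by omega)
  have im := sr_mul_pred hi
  have u0 := sr_sq hu'
  have u1 := sr_sq (x := 1 + u) (by omega)
  have u2 := sr_sq (x := 2 + u) (by omega)
  have um := sr_mul_pred hu'
  rw [hk]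
  ring_nf
  ring_nf at i0 i1 i2 im u0 u1 u2 um
  match_scalars <;> push_cast at * <;> grind

theorem rel4 : J0 k ρ * Kp k ρ - Kp k ρ * J0 k ρ = Kp k ρ := by
  refine end_ext k ρ fun n i hn hi hu => ?_
  simp only [Module.End.mul_apply, LinearMap.sub_apply, J0_ket, Kp_ket, map_smul, map_add]
  match_scalars <;> ring

theorem rel5 : Jp k ρ * Kp k ρ - Kp k ρ * Jp k ρ = 0 := by
  refine end_ext k ρ fun n i hn hi hu => ?_
  obtain ⟨u, hk⟩ : ∃ u, |k| = u + i - 2 * n := ⟨|k| + 2 * n - i, by ring⟩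
  simp only [Module.End.mul_apply, LinearMap.sub_apply, J0_ket, Jm_ket, Jp_ket, K0_ket, Kp_ket,
    Km_ket, map_smul, map_add, LinearMap.smul_apply, LinearMap.zero_apply, smul_add, smul_smul]
  have hu' : 0 ≤ u := by omega
  have i0 := sr_sq hi
  have i1 := sr_sq (x := 1 + i) (by omega)
  have i2 := sr_sq (x := 2 + i) (by omega)
  have im := sr_mul_pred hi
  have u0 := sr_sq hu'
  have u1 := sr_sq (x := 1 + u) (by omega)
  have u2 := sr_sq (x := 2 + u) (by omega)
  have um := sr_mul_pred hu'
  rw [hk]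
  ring_nf
  ring_nf at i0 i1 i2 im u0 u1 u2 um
  match_scalars <;> push_cast at * <;> grind

theorem rel6 : Jm k ρ * Kp k ρ - Kp k ρ * Jm k ρ = -(2 : ℂ) • K0 k ρ := by
  refine end_ext k ρ fun n i hn hi hu => ?_
  obtain ⟨u, hk⟩ : ∃ u, |k| = u + i - 2 * n := ⟨|k| + 2 * n - i, by ring⟩
  simp only [Module.End.mul_apply, LinearMap.sub_apply, J0_ket, Jm_ket, Jp_ket, K0_ket, Kp_ket,
    Km_ket, map_smul, map_add, LinearMap.smul_apply, LinearMap.zero_apply, smul_add, smul_smul]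
  have hu' : 0 ≤ u := by omega
  have i0 := sr_sq hi
  have i1 := sr_sq (x := 1 + i) (by omega)
  have i2 := sr_sq (x := 2 + i) (by omega)
  have im := sr_mul_pred hi
  have u0 := sr_sq hu'
  have u1 := sr_sq (x := 1 + u) (by omega)
  have u2 := sr_sq (x := 2 + u) (by omega)
  have um := sr_mul_pred hu'
  rw [hk]
  ring_nf
  ring_nf at i0 i1 i2 im u0 u1 u2 um
  match_scalars <;> push_cast at * <;> grind

theorem rel7 : Jm k ρ * K0 k ρ - K0 k ρ * Jm k ρ = Km k ρ := by
  refine end_ext k ρ fun n i hn hi hu => ?_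
  obtain ⟨u, hk⟩ : ∃ u, |k| = u + i - 2 * n := ⟨|k| + 2 * n - i, by ring⟩
  simp only [Module.End.mul_apply, LinearMap.sub_apply, J0_ket, Jm_ket, Jp_ket, K0_ket, Kp_ket,
    Km_ket, map_smul, map_add, LinearMap.smul_apply, LinearMap.zero_apply, smul_add, smul_smul]
  have hu' : 0 ≤ u := by omega
  have i0 := sr_sq hi
  have i1 := sr_sq (x := 1 + i) (by omega)
  have i2 := sr_sq (x := 2 + i) (by omega)
  have im := sr_mul_pred hi
  have u0 := sr_sq hu'
  have u1 := sr_sq (x := 1 + u) (by omega)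
  have u2 := sr_sq (x := 2 + u) (by omega)
  have um := sr_mul_pred hu'
  rw [hk]
  ring_nf
  ring_nf at i0 i1 i2 im u0 u1 u2 um
  match_scalars <;> push_cast at * <;> grind

theorem rel8 : Jm k ρ * Km k ρ - Km k ρ * Jm k ρ = 0 := by
  refine end_ext k ρ fun n i hn hi hu => ?_
  obtain ⟨u, hk⟩ : ∃ u, |k| = u + i - 2 * n := ⟨|k| + 2 * n - i, by ring⟩
  simp only [Module.End.mul_apply, LinearMap.sub_apply, J0_ket, Jm_ket, Jp_ket, K0_ket, Kp_ket,
    Km_ket, map_smul, map_add, LinearMap.smul_apply, LinearMap.zero_apply, smul_add, smul_smul]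
  have hu' : 0 ≤ u := by omega
  have i0 := sr_sq hi
  have i1 := sr_sq (x := 1 + i) (by omega)
  have i2 := sr_sq (x := 2 + i) (by omega)
  have im := sr_mul_pred hi
  have u0 := sr_sq hu'
  have u1 := sr_sq (x := 1 + u) (by omega)
  have u2 := sr_sq (x := 2 + u) (by omega)
  have um := sr_mul_pred hu'
  rw [hk]
  ring_nf
  ring_nf at i0 i1 i2 im u0 u1 u2 um
  match_scalars <;> push_cast at * <;> grind

theorem jval_cast (n : ℤ) : ((jval k n : ℝ) : ℂ) = ((|k| + 2 * n : ℤ) : ℂ) / 2 := by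
  have h : ((|(k : ℝ)| : ℝ) : ℂ) = ((|k| : ℤ) : ℂ) := by
    rw [← Int.cast_abs, Complex.ofReal_intCast]
  simp only [jval]
  push_cast
  rw [h]
  ring

theorem pz_step {n : ℤ} (hn : 0 ≤ n) :
    ((|k| + 2 * n : ℤ) : ℂ) * pz k ρ n = ((|k| + 2 * n : ℤ) + 4) * pz k ρ (n + 1) := by
  simp only [pz, Pzero, jval_cast]
  have hk := abs_nonneg k
  obtain ⟨N, hN⟩ : ∃ N : ℕ, |k| + 2 * n = N := ⟨(|k| + 2 * n).toNat, by omega⟩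
  have hN2 : |k| + 2 * (n + 1) = (N : ℤ) + 2 := by omega
  rw [hN, hN2]
  push_cast
  have h2 : ((N : ℂ) + 2) ≠ 0 := by exact_mod_cast (by omega : N + 2 ≠ 0)
  have h4 : ((N : ℂ) + 4) ≠ 0 := by exact_mod_cast (by omega : N + 4 ≠ 0)
  rcases Nat.eq_zero_or_pos N with rfl | hpos
  · have : k = 0 := by
      have : |k| = 0 := by omega
      exact abs_eq_zero.mp this
    simp [this]
  · have h0 : (N : ℂ) ≠ 0 := by exact_mod_cast hpos.ne'
    rw [if_neg (by simp [h0]), if_neg (by simp [h2])]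
    have e1 : (N : ℂ) / 2 + 1 = (N + 2) / 2 := by ring
    have e2 : ((N : ℂ) + 2) / 2 + 1 = (N + 4) / 2 := by ring
    rw [e1, e2]
    field_simp

theorem pz_mul (n : ℤ) (h : 0 < |k| + 2 * n) :
    pz k ρ n * (((|k| + 2 * n : ℤ) : ℂ) * ((|k| + 2 * n : ℤ) + 2)) = 2 * Complex.I * k * ρ := by
  simp only [pz, Pzero, jval_cast]
  obtain ⟨N, hN⟩ : ∃ N : ℕ, |k| + 2 * n = N := ⟨(|k| + 2 * n).toNat, by omega⟩
  rw [hN] at h ⊢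
  push_cast
  have h0 : (N : ℂ) ≠ 0 := by exact_mod_cast (by omega : N ≠ 0)
  have h2 : ((N : ℂ) + 2) ≠ 0 := by exact_mod_cast (by omega : N + 2 ≠ 0)
  rw [if_neg (by simp [h0])]
  have e1 : (N : ℂ) / 2 + 1 = (N + 2) / 2 := by ring
  rw [e1]
  field_simp

theorem pm_sq (n : ℤ) :
    pm k ρ n ^ 2 = (((|k| + 2 * n : ℤ) : ℂ) ^ 2 - k ^ 2) * (((|k| + 2 * n : ℤ) : ℂ) ^ 2 - 4 * ρ ^ 2)
      / (4 * ((|k| + 2 * n : ℤ) : ℂ) ^ 2 * ((|k| + 2 * n : ℤ) + 1) * ((|k| + 2 * n : ℤ) - 1)) := by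
  have hs : ∀ z : ℂ, csqrt z ^ 2 = z := fun z => by rw [pow_two, csqrt_mul_self]
  simp only [pm, Pminus, jval_cast, div_pow, mul_pow, hs]
  generalize ((|k| + 2 * n : ℤ) : ℂ) = N
  rw [show (N / 2 + k / 2) * (N / 2 - k / 2) * (N / 2 + ρ) * (N / 2 - ρ) =
    ((N ^ 2 - k ^ 2) * (N ^ 2 - 4 * ρ ^ 2)) / 16 by ring,
    show N ^ 2 / 2 ^ 2 * (2 * (N / 2) + 1) * (2 * (N / 2) - 1) =
      (4 * N ^ 2 * (N + 1) * (N - 1)) / 16 by ring]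
  rw [div_div_div_cancel_right₀ (by norm_num)]

theorem p_identity {n : ℤ} (hn : 0 ≤ n) (h : 0 < |k| + 2 * n) :
    pm k ρ (n + 1) ^ 2 * ((|k| + 2 * n : ℤ) + 3) - pz k ρ n ^ 2
      - pm k ρ n ^ 2 * ((|k| + 2 * n : ℤ) - 1) = 1 := by
  have hz := pz_mul k ρ n h
  have hp := pm_sq k ρ n
  have hp' := pm_sq k ρ (n + 1)
  have hk2 : ((|k| : ℤ) : ℂ) ^ 2 = (k : ℂ) ^ 2 := by exact_mod_cast sq_abs k
  obtain ⟨N, hN⟩ : ∃ N : ℕ, |k| + 2 * n = N := ⟨(|k| + 2 * n).toNat, by omega⟩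
  have hN2 : |k| + 2 * (n + 1) = (N : ℤ) + 2 := by omega
  have hkN : N = 1 → (k : ℂ) ^ 2 = 1 := by
    rintro rfl
    have hk : |k| = 1 := by have := abs_nonneg k; omega
    rw [← hk2, hk]; simp
  rw [hN] at h hz hp ⊢
  rw [hN2] at hp'
  push_cast at *
  have h0 : (N : ℂ) ≠ 0 := by exact_mod_cast (by omega : N ≠ 0)
  have h1 : ((N : ℂ) + 1) ≠ 0 := by exact_mod_cast (by omega : N + 1 ≠ 0)
  have h2 : ((N : ℂ) + 2) ≠ 0 := by exact_mod_cast (by omega : N + 2 ≠ 0)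
  have h3 : ((N : ℂ) + 3) ≠ 0 := by exact_mod_cast (by omega : N + 3 ≠ 0)
  have q1 : pm k ρ n ^ 2 * (N - 1) =
      ((N : ℂ) ^ 2 - k ^ 2) * ((N : ℂ) ^ 2 - 4 * ρ ^ 2) / (4 * (N : ℂ) ^ 2 * (N + 1)) := by
    by_cases hN1 : N = 1
    · rw [hkN hN1]; subst hN1; simp
    · have : ((N : ℂ) - 1) ≠ 0 := sub_ne_zero.mpr (by exact_mod_cast hN1)
      rw [hp]; field_simp
  have q2 : pm k ρ (n + 1) ^ 2 * (N + 3) =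
      (((N : ℂ) + 2) ^ 2 - k ^ 2) * (((N : ℂ) + 2) ^ 2 - 4 * ρ ^ 2)
        / (4 * ((N : ℂ) + 2) ^ 2 * (N + 1)) := by
    rw [hp', show (N : ℂ) + 2 + 1 = N + 3 by ring, show (N : ℂ) + 2 - 1 = N + 1 by ring]
    field_simp
  have q3 : pz k ρ n ^ 2 = -(4 * k ^ 2 * ρ ^ 2) / ((N : ℂ) ^ 2 * (N + 2) ^ 2) := by
    rw [eq_div_iff (by simp [h0, h2]), ← mul_pow, ← mul_pow, hz]
    simp only [mul_pow, Complex.I_sq]; ring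
  rw [q1, q2, q3]
  field_simp
  ring

theorem rel9 : K0 k ρ * Kp k ρ - Kp k ρ * K0 k ρ = -Jp k ρ := by
  refine end_ext k ρ fun n i hn hi hu => ?_
  obtain ⟨u, hk⟩ : ∃ u, |k| = u + i - 2 * n := ⟨|k| + 2 * n - i, by ring⟩
  simp only [Module.End.mul_apply, LinearMap.sub_apply, J0_ket, Jm_ket, Jp_ket, K0_ket, Kp_ket,
    Km_ket, map_smul, map_add, LinearMap.smul_apply, LinearMap.neg_apply, smul_add, smul_smul]
  have hu' : 0 ≤ u := by omega
  have i0 := sr_sq hi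
  have i1 := sr_sq (x := 1 + i) (by omega)
  have i2 := sr_sq (x := 2 + i) (by omega)
  have im := sr_mul_pred hi
  have u0 := sr_sq hu'
  have u1 := sr_sq (x := 1 + u) (by omega)
  have u2 := sr_sq (x := 2 + u) (by omega)
  have um := sr_mul_pred hu'
  have q1 := pz_step k ρ hn
  have q2 : pm k ρ n * (((|k| + 2 * n : ℤ) - 2) * pz k ρ (n - 1)
      - ((|k| + 2 * n : ℤ) + 2) * pz k ρ n) = 0 := by
    rcases hn.eq_or_lt with rfl | hn'
    · rw [show pm k ρ 0 = 0 from Pminus_bot k ρ, zero_mul]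
    · have := pz_step k ρ (n := n - 1) (by omega)
      rw [sub_add_cancel] at this
      push_cast at this ⊢
      linear_combination pm k ρ n * this
  have q3 : sr u * (pm k ρ (n + 1) ^ 2 * ((|k| + 2 * n : ℤ) + 3) - pz k ρ n ^ 2
      - pm k ρ n ^ 2 * ((|k| + 2 * n : ℤ) - 1) - 1) = 0 := by
    rcases hu'.eq_or_lt with rfl | hu1
    · simp [sr]
    · rw [p_identity k ρ hn (by omega)]; ring
  rw [hk] at q1 q2 q3 ⊢
  ring_nf
  ring_nf at q1 q2 q3 i0 i1 i2 im u0 u1 u2 um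
  push_cast at *
  match_scalars
  · ring
  · linear_combination pm k ρ (1 + n) * sr (1 + i) * sr (2 + i) / 2 * q1
      + pm k ρ (1 + n) * sr (1 + i) * sr (2 + i) * pz k ρ n * u0
      - pm k ρ (1 + n) * sr (1 + i) * sr (2 + i) * pz k ρ (1 + n) * u1
  · linear_combination -sr (1 + i) * q3 - pm k ρ (1 + n) ^ 2 * sr (1 + i) * sr u * i2
      + sr (1 + i) * pm k ρ n ^ 2 * um - pm k ρ (1 + n) ^ 2 * sr (1 + i) * sr u * u1
      + sr (1 + i) * sr u * pm k ρ n ^ 2 * i0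
  · linear_combination -(1 / 2) * sr u * sr (-1 + u) * q2
      + sr u * pm k ρ n * sr (-1 + u) * pz k ρ n * i1
      - sr u * pm k ρ n * sr (-1 + u) * pz k ρ (-1 + n) * i0
  · ring

theorem relations : LadderRelations (J0 k ρ) (Jp k ρ) (Jm k ρ) (K0 k ρ) (Kp k ρ) (Km k ρ) :=
  .of_generating (rel1 k ρ) (rel2 k ρ) (rel3 k ρ) (rel4 k ρ) (rel5 k ρ) (rel6 k ρ) (rel7 k ρ)
    (rel8 k ρ) (rel9 k ρ)

/-- `V_{λ,ρ}` as a module over `𝔰𝔭𝔦𝔫(3,1)_ℂ`. -/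
noncomputable instance : LieRingModule Spin31 (V k ρ) where
  bracket x v := ladderMap (J0 k ρ) (Jp k ρ) (Jm k ρ) (K0 k ρ) (Kp k ρ) (Km k ρ) x v
  add_lie x y v := by rw [map_add]; rfl
  lie_add x v w := map_add _ v w
  leibniz_lie x y v := by
    rw [(relations k ρ).map_lie, LinearMap.sub_apply, Module.End.mul_apply,
      Module.End.mul_apply, sub_add_cancel]

noncomputable instance : LieModule ℂ Spin31 (V k ρ) where
  smul_lie c x v := LinearMap.congr_fun (map_smul (ladderMap _ _ _ _ _ _) c x) v
  lie_smul c x v := map_smul (ladderMap _ _ _ _ _ _ x) c v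

end V

/-! ### The finite-dimensional modules -/

/-- The underlying space of the module `F^A_γ`, `γ = a / 2`, with basis the `|γ_A,μ⟩`,
`μ = -γ + i`, `0 ≤ i ≤ a`. Here `A = -1` gives the left module `(γ,0)` and `A = 1` the right
module `(0,γ)`. -/
def F (_A : ℤˣ) (a : ℕ) : Type := Fin (a + 1) →₀ ℂ

namespace F

variable (A : ℤˣ) (a : ℕ)

noncomputable instance : AddCommGroup (F A a) := inferInstanceAs (AddCommGroup (Fin (a + 1) →₀ ℂ))
noncomputable instance : Module ℂ (F A a) := inferInstanceAs (Module ℂ (Fin (a + 1) →₀ ℂ))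

/-- The basis vector `|γ_A,μ⟩`, `μ = -γ + i`, and `0` if there is none. -/
noncomputable def ket (i : ℤ) : F A a :=
  if h : 0 ≤ i ∧ i.toNat < a + 1 then
    Finsupp.single (⟨i.toNat, h.2⟩ : Fin (a + 1)) (1 : ℂ)
  else 0

/-- The linear operator with prescribed values on the basis vectors. -/
noncomputable def op (f : ℤ → F A a) : Module.End ℂ (F A a) :=
  Finsupp.linearCombination ℂ (fun i : Fin (a + 1) => f (i : ℕ))

/-- The magnetic number `μ = i - γ`. -/
noncomputable def muval (a : ℕ) (i : ℤ) : ℝ := i - a / 2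

/-- `J₀ |γ_A,μ⟩ = μ |γ_A,μ⟩`. -/
noncomputable def J0 : Module.End ℂ (F A a) :=
  op A a fun i => (muval a i : ℂ) • ket A a i

/-- `J₊ |γ_A,μ⟩ = √(γ-μ) √(γ+μ+1) |γ_A,μ+1⟩`. -/
noncomputable def Jp : Module.End ℂ (F A a) :=
  op A a fun i => ((√(a / 2 - muval a i) * √(a / 2 + muval a i + 1) : ℝ) : ℂ) • ket A a (i + 1)

/-- `J₋ |γ_A,μ⟩ = √(γ+μ) √(γ-μ+1) |γ_A,μ-1⟩`. -/
noncomputable def Jm : Module.End ℂ (F A a) :=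
  op A a fun i => ((√(a / 2 + muval a i) * √(a / 2 - muval a i + 1) : ℝ) : ℂ) • ket A a (i - 1)

/-- `K₀ = i A J₀` on `F^A_γ`. -/
noncomputable def K0 : Module.End ℂ (F A a) := (Complex.I * ((A : ℤ) : ℂ)) • J0 A a

/-- `K₊ = i A J₊` on `F^A_γ`. -/
noncomputable def Kp : Module.End ℂ (F A a) := (Complex.I * ((A : ℤ) : ℂ)) • Jp A a

/-- `K₋ = i A J₋` on `F^A_γ`. -/
noncomputable def Km : Module.End ℂ (F A a) := (Complex.I * ((A : ℤ) : ℂ)) • Jm A a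

theorem ket_eq_zero {i : ℤ} (h : ¬(0 ≤ i ∧ i.toNat < a + 1)) : ket A a i = 0 := dif_neg h

theorem op_ket (f : ℤ → F A a) (i : ℤ) (hf : ¬(0 ≤ i ∧ i.toNat < a + 1) → f i = 0) :
    op A a f (ket A a i) = f i := by
  by_cases h : 0 ≤ i ∧ i.toNat < a + 1
  · have e1 : ket A a i = Finsupp.single (⟨i.toNat, h.2⟩ : Fin (a + 1)) (1 : ℂ) := dif_pos h
    have e : op A a f (ket A a i) = f i.toNat := by
      rw [e1]
      exact (Finsupp.linearCombination_single ℂ _ _).trans (one_smul _ _)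
    rw [e, Int.toNat_of_nonneg h.1]
  · rw [ket_eq_zero A a h, map_zero, hf h]

theorem end_ext {S T : Module.End ℂ (F A a)}
    (h : ∀ i : ℤ, 0 ≤ i → 0 ≤ a - i → S (ket A a i) = T (ket A a i)) : S = T := by
  refine Finsupp.lhom_ext' fun p => LinearMap.ext_ring ?_
  have e : ket A a (p : ℕ) = Finsupp.single p (1 : ℂ) := dif_pos ⟨by omega, by have := p.isLt; omega⟩
  have := h (p : ℕ) (by omega) (by have := p.isLt; omega)
  rw [e] at this
  exact this

theorem J0_ket (i : ℤ) : J0 A a (ket A a i) = ((i : ℂ) - a / 2) • ket A a i := by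
  rw [J0, op_ket]
  · simp [muval]
  · intro h; rw [ket_eq_zero A a h, smul_zero]

theorem Jp_ket (i : ℤ) :
    Jp A a (ket A a i) = (V.sr (a - i) * V.sr (i + 1)) • ket A a (i + 1) := by
  have e : ∀ i : ℤ, ((√(a / 2 - muval a i) * √(a / 2 + muval a i + 1) : ℝ) : ℂ)
      = V.sr (a - i) * V.sr (i + 1) := by
    intro i
    rw [show (a : ℝ) / 2 - muval a i = ((a - i : ℤ) : ℝ) by simp only [muval]; push_cast; ring,
      show (a : ℝ) / 2 + muval a i = i by simp only [muval]; ring]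
    simp [V.sr]
  rw [Jp, op_ket]
  · simp only [e]
  · intro h
    simp only [e]
    rcases eq_or_ne i (-1) with rfl | h1
    · simp [V.sr]
    · rw [ket_eq_zero A a (i := i + 1) (by omega), smul_zero]

theorem Jm_ket (i : ℤ) :
    Jm A a (ket A a i) = (V.sr i * V.sr (a - i + 1)) • ket A a (i - 1) := by
  have e : ∀ i : ℤ, ((√(a / 2 + muval a i) * √(a / 2 - muval a i + 1) : ℝ) : ℂ)
      = V.sr i * V.sr (a - i + 1) := by
    intro i
    rw [show (a : ℝ) / 2 - muval a i = ((a - i : ℤ) : ℝ) by simp only [muval]; push_cast; ring,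
      show (a : ℝ) / 2 + muval a i = i by simp only [muval]; ring]
    simp [V.sr]
  rw [Jm, op_ket]
  · simp only [e]
  · intro h
    simp only [e]
    rcases eq_or_ne i (a + 1) with rfl | h1
    · simp [V.sr]
    · rw [ket_eq_zero A a (i := i - 1) (by omega), smul_zero]

theorem rel1 : J0 A a * Jp A a - Jp A a * J0 A a = Jp A a := by
  refine end_ext A a fun i hi hu => ?_
  simp only [Module.End.mul_apply, LinearMap.sub_apply, J0_ket, Jp_ket, map_smul]
  match_scalars
  push_cast
  ring

theorem rel2 : J0 A a * Jm A a - Jm A a * J0 A a = -Jm A a := by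
  refine end_ext A a fun i hi hu => ?_
  simp only [Module.End.mul_apply, LinearMap.sub_apply, J0_ket, Jm_ket, map_smul,
    LinearMap.neg_apply]
  match_scalars
  push_cast
  ring

theorem rel3 : Jp A a * Jm A a - Jm A a * Jp A a = (2 : ℂ) • J0 A a := by
  refine end_ext A a fun i hi hu => ?_
  obtain ⟨u, hk⟩ : ∃ u, (a : ℤ) = u + i := ⟨a - i, by ring⟩
  have hc : (a : ℂ) = u + i := by exact_mod_cast congrArg (Int.cast : ℤ → ℂ) hk
  simp only [Module.End.mul_apply, LinearMap.sub_apply, J0_ket, Jm_ket, Jp_ket, map_smul,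
    LinearMap.smul_apply, smul_smul, hc, hk]
  have hu' : 0 ≤ u := by omega
  have i0 := V.sr_sq hi
  have i1 := V.sr_sq (x := 1 + i) (by omega)
  have u0 := V.sr_sq hu'
  have u1 := V.sr_sq (x := 1 + u) (by omega)
  clear hk hc
  ring_nf
  ring_nf at i0 i1 u0 u1
  match_scalars
  push_cast at *
  grind

theorem relations : LadderRelations (J0 A a) (Jp A a) (Jm A a) (K0 A a) (Kp A a) (Km A a) := by
  have h1 := rel1 A a
  have h2 := rel2 A a
  have h3 := rel3 A a
  have hA : (Complex.I * ((A : ℤ) : ℂ)) * (Complex.I * ((A : ℤ) : ℂ)) = -1 := by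
    have : ((A : ℤ) : ℂ) * ((A : ℤ) : ℂ) = 1 := by
      rcases Int.units_eq_one_or A with rfl | rfl <;> simp
    linear_combination Complex.I ^ 2 * this + Complex.I_sq
  have h3' : Jm A a * Jp A a - Jp A a * Jm A a = -(2 : ℂ) • J0 A a := by
    rw [neg_smul, ← h3, neg_sub]
  have h2' : Jm A a * J0 A a - J0 A a * Jm A a = Jm A a := by
    rw [← neg_sub, h2, neg_neg]
  refine .of_generating h1 h2 h3 ?_ ?_ ?_ ?_ ?_ ?_ <;>
    simp only [K0, Kp, Km, mul_smul_comm, smul_mul_assoc, ← smul_sub, h1, h3', h2', sub_self,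
      smul_zero, smul_smul, hA, mul_comm]
  · rw [neg_one_smul]

/-- `F^A_γ` as a module over `𝔰𝔭𝔦𝔫(3,1)_ℂ`. -/
noncomputable instance : LieRingModule Spin31 (F A a) where
  bracket x v := ladderMap (J0 A a) (Jp A a) (Jm A a) (K0 A a) (Kp A a) (Km A a) x v
  add_lie x y v := by rw [map_add]; rfl
  lie_add x v w := map_add _ v w
  leibniz_lie x y v := by
    rw [(relations A a).map_lie, LinearMap.sub_apply, Module.End.mul_apply,
      Module.End.mul_apply, sub_add_cancel]

noncomputable instance : LieModule ℂ Spin31 (F A a) where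
  smul_lie c x v := LinearMap.congr_fun (map_smul (ladderMap _ _ _ _ _ _) c x) v
  lie_smul c x v := map_smul (ladderMap _ _ _ _ _ _ x) c v

end F

/-- The finite-dimensional module `(γ₁,γ₂) = F⁻_{γ₁} ⊗ F⁺_{γ₂}`, with `γ₁ = a / 2`,
`γ₂ = b / 2`. -/
abbrev FinDim (a b : ℕ) : Type := F (-1) a ⊗[ℂ] F 1 b

/-! ### The Casimirs -/

section Casimir

universe u

variable (W : Type u) [AddCommGroup W] [Module ℂ W] [LieRingModule Spin31 W]
  [LieModule ℂ Spin31 W]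

/-- `𝒞₁ = J · K`, acting on a module. -/
noncomputable def casimir₁ : Module.End ℂ W :=
  ∑ a : Fin 3, LieModule.toEnd ℂ Spin31 W (Spin31.J a) * LieModule.toEnd ℂ Spin31 W (Spin31.K a)

/-- `𝒞₂ = J² - K²`, acting on a module. -/
noncomputable def casimir₂ : Module.End ℂ W :=
  ∑ a : Fin 3, (LieModule.toEnd ℂ Spin31 W (Spin31.J a) ^ 2
    - LieModule.toEnd ℂ Spin31 W (Spin31.K a) ^ 2)

/-- The two Casimirs are simultaneously diagonalisable on `W`: there is a basis of `W` whose
elements are eigenvectors of both. -/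
def CasimirsDiagonalisable : Prop :=
  ∃ (ι : Type u) (B : Module.Basis ι ℂ W), ∀ i : ι, ∃ c₁ c₂ : ℂ,
    casimir₁ W (B i) = c₁ • B i ∧ casimir₂ W (B i) = c₂ • B i

end Casimir

/-- The pair of Casimir values attached to `(Λ,P)`: `(i Λ P, Λ² + P² - 1)`. -/
noncomputable def casimirValues (p : ℂ × ℂ) : ℂ × ℂ :=
  (Complex.I * p.1 * p.2, p.1 ^ 2 + p.2 ^ 2 - 1)

/-- The double of `Λ = λ + ν₁ + ν₂`, where `λ = k / 2`, `ν₁ = p₁ - a / 2`, `ν₂ = p₂ - b / 2`. -/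
def twoLam (a b : ℕ) (k : ℤ) (p : Fin (a + 1) × Fin (b + 1)) : ℤ :=
  k + (2 * (p.1 : ℕ) - a) + (2 * (p.2 : ℕ) - b)

/-- `P = ρ - ν₁ + ν₂`, where `ν₁ = p₁ - a / 2`, `ν₂ = p₂ - b / 2`. -/
noncomputable def rhoNew (a b : ℕ) (ρ : ℂ) (p : Fin (a + 1) × Fin (b + 1)) : ℂ :=
  ρ - ((p.1 : ℕ) - a / 2) + ((p.2 : ℕ) - b / 2)

end Lorentz

namespace Lorentz

/-- An invariant subspace contains the components of its elements along the eigenspaces. -/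
theorem component_mem_of_invariant {W : Type*} [AddCommGroup W] [Module ℂ W] {f : Module.End ℂ W}
    {P : Submodule ℂ W} (hP : ∀ x ∈ P, f x ∈ P) (s : Finset ℂ) :
    ∀ m : ℂ → W, (∀ μ ∈ s, f (m μ) = μ • m μ) → ∑ μ ∈ s, m μ ∈ P → ∀ μ ∈ s, m μ ∈ P := by
  classical
  induction s using Finset.induction_on with
  | empty => intro m _ _ μ hμ; simp at hμ
  | insert a s ha ih =>
    intro m hm hs
    have h1 : ∑ μ ∈ s, (μ - a) • m μ ∈ P := by
      have h2 : ∑ μ ∈ s, (μ - a) • m μ =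
          f (∑ μ ∈ insert a s, m μ) - a • ∑ μ ∈ insert a s, m μ := by
        rw [map_sum, Finset.smul_sum, ← Finset.sum_sub_distrib, Finset.sum_insert ha,
          hm a (Finset.mem_insert_self a s), sub_self, zero_add]
        refine Finset.sum_congr rfl fun μ hμ => ?_
        rw [hm μ (Finset.mem_insert_of_mem hμ), sub_smul]
      rw [h2]
      exact P.sub_mem (hP _ hs) (P.smul_mem a hs)
    have h3 : ∀ μ ∈ s, m μ ∈ P := fun μ hμ => by
      have h4 := ih (fun μ => (μ - a) • m μ)
        (fun μ hμ => by rw [map_smul, hm μ (Finset.mem_insert_of_mem hμ), smul_comm]) h1 μ hμ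
      have hne : μ - a ≠ 0 := sub_ne_zero.mpr fun h => ha (by rwa [h] at hμ)
      exact (P.smul_mem_iff hne).mp h4
    intro μ hμ
    rcases Finset.mem_insert.mp hμ with rfl | hμ
    · rw [Finset.sum_insert ha] at hs
      exact (P.add_mem_iff_left (P.sum_mem h3)).mp hs
    · exact h3 μ hμ

/-- The restriction of a diagonalisable operator to an invariant subspace is diagonalisable. -/
theorem iSup_eigenspace_restrict_eq_top {W : Type*} [AddCommGroup W] [Module ℂ W]
    {f : Module.End ℂ W} {P : Submodule ℂ W} (hP : ∀ x ∈ P, f x ∈ P)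
    (h : ⨆ μ, Module.End.eigenspace f μ = ⊤) :
    ⨆ μ, Module.End.eigenspace (f.restrict hP) μ = ⊤ := by
  rw [eq_top_iff]
  rintro ⟨x, hx⟩ -
  have h' : x ∈ ⨆ μ, Module.End.eigenspace f μ := by rw [h]; trivial
  obtain ⟨m, hm, rfl⟩ := (Submodule.mem_iSup_iff_exists_finsupp _ _).mp h'
  have hc := component_mem_of_invariant hP m.support m
    (fun μ _ => Module.End.mem_eigenspace_iff.mp (hm μ)) hx
  have e : (⟨m.sum fun _ x => x, hx⟩ : P) =
      ∑ μ ∈ m.support.attach, ⟨m μ, hc μ μ.2⟩ := by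
    ext
    rw [AddSubmonoidClass.coe_finsetSum, Finset.sum_attach m.support (fun μ => m μ)]
    rfl
  rw [e]
  refine Submodule.sum_mem _ fun μ _ => Submodule.mem_iSup_of_mem (μ : ℂ) ?_
  rw [Module.End.mem_eigenspace_iff]
  ext
  exact Module.End.mem_eigenspace_iff.mp (hm μ)

/-- Operators `S₀, S₊, S₋` on a vector space that satisfy the relations of `𝔰𝔩₂`. -/
structure SpinOps (W : Type*) [AddCommGroup W] [Module ℂ W] where
  /-- the weight operator -/
  S0 : Module.End ℂ W
  /-- the raising operator -/
  Sp : Module.End ℂ W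
  /-- the lowering operator -/
  Sm : Module.End ℂ W
  zero_plus : ∀ x, S0 (Sp x) = Sp (S0 x) + Sp x
  zero_minus : ∀ x, S0 (Sm x) = Sm (S0 x) - Sm x
  plus_minus : ∀ x, Sp (Sm x) = Sm (Sp x) + (2 : ℂ) • S0 x

namespace SpinOps

variable {W : Type*} [AddCommGroup W] [Module ℂ W] (S : SpinOps W)

/-- Four times the quadratic Casimir, plus one. -/
noncomputable def cas : Module.End ℂ W := (4 : ℂ) • (S.Sm * S.Sp + S.S0 * S.S0 + S.S0) + 1

theorem cas_apply (x : W) :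
    S.cas x = (4 : ℂ) • (S.Sm (S.Sp x) + S.S0 (S.S0 x) + S.S0 x) + x := by
  simp [cas]

/-- `x` is a highest weight vector (possibly zero) of weight `j`. -/
structure IsHighest (j : ℂ) (x : W) : Prop where
  weight : S.S0 x = j • x
  raise : S.Sp x = 0

variable {S}

theorem weight_Sp_pow {μ : ℂ} {x : W} (h : S.S0 x = μ • x) (n : ℕ) :
    S.S0 ((S.Sp ^ n) x) = (μ + n) • (S.Sp ^ n) x := by
  induction n with
  | zero => simpa using h
  | succ n ih =>
    rw [pow_succ', Module.End.mul_apply, S.zero_plus, ih, map_smul]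
    push_cast
    module

theorem weight_Sm_pow {μ : ℂ} {x : W} (h : S.S0 x = μ • x) (n : ℕ) :
    S.S0 ((S.Sm ^ n) x) = (μ - n) • (S.Sm ^ n) x := by
  induction n with
  | zero => simpa using h
  | succ n ih =>
    rw [pow_succ', Module.End.mul_apply, S.zero_minus, ih, map_smul]
    push_cast
    module

theorem Sp_Sm_pow {μ : ℂ} {x : W} (h : S.S0 x = μ • x) (n : ℕ) :
    S.Sp ((S.Sm ^ (n + 1)) x) =
      (S.Sm ^ (n + 1)) (S.Sp x) + ((n + 1) * (2 * μ - n)) • (S.Sm ^ n) x := by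
  induction n with
  | zero => simp [S.plus_minus, h, smul_smul]
  | succ n ih =>
    have e : ∀ y, (S.Sm ^ (n + 1 + 1)) y = S.Sm ((S.Sm ^ (n + 1)) y) := fun y => by
      rw [pow_succ', Module.End.mul_apply]
    have e' : ∀ y, (S.Sm ^ (n + 1)) y = S.Sm ((S.Sm ^ n) y) := fun y => by
      rw [pow_succ', Module.End.mul_apply]
    rw [e, S.plus_minus, ih, weight_Sm_pow h, map_add, map_smul, ← e, ← e']
    push_cast
    module

theorem IsHighest.Sp_pow_Sm_pow {j : ℂ} {y : W} (h : S.IsHighest j y) (N : ℕ)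
    (hj : ∀ s : ℕ, s < N → 2 * j ≠ s) :
    ∃ c : ℂ, c ≠ 0 ∧ (S.Sp ^ N) ((S.Sm ^ N) y) = c • y := by
  induction N with
  | zero => exact ⟨1, one_ne_zero, by simp⟩
  | succ N ih =>
    obtain ⟨c, hc, e⟩ := ih fun s hs => hj s (by omega)
    refine ⟨(N + 1) * (2 * j - N) * c,
      mul_ne_zero (mul_ne_zero (by exact_mod_cast N.succ_ne_zero)
        (sub_ne_zero.mpr (hj N (by omega)))) hc, ?_⟩
    rw [pow_succ S.Sp, Module.End.mul_apply, Sp_Sm_pow h.weight, h.raise, map_zero, zero_add,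
      map_smul, e, smul_smul]

theorem mem_of_weight_nat {P : Submodule ℂ W} (hm : ∀ x ∈ P, S.Sm x ∈ P)
    (hP : ∀ j x, S.IsHighest j x → x ∈ P) (n N : ℕ) :
    ∀ x, S.S0 x = (n / 2 : ℂ) • x → (S.Sp ^ N) x = 0 → x ∈ P := by
  induction N with
  | zero => intro x _ hx; simp only [pow_zero, Module.End.one_apply] at hx; rw [hx]; exact P.zero_mem
  | succ N ih =>
    intro x hx hN
    have hy : S.IsHighest (n / 2 + N) ((S.Sp ^ N) x) :=
      ⟨weight_Sp_pow hx N, by rw [← Module.End.mul_apply, ← pow_succ', hN]⟩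
    obtain ⟨c, hc, e⟩ := hy.Sp_pow_Sm_pow N fun s hs h => by
      have : ((n + 2 * N : ℕ) : ℂ) = s := by push_cast; linear_combination h
      have := Nat.cast_injective this
      omega
    have hmem : ∀ s : ℕ, (S.Sm ^ s) ((S.Sp ^ N) x) ∈ P := fun s => by
      induction s with
      | zero => simpa using hP _ _ hy
      | succ s ihs => rw [pow_succ', Module.End.mul_apply]; exact hm _ ihs
    have hw := weight_Sm_pow hy.weight N
    rw [add_sub_cancel_right] at hw
    have := ih (x - c⁻¹ • (S.Sm ^ N) ((S.Sp ^ N) x))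
      (by rw [map_sub, map_smul, hx, hw]; module)
      (by rw [map_sub, map_smul, e, smul_smul, inv_mul_cancel₀ hc, one_smul, sub_self])
    simpa using P.add_mem this (P.smul_mem c⁻¹ (hmem N))

/-- The vectors on which `S₋` is nilpotent modulo `P` and whose weight is not half a natural number
lie in `P` as soon as `S₊` maps them to `P`. -/
theorem mem_of_weight_not_nat {P : Submodule ℂ W} (hp : ∀ x ∈ P, S.Sp x ∈ P)
    (hm : ∀ x ∈ P, S.Sm x ∈ P) {μ : ℂ} {x : W} (hx : S.S0 x = μ • x) (hμ : ∀ n : ℕ, 2 * μ ≠ n)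
    (hSx : S.Sp x ∈ P) (nil : ∃ N : ℕ, (S.Sm ^ N) x = 0) : x ∈ P := by
  obtain ⟨N, hN⟩ := nil
  replace hN : (S.Sm ^ N) x ∈ P := by rw [hN]; exact P.zero_mem
  have hpow : ∀ (s : ℕ) (y : W), y ∈ P → (S.Sm ^ s) y ∈ P := fun s y hy => by
    induction s with
    | zero => simpa using hy
    | succ s ihs => rw [pow_succ', Module.End.mul_apply]; exact hm _ ihs
  induction N with
  | zero => simpa using hN
  | succ N ih =>
    refine ih ?_
    have h1 := hp _ hN
    rw [Sp_Sm_pow hx] at h1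
    have h2 := (P.add_mem_iff_right (hpow (N + 1) _ hSx)).mp h1
    have hc : ((N : ℂ) + 1) * (2 * μ - N) ≠ 0 :=
      mul_ne_zero (by exact_mod_cast N.succ_ne_zero) (sub_ne_zero.mpr (hμ N))
    exact (P.smul_mem_iff hc).mp h2

theorem IsHighest.exists_nat {j : ℂ} {x : W} (h : S.IsHighest j x) (hx : x ≠ 0)
    (nil : ∃ N : ℕ, (S.Sm ^ N) x = 0) : ∃ n : ℕ, 2 * j = n := by
  by_contra! hj
  exact hx ((Submodule.mem_bot ℂ).mp (mem_of_weight_not_nat (S := S) (P := ⊥) (by simp) (by simp)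
    h.weight hj (by simp [h.raise]) nil))

theorem IsHighest.Sm_pow_eq_zero {n : ℕ} {x : W} (h : S.IsHighest (n / 2) x)
    (nil : ∀ y, ∃ N : ℕ, (S.Sm ^ N) y = 0) : (S.Sm ^ (n + 1)) x = 0 := by
  by_contra hx
  have hz : S.IsHighest (n / 2 - (n + 1 : ℕ)) ((S.Sm ^ (n + 1)) x) := by
    refine ⟨weight_Sm_pow h.weight _, ?_⟩
    rw [Sp_Sm_pow h.weight, h.raise, map_zero, zero_add]
    simp [mul_div_cancel₀]
  obtain ⟨m, hm⟩ := hz.exists_nat hx (nil _)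
  have : ((m + n + 2 : ℕ) : ℂ) = (0 : ℕ) := by push_cast at hm ⊢; linear_combination -hm
  have := Nat.cast_injective this
  omega

/-- Complete reducibility of locally finite modules: a submodule that contains all highest weight
vectors is everything. -/
theorem eq_top_of_highest {P : Submodule ℂ W} (hp : ∀ x ∈ P, S.Sp x ∈ P)
    (hm : ∀ x ∈ P, S.Sm x ∈ P) (hspan : ⨆ μ, Module.End.eigenspace S.S0 μ = ⊤)
    (nilp : ∀ x, ∃ N : ℕ, (S.Sp ^ N) x = 0) (nilm : ∀ x, ∃ N : ℕ, (S.Sm ^ N) x = 0)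
    (hP : ∀ j x, S.IsHighest j x → x ∈ P) : P = ⊤ := by
  have key : ∀ (N : ℕ) (μ : ℂ) (x : W), S.S0 x = μ • x → (S.Sp ^ N) x ∈ P → x ∈ P := by
    intro N
    induction N with
    | zero => intro μ x _ h; simpa using h
    | succ N ih =>
      intro μ x hx h
      have h1 : S.Sp x ∈ P := ih (μ + 1) (S.Sp x) (by rw [S.zero_plus, hx, map_smul]; module)
        (by rwa [pow_succ, Module.End.mul_apply] at h)
      by_cases hμ : ∃ n : ℕ, 2 * μ = n
      · obtain ⟨n, hn⟩ := hμ
        obtain ⟨M, hM⟩ := nilp x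
        exact mem_of_weight_nat hm hP n M x (by rw [hx, ← hn]; congr 1; ring) hM
      · push Not at hμ
        exact mem_of_weight_not_nat hp hm hx hμ h1 (nilm x)
  rw [eq_top_iff, ← hspan]
  refine iSup_le fun μ x hx => ?_
  obtain ⟨N, hN⟩ := nilp x
  exact key N μ x (Module.End.mem_eigenspace_iff.mp hx) (by rw [hN]; exact P.zero_mem)

theorem exists_highest [Nontrivial W] (hspan : ⨆ μ, Module.End.eigenspace S.S0 μ = ⊤)
    (nilp : ∀ x, ∃ N : ℕ, (S.Sp ^ N) x = 0) (nilm : ∀ x, ∃ N : ℕ, (S.Sm ^ N) x = 0) :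
    ∃ (n : ℕ) (x : W), x ≠ 0 ∧ S.IsHighest (n / 2) x := by
  by_contra! h
  refine bot_ne_top (α := Submodule ℂ W) (eq_top_of_highest (S := S) (by simp) (by simp) hspan nilp
    nilm fun j x hx => ?_)
  rw [Submodule.mem_bot]
  by_contra h0
  obtain ⟨n, hn⟩ := hx.exists_nat h0 (nilm x)
  exact h n x h0 (by rwa [← hn, mul_div_cancel_left₀ _ two_ne_zero])

end SpinOps

end Lorentz

namespace Lorentz

theorem sign_sq (A : ℤˣ) : ((A : ℤ) : ℂ) ^ 2 = 1 := by
  rcases Int.units_eq_one_or A with rfl | rfl <;> simp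

/-- Operators `J₀, J±, K₀, K±` that satisfy the relations of `𝔰𝔭𝔦𝔫(3,1)_ℂ`. -/
structure LadderOps (W : Type*) [AddCommGroup W] [Module ℂ W] where
  /-- `J₀` -/
  J0 : Module.End ℂ W
  /-- `J₊` -/
  Jp : Module.End ℂ W
  /-- `J₋` -/
  Jm : Module.End ℂ W
  /-- `K₀` -/
  K0 : Module.End ℂ W
  /-- `K₊` -/
  Kp : Module.End ℂ W
  /-- `K₋` -/
  Km : Module.End ℂ W
  rel : LadderRelations J0 Jp Jm K0 Kp Km

namespace LadderOps

variable {W : Type*} [AddCommGroup W] [Module ℂ W] (D : LadderOps W)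

theorem apply_comm {S T R : Module.End ℂ W} (h : S * T - T * S = R) (x : W) :
    S (T x) = T (S x) + R x := by
  rw [← h]; simp

theorem J0_Jp (x : W) : D.J0 (D.Jp x) = D.Jp (D.J0 x) + D.Jp x := apply_comm D.rel.J0_Jp x
theorem J0_Jm (x : W) : D.J0 (D.Jm x) = D.Jm (D.J0 x) - D.Jm x := by
  rw [apply_comm D.rel.J0_Jm x, LinearMap.neg_apply, sub_eq_add_neg]
theorem Jp_Jm (x : W) : D.Jp (D.Jm x) = D.Jm (D.Jp x) + (2 : ℂ) • D.J0 x :=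
  apply_comm D.rel.Jp_Jm x
theorem J0_K0 (x : W) : D.J0 (D.K0 x) = D.K0 (D.J0 x) := by
  rw [apply_comm D.rel.J0_K0 x, LinearMap.zero_apply, add_zero]
theorem J0_Kp (x : W) : D.J0 (D.Kp x) = D.Kp (D.J0 x) + D.Kp x := apply_comm D.rel.J0_Kp x
theorem J0_Km (x : W) : D.J0 (D.Km x) = D.Km (D.J0 x) - D.Km x := by
  rw [apply_comm D.rel.J0_Km x, LinearMap.neg_apply, sub_eq_add_neg]
theorem Jp_K0 (x : W) : D.Jp (D.K0 x) = D.K0 (D.Jp x) - D.Kp x := by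
  rw [apply_comm D.rel.Jp_K0 x, LinearMap.neg_apply, sub_eq_add_neg]
theorem Jp_Kp (x : W) : D.Jp (D.Kp x) = D.Kp (D.Jp x) := by
  rw [apply_comm D.rel.Jp_Kp x, LinearMap.zero_apply, add_zero]
theorem Jp_Km (x : W) : D.Jp (D.Km x) = D.Km (D.Jp x) + (2 : ℂ) • D.K0 x :=
  apply_comm D.rel.Jp_Km x
theorem K0_Jm (x : W) : D.K0 (D.Jm x) = D.Jm (D.K0 x) - D.Km x := by
  rw [apply_comm D.rel.Jm_K0 x, add_sub_cancel_right]
theorem Kp_Jm (x : W) : D.Kp (D.Jm x) = D.Jm (D.Kp x) + (2 : ℂ) • D.K0 x := by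
  rw [apply_comm D.rel.Jm_Kp x, LinearMap.smul_apply]; module
theorem Km_Jm (x : W) : D.Km (D.Jm x) = D.Jm (D.Km x) := by
  rw [apply_comm D.rel.Jm_Km x, LinearMap.zero_apply, add_zero]
theorem K0_Kp (x : W) : D.K0 (D.Kp x) = D.Kp (D.K0 x) - D.Jp x := by
  rw [apply_comm D.rel.K0_Kp x, LinearMap.neg_apply, sub_eq_add_neg]
theorem K0_Km (x : W) : D.K0 (D.Km x) = D.Km (D.K0 x) + D.Jm x := apply_comm D.rel.K0_Km x
theorem Kp_Km (x : W) : D.Kp (D.Km x) = D.Km (D.Kp x) - (2 : ℂ) • D.J0 x := by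
  rw [apply_comm D.rel.Kp_Km x, LinearMap.smul_apply]; module

/-- The rotation subalgebra. -/
def rot : SpinOps W := ⟨D.J0, D.Jp, D.Jm, D.J0_Jp, D.J0_Jm, D.Jp_Jm⟩

@[simp] theorem rot_S0 : D.rot.S0 = D.J0 := rfl
@[simp] theorem rot_Sp : D.rot.Sp = D.Jp := rfl
@[simp] theorem rot_Sm : D.rot.Sm = D.Jm := rfl

/-- The two commuting copies of `𝔰𝔩₂`, spanned by the `(J - i A K) / 2` for `A = ±1`. -/
noncomputable def half (A : ℤˣ) : SpinOps W where
  S0 := (1 / 2 : ℂ) • (D.J0 - (Complex.I * ((A : ℤ) : ℂ)) • D.K0)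
  Sp := (1 / 2 : ℂ) • (D.Jp - (Complex.I * ((A : ℤ) : ℂ)) • D.Kp)
  Sm := (1 / 2 : ℂ) • (D.Jm - (Complex.I * ((A : ℤ) : ℂ)) • D.Km)
  zero_plus x := by
    have I2 : Complex.I ^ 2 = -1 := Complex.I_sq
    have hA := sign_sq A
    simp only [LinearMap.smul_apply, LinearMap.sub_apply, map_smul, map_sub, D.J0_Jp, D.J0_Kp,
      D.K0_Kp, D.Jp_K0]
    match_scalars <;> grind
  zero_minus x := by
    have I2 : Complex.I ^ 2 = -1 := Complex.I_sq
    have hA := sign_sq A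
    simp only [LinearMap.smul_apply, LinearMap.sub_apply, map_smul, map_sub, D.J0_Jm, D.J0_Km,
      D.K0_Km, D.K0_Jm]
    match_scalars <;> grind
  plus_minus x := by
    have I2 : Complex.I ^ 2 = -1 := Complex.I_sq
    have hA := sign_sq A
    simp only [LinearMap.smul_apply, LinearMap.sub_apply, map_smul, map_sub, D.Jp_Jm, D.Jp_Km,
      D.Kp_Jm, D.Kp_Km, smul_sub, smul_add, smul_smul]
    match_scalars <;> grind

/-- `J · K` -/
noncomputable def cas₁ : Module.End ℂ W :=
  D.J0 * D.K0 + (1 / 2 : ℂ) • (D.Jp * D.Km + D.Jm * D.Kp)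

/-- `J² - K²` -/
noncomputable def cas₂ : Module.End ℂ W :=
  D.J0 * D.J0 + (1 / 2 : ℂ) • (D.Jp * D.Jm + D.Jm * D.Jp)
    - (D.K0 * D.K0 + (1 / 2 : ℂ) • (D.Kp * D.Km + D.Km * D.Kp))

theorem cas₁_apply (x : W) :
    D.cas₁ x = D.J0 (D.K0 x) + (1 / 2 : ℂ) • (D.Jp (D.Km x) + D.Jm (D.Kp x)) := by
  simp [cas₁]

theorem cas₂_apply (x : W) :
    D.cas₂ x = D.J0 (D.J0 x) + (1 / 2 : ℂ) • (D.Jp (D.Jm x) + D.Jm (D.Jp x))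
      - (D.K0 (D.K0 x) + (1 / 2 : ℂ) • (D.Kp (D.Km x) + D.Km (D.Kp x))) := by
  simp [cas₂]

theorem half_cas (A : ℤˣ) :
    (D.half A).cas = D.cas₂ - (2 * Complex.I * ((A : ℤ) : ℂ)) • D.cas₁ + 1 := by
  have I2 : Complex.I ^ 2 = -1 := Complex.I_sq
  ext x
  simp only [SpinOps.cas_apply, half, LinearMap.add_apply, LinearMap.sub_apply,
    LinearMap.smul_apply, Module.End.one_apply, cas₁_apply, cas₂_apply, map_smul, map_sub]
  rw [D.Jp_Jm, D.Kp_Km, D.Jp_Km, D.J0_K0]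
  have h : D.Km (D.Jp x) = D.Jp (D.Km x) - (2 : ℂ) • D.K0 x := by rw [D.Jp_Km]; module
  have hA := sign_sq A
  simp only [h, smul_sub, smul_add, smul_smul]
  match_scalars <;> grind

section Highest

variable {D} {a b j : ℂ} {w : W}

theorem cas₁_highest (hw : D.rot.IsHighest j w) :
    D.cas₁ w = (j + 1) • D.K0 w + (1 / 2 : ℂ) • D.Jm (D.Kp w) := by
  have e0 : D.J0 w = j • w := hw.weight
  have ep : D.Jp w = 0 := hw.raise
  rw [cas₁_apply, D.J0_K0, e0, D.Jp_Km, ep, map_zero, map_smul]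
  module

theorem cas₂_highest (hw : D.rot.IsHighest j w) :
    D.cas₂ w = (j ^ 2 + 2 * j) • w - D.K0 (D.K0 w) - D.Km (D.Kp w) := by
  have e0 : D.J0 w = j • w := hw.weight
  have ep : D.Jp w = 0 := hw.raise
  rw [cas₂_apply, D.Jp_Jm, D.Kp_Km, ep, map_zero, e0, map_smul, e0]
  module

theorem K0_highest (hj : j + 1 ≠ 0) (h1 : ∀ x, D.cas₁ x = a • x) (hw : D.rot.IsHighest j w) :
    D.K0 w = (a / (j + 1)) • w - (1 / (2 * (j + 1))) • D.Jm (D.Kp w) := by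
  have h := h1 w
  rw [cas₁_highest hw] at h
  have h' : (j + 1) • D.K0 w = a • w - (1 / 2 : ℂ) • D.Jm (D.Kp w) := by rw [← h]; module
  have h'' := congrArg (fun x => (j + 1)⁻¹ • x) h'
  simp only [smul_smul, inv_mul_cancel₀ hj, one_smul, smul_sub] at h''
  rw [h'']
  match_scalars <;> field_simp

theorem Kp_highest (hw : D.rot.IsHighest j w) : D.rot.IsHighest (j + 1) (D.Kp w) := by
  have e0 : D.J0 w = j • w := hw.weight
  have ep : D.Jp w = 0 := hw.raise
  constructor
  · rw [rot_S0, D.J0_Kp, e0, map_smul]; module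
  · rw [rot_Sp, D.Jp_Kp, ep, map_zero]

theorem Kp_pow_highest (hw : D.rot.IsHighest j w) (n : ℕ) :
    D.rot.IsHighest (j + n) ((D.Kp ^ n) w) := by
  induction n with
  | zero => simpa using hw
  | succ n ih =>
    rw [pow_succ', Module.End.mul_apply]
    push_cast
    rw [← add_assoc]
    exact Kp_highest ih

theorem Km_Kp_highest (hj : j + 1 ≠ 0) (hj' : 2 * j + 3 ≠ 0) (h1 : ∀ x, D.cas₁ x = a • x)
    (h2 : ∀ x, D.cas₂ x = b • x) (hw : D.rot.IsHighest j w) :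
    D.Km (D.Kp w) = (2 * (j + 1) / (2 * j + 3)) • ((j ^ 2 + 2 * j - b) • w
      - (a / (j + 1)) • D.K0 w + (1 / (2 * (j + 1))) • D.Jm (D.K0 (D.Kp w))) := by
  have h := h2 w
  have eK : D.K0 (D.K0 w) = (a / (j + 1)) • D.K0 w
      - (1 / (2 * (j + 1))) • (D.Jm (D.K0 (D.Kp w)) - D.Km (D.Kp w)) := by
    conv_lhs => rw [K0_highest hj h1 hw]
    rw [map_sub, map_smul, map_smul, D.K0_Jm]
  rw [cas₂_highest hw, eK] at h
  have h' : ((2 * j + 3) / (2 * (j + 1))) • D.Km (D.Kp w) = (j ^ 2 + 2 * j - b) • w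
      - (a / (j + 1)) • D.K0 w + (1 / (2 * (j + 1))) • D.Jm (D.K0 (D.Kp w)) := by
    rw [sub_smul, ← h]
    match_scalars <;> field_simp <;> ring
  rw [← h', smul_smul]
  have : 2 * (j + 1) / (2 * j + 3) * ((2 * j + 3) / (2 * (j + 1))) = 1 := by field_simp
  rw [this, one_smul]

theorem cas₁_Jm (x : W) : D.cas₁ (D.Jm x) = D.Jm (D.cas₁ x) := by
  simp only [cas₁_apply, map_add, map_sub, map_smul, D.K0_Jm, D.J0_Jm, D.Km_Jm, D.Kp_Jm, D.Jp_Jm]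
  rw [D.J0_Km]
  module

theorem cas₂_Jm (x : W) : D.cas₂ (D.Jm x) = D.Jm (D.cas₂ x) := by
  simp only [cas₂_apply, map_add, map_sub, map_smul, D.K0_Jm, D.J0_Jm, D.Km_Jm, D.Kp_Jm, D.Jp_Jm]
  rw [D.K0_Km]
  module

theorem cas₁_Kp (x : W) : D.cas₁ (D.Kp x) = D.Kp (D.cas₁ x) := by
  have h1 : ∀ y, D.Km (D.Kp y) = D.Kp (D.Km y) + (2 : ℂ) • D.J0 y := fun y => by
    rw [D.Kp_Km]; module
  have h2 : ∀ y, D.Jm (D.Kp y) = D.Kp (D.Jm y) - (2 : ℂ) • D.K0 y := fun y => by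
    rw [D.Kp_Jm]; module
  simp only [cas₁_apply, map_add, map_sub, map_smul, D.K0_Kp, D.J0_Kp, D.Jp_Kp, h1, h2, D.J0_Jp]
  module

theorem cas₂_Kp (x : W) : D.cas₂ (D.Kp x) = D.Kp (D.cas₂ x) := by
  have h1 : ∀ y, D.Km (D.Kp y) = D.Kp (D.Km y) + (2 : ℂ) • D.J0 y := fun y => by
    rw [D.Kp_Km]; module
  have h2 : ∀ y, D.Jm (D.Kp y) = D.Kp (D.Jm y) - (2 : ℂ) • D.K0 y := fun y => by
    rw [D.Kp_Jm]; module
  simp only [cas₂_apply, map_add, map_sub, map_smul, D.K0_Kp, D.J0_Kp, D.Jp_Kp, h1, h2, D.Jp_K0]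
  module

/-- A highest weight vector of the lowest spin. -/
structure IsBottom (D : LadderOps W) (a j : ℂ) (w : W) : Prop where
  highest : D.rot.IsHighest j w
  lower : D.Km w = (a / (j * (j + 1))) • D.Jm w
    - (1 / (2 * (j + 1) * (2 * j + 1))) • D.Jm (D.Jm (D.Kp w))

/-- If no highest weight vector has weight `j - 1`, those of weight `j` are of lowest spin. -/
theorem isBottom_of_forall {q : ℕ} (h1 : ∀ x, D.cas₁ x = a • x)
    (nilm : ∀ x, ∃ N : ℕ, (D.Jm ^ N) x = 0) (hw : D.rot.IsHighest (q / 2) w)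
    (h : ∀ x, D.rot.IsHighest (q / 2 - 1) x → x = 0) :
    D.IsBottom a (q / 2) w ∧ (q = 0 → w ≠ 0 → a = 0) := by
  have hj : ((q : ℂ) / 2 + 1) ≠ 0 := by
    have : ((q + 2 : ℕ) : ℂ) ≠ 0 := Nat.cast_ne_zero.mpr (by omega)
    intro h; apply this; push_cast; linear_combination 2 * h
  have hj2 : (2 * ((q : ℂ) / 2) + 1) ≠ 0 := by
    have : ((q + 1 : ℕ) : ℂ) ≠ 0 := Nat.cast_ne_zero.mpr (by omega)
    intro h; apply this; push_cast; linear_combination h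
  have e0 : D.J0 w = ((q : ℂ) / 2) • w := hw.weight
  have ep : D.Jp w = 0 := hw.raise
  have hK := K0_highest hj h1 hw
  have ha : q = 0 → a • w = 0 := by
    rintro rfl
    have hm : D.Jm w = 0 := by simpa using hw.Sm_pow_eq_zero nilm
    have := h1 w
    rw [← this, cas₁_apply, D.J0_K0, e0, D.Jp_Km, ep]
    have h3 := D.Kp_Jm w
    rw [hm, map_zero] at h3
    simp only [Nat.cast_zero, zero_div, zero_smul, map_zero, zero_add]
    rw [add_comm, ← h3, smul_zero]
  refine ⟨⟨hw, ?_⟩, fun hq hw0 => (smul_eq_zero.mp (ha hq)).resolve_right hw0⟩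
  rw [← sub_eq_zero]
  have eu : D.J0 (D.Kp w) = ((q : ℂ) / 2 + 1) • D.Kp w := (Kp_highest hw).weight
  have epu : D.Jp (D.Kp w) = 0 := (Kp_highest hw).raise
  apply h
  constructor
  · simp only [rot_S0, map_sub, map_smul, D.J0_Km, D.J0_Jm, e0, eu]
    module
  · have hw2 : (a / ((q : ℂ) / 2 + 1)) • w = (a / (q / 2 * (q / 2 + 1)) * (q / 2)) • w := by
      rcases Nat.eq_zero_or_pos q with rfl | hq
      · simp [ha rfl]
      · have : (q : ℂ) ≠ 0 := Nat.cast_ne_zero.mpr hq.ne'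
        congr 1
        field_simp
    simp only [rot_Sp, map_sub, map_add, map_smul, D.Jp_Km, D.Jp_Jm, D.J0_Jm, e0, ep, eu, epu, map_zero,
      hK, smul_sub, hw2]
    generalize (q : ℂ) / 2 = j at *
    match_scalars <;> field_simp <;> ring

theorem IsBottom.polynomial_eq_zero (hj : j + 1 ≠ 0) (hj' : 2 * j + 3 ≠ 0) (hj1 : 2 * j + 1 ≠ 0)
    (hj2 : j + 2 ≠ 0)
    (h1 : ∀ x, D.cas₁ x = a • x) (h2 : ∀ x, D.cas₂ x = b • x) (hw : D.IsBottom a j w)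
    (hw0 : w ≠ 0) (h0 : j = 0 → a = 0) : j ^ 4 - (b + 1) * j ^ 2 - a ^ 2 = 0 := by
  by_cases hj0 : j = 0
  · simp [hj0, h0 hj0]
  have e0 : D.J0 w = j • w := hw.highest.weight
  have hA := K0_highest hj h1 hw.highest
  have hB := K0_highest (j := j + 1) (by rwa [add_assoc, one_add_one_eq_two]) h1
    (Kp_highest hw.highest)
  have hC := Km_Kp_highest hj hj' h1 h2 hw.highest
  have hD := D.Kp_Km w
  rw [hw.lower] at hD
  simp only [map_sub, map_smul, D.Kp_Jm, map_add, D.K0_Jm, hB, hC, hA, e0, smul_sub, smul_add,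
    smul_smul] at hD
  have hj3 : j + 1 + 1 ≠ 0 := by rwa [add_assoc, one_add_one_eq_two]
  rw [mul_comm] at hj' hj1
  have key : (j ^ 4 - (b + 1) * j ^ 2 - a ^ 2) • w = 0 := by
    rw [← smul_zero (j * (2 * j + 1) / 2 : ℂ), ← sub_eq_zero.mpr hD.symm]
    match_scalars <;> field_simp <;> ring
  exact (smul_eq_zero.mp key).resolve_right hw0

end Highest

end LadderOps
end Lorentz

namespace Lorentz
namespace LadderOps

variable {W : Type*} [AddCommGroup W] [Module ℂ W] {W' : Type*} [AddCommGroup W'] [Module ℂ W']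

/-- An operator is intertwined by `φ`. -/
structure Intertwines (D : LadderOps W) (D' : LadderOps W') (φ : W →ₗ[ℂ] W') : Prop where
  J0 : ∀ x, φ (D.J0 x) = D'.J0 (φ x)
  Jp : ∀ x, φ (D.Jp x) = D'.Jp (φ x)
  Jm : ∀ x, φ (D.Jm x) = D'.Jm (φ x)
  K0 : ∀ x, φ (D.K0 x) = D'.K0 (φ x)
  Kp : ∀ x, φ (D.Kp x) = D'.Kp (φ x)
  Km : ∀ x, φ (D.Km x) = D'.Km (φ x)

/-- `J₀, K₀, K₋` are determined by `J₊, J₋, K₊`. -/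
theorem Intertwines.of_generating {D : LadderOps W} {D' : LadderOps W'} {φ : W →ₗ[ℂ] W'}
    (hp : ∀ x, φ (D.Jp x) = D'.Jp (φ x)) (hm : ∀ x, φ (D.Jm x) = D'.Jm (φ x))
    (hk : ∀ x, φ (D.Kp x) = D'.Kp (φ x)) : Intertwines D D' φ := by
  have two : (2 : ℂ) ≠ 0 := two_ne_zero
  have h0 : ∀ x, φ (D.J0 x) = D'.J0 (φ x) := fun x => by
    have h1 := congrArg φ (D.Jp_Jm x)
    have h2 := D'.Jp_Jm (φ x)
    rw [map_add, hp, hm, hm, hp, h2, add_right_inj, map_smul] at h1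
    exact (smul_right_injective _ two h1).symm
  have hk0 : ∀ x, φ (D.K0 x) = D'.K0 (φ x) := fun x => by
    have h1 := congrArg φ (D.Kp_Jm x)
    have h2 := D'.Kp_Jm (φ x)
    rw [map_add, hk, hm, hm, hk, h2, add_right_inj, map_smul] at h1
    exact (smul_right_injective _ two h1).symm
  refine ⟨h0, hp, hm, hk0, hk, fun x => ?_⟩
  have h1 := congrArg φ (D.K0_Jm x)
  have h2 := D'.K0_Jm (φ x)
  rw [map_sub, hk0, hm, hm, hk0, h2, sub_right_inj] at h1
  exact h1.symm

/-- Componentwise operators on a product. -/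
def prod (D : LadderOps W) (D' : LadderOps W') : LadderOps (W × W') where
  J0 := D.J0.prodMap D'.J0
  Jp := D.Jp.prodMap D'.Jp
  Jm := D.Jm.prodMap D'.Jm
  K0 := D.K0.prodMap D'.K0
  Kp := D.Kp.prodMap D'.Kp
  Km := D.Km.prodMap D'.Km
  rel := by
    obtain ⟨h1, h2, h3, h4, h5, h6, h7, h8, h9, h10, h11, h12, h13, h14, h15⟩ := D.rel
    obtain ⟨g1, g2, g3, g4, g5, g6, g7, g8, g9, g10, g11, g12, g13, g14, g15⟩ := D'.rel
    have key : ∀ {A B C : Module.End ℂ W} {A' B' C' : Module.End ℂ W'}, A * B - B * A = C →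
        A' * B' - B' * A' = C' → A.prodMap A' * B.prodMap B' - B.prodMap B' * A.prodMap A' =
          C.prodMap C' := by
      rintro A B C A' B' C' rfl rfl
      ext x <;> simp
    constructor
    all_goals first
      | exact key ‹_› ‹_›
      | (refine (key ‹_› ‹_›).trans ?_; ext x <;> simp)

/-- A subspace that is stable under the operators. -/
structure IsStable (D : LadderOps W) (P : Submodule ℂ W) : Prop where
  J0 : ∀ x ∈ P, D.J0 x ∈ P
  Jp : ∀ x ∈ P, D.Jp x ∈ P
  Jm : ∀ x ∈ P, D.Jm x ∈ P
  K0 : ∀ x ∈ P, D.K0 x ∈ P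
  Kp : ∀ x ∈ P, D.Kp x ∈ P
  Km : ∀ x ∈ P, D.Km x ∈ P

/-- The operators on a stable subspace. -/
def restrict (D : LadderOps W) {P : Submodule ℂ W} (h : D.IsStable P) : LadderOps P where
  J0 := D.J0.restrict h.J0
  Jp := D.Jp.restrict h.Jp
  Jm := D.Jm.restrict h.Jm
  K0 := D.K0.restrict h.K0
  Kp := D.Kp.restrict h.Kp
  Km := D.Km.restrict h.Km
  rel := by
    obtain ⟨h1, h2, h3, h4, h5, h6, h7, h8, h9, h10, h11, h12, h13, h14, h15⟩ := D.rel
    constructor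
    all_goals
      ext x
      first
        | exact LinearMap.congr_fun h1 x | exact LinearMap.congr_fun h2 x
        | exact LinearMap.congr_fun h3 x | exact LinearMap.congr_fun h4 x
        | exact LinearMap.congr_fun h5 x | exact LinearMap.congr_fun h6 x
        | exact LinearMap.congr_fun h7 x | exact LinearMap.congr_fun h8 x
        | exact LinearMap.congr_fun h9 x | exact LinearMap.congr_fun h10 x
        | exact LinearMap.congr_fun h11 x | exact LinearMap.congr_fun h12 x
        | exact LinearMap.congr_fun h13 x | exact LinearMap.congr_fun h14 x
        | exact LinearMap.congr_fun h15 x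

theorem isHighest_restrict {D : LadderOps W} {P : Submodule ℂ W} (h : D.IsStable P) {j : ℂ} {x : P} :
    (D.restrict h).rot.IsHighest j x ↔ D.rot.IsHighest j (x : W) :=
  ⟨fun hx => ⟨congrArg Subtype.val hx.weight, congrArg Subtype.val hx.raise⟩,
    fun hx => ⟨Subtype.ext hx.weight, Subtype.ext hx.raise⟩⟩

theorem coe_restrict_pow {f : Module.End ℂ W} {P : Submodule ℂ W} (h : ∀ x ∈ P, f x ∈ P) (n : ℕ)
    (x : P) : (((f.restrict h) ^ n) x : W) = (f ^ n) x := by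
  induction n with
  | zero => rfl
  | succ n ih =>
    rw [pow_succ', pow_succ', Module.End.mul_apply, Module.End.mul_apply, ← ih]
    rfl

theorem Intertwines.isStable_ker {D : LadderOps W} {D' : LadderOps W'} {φ : W →ₗ[ℂ] W'}
    (h : Intertwines D D' φ) : D.IsStable (LinearMap.ker φ) := by
  constructor <;> intro x hx <;> rw [LinearMap.mem_ker] at hx ⊢
  · rw [h.J0, hx, map_zero]
  · rw [h.Jp, hx, map_zero]
  · rw [h.Jm, hx, map_zero]
  · rw [h.K0, hx, map_zero]
  · rw [h.Kp, hx, map_zero]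
  · rw [h.Km, hx, map_zero]

/-- Local finiteness with respect to the rotations. -/
structure IsLocallyFinite (D : LadderOps W) : Prop where
  weight : ⨆ μ, Module.End.eigenspace D.J0 μ = ⊤
  raise : ∀ x, ∃ N : ℕ, (D.Jp ^ N) x = 0
  lower : ∀ x, ∃ N : ℕ, (D.Jm ^ N) x = 0

theorem IsLocallyFinite.restrict {D : LadderOps W} (hD : D.IsLocallyFinite) {P : Submodule ℂ W}
    (h : D.IsStable P) : (D.restrict h).IsLocallyFinite where
  weight := iSup_eigenspace_restrict_eq_top h.J0 hD.weight
  raise x := by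
    obtain ⟨N, hN⟩ := hD.raise x
    exact ⟨N, Subtype.ext ((coe_restrict_pow h.Jp N x).trans hN)⟩
  lower x := by
    obtain ⟨N, hN⟩ := hD.lower x
    exact ⟨N, Subtype.ext ((coe_restrict_pow h.Jm N x).trans hN)⟩

theorem IsLocallyFinite.exists_highest [Nontrivial W] {D : LadderOps W} (hD : D.IsLocallyFinite) :
    ∃ (n : ℕ) (x : W), x ≠ 0 ∧ D.rot.IsHighest (n / 2) x :=
  SpinOps.exists_highest hD.weight hD.raise hD.lower

variable (D : LadderOps W)

/-- The span of the `J₋ˢ K₊ⁿ w`. -/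
def ladderSpan (w : W) : Submodule ℂ W :=
  Submodule.span ℂ (Set.range fun p : ℕ × ℕ => (D.Jm ^ p.2) ((D.Kp ^ p.1) w))

variable {D} {a b j : ℂ} {w : W}

theorem mem_ladderSpan (w : W) (n s : ℕ) : (D.Jm ^ s) ((D.Kp ^ n) w) ∈ D.ladderSpan w :=
  Submodule.subset_span ⟨(n, s), rfl⟩

theorem Jm_mem_ladderSpan {x : W} (hx : x ∈ D.ladderSpan w) : D.Jm x ∈ D.ladderSpan w := by
  have h : D.ladderSpan w ≤ (D.ladderSpan w).comap D.Jm := by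
    refine Submodule.span_le.mpr ?_
    rintro _ ⟨p, rfl⟩
    change D.Jm _ ∈ D.ladderSpan w
    rw [← Module.End.mul_apply, ← pow_succ']
    exact mem_ladderSpan w p.1 (p.2 + 1)
  exact h hx

theorem Jp_mem_ladderSpan (hw : D.rot.IsHighest j w) {x : W} (hx : x ∈ D.ladderSpan w) :
    D.Jp x ∈ D.ladderSpan w := by
  have h : D.ladderSpan w ≤ (D.ladderSpan w).comap D.Jp := by
    refine Submodule.span_le.mpr ?_
    rintro _ ⟨⟨n, s⟩, rfl⟩
    change D.Jp ((D.Jm ^ s) _) ∈ D.ladderSpan w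
    have hn := Kp_pow_highest hw n
    cases s with
    | zero =>
      have : D.Jp ((D.Kp ^ n) w) = 0 := hn.raise
      rw [pow_zero, Module.End.one_apply, this]
      exact Submodule.zero_mem _
    | succ s =>
      have := SpinOps.Sp_Sm_pow hn.weight s
      rw [hn.raise, map_zero, zero_add] at this
      exact this ▸ Submodule.smul_mem _ _ (mem_ladderSpan w n s)
  exact h hx

theorem IsBottom.Kp_mem_ladderSpan {q : ℕ} (h1 : ∀ x, D.cas₁ x = a • x)
    (h2 : ∀ x, D.cas₂ x = b • x) (hw : D.IsBottom a (q / 2) w) {x : W}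
    (hx : x ∈ D.ladderSpan w) : D.Kp x ∈ D.ladderSpan w := by
  have hj : ∀ n : ℕ, ((q : ℂ) / 2 + n + 1) ≠ 0 := fun n h => by
    have : ((q + 2 * n + 2 : ℕ) : ℂ) ≠ 0 := Nat.cast_ne_zero.mpr (by omega)
    apply this; push_cast; linear_combination 2 * h
  have hj' : ∀ n : ℕ, (2 * ((q : ℂ) / 2 + n) + 3) ≠ 0 := fun n h => by
    have : ((q + 2 * n + 3 : ℕ) : ℂ) ≠ 0 := Nat.cast_ne_zero.mpr (by omega)
    apply this; push_cast; linear_combination h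
  have e : ∀ n, (D.Kp ^ n) w ∈ D.ladderSpan w := fun n => mem_ladderSpan w n 0
  have e' : ∀ n, D.Kp ((D.Kp ^ n) w) = (D.Kp ^ (n + 1)) w := fun n => by
    rw [pow_succ', Module.End.mul_apply]
  have hK0 : ∀ n, D.K0 ((D.Kp ^ n) w) ∈ D.ladderSpan w := fun n => by
    rw [K0_highest (hj n) h1 (Kp_pow_highest hw.highest n), e']
    exact Submodule.sub_mem _ (Submodule.smul_mem _ _ (e n))
      (Submodule.smul_mem _ _ (Jm_mem_ladderSpan (e _)))
  have hKm : ∀ n, D.Km ((D.Kp ^ n) w) ∈ D.ladderSpan w := fun n => by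
    cases n with
    | zero =>
      rw [pow_zero, Module.End.one_apply, hw.lower]
      exact Submodule.sub_mem _ (Submodule.smul_mem _ _ (Jm_mem_ladderSpan (e 0)))
        (Submodule.smul_mem _ _ (Jm_mem_ladderSpan (Jm_mem_ladderSpan (by simpa using e 1))))
    | succ n =>
      rw [← e', Km_Kp_highest (hj n) (hj' n) h1 h2 (Kp_pow_highest hw.highest n), e']
      exact Submodule.smul_mem _ _ (Submodule.add_mem _ (Submodule.sub_mem _
        (Submodule.smul_mem _ _ (e n)) (Submodule.smul_mem _ _ (hK0 n)))
        (Submodule.smul_mem _ _ (Jm_mem_ladderSpan (hK0 _))))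
  have key : ∀ n s, D.Kp ((D.Jm ^ s) ((D.Kp ^ n) w)) ∈ D.ladderSpan w ∧
      D.K0 ((D.Jm ^ s) ((D.Kp ^ n) w)) ∈ D.ladderSpan w ∧
      D.Km ((D.Jm ^ s) ((D.Kp ^ n) w)) ∈ D.ladderSpan w := fun n s => by
    induction s with
    | zero =>
      simp only [pow_zero, Module.End.one_apply]
      exact ⟨e' n ▸ e _, hK0 n, hKm n⟩
    | succ s ih =>
      rw [pow_succ', Module.End.mul_apply, D.Kp_Jm, D.K0_Jm, D.Km_Jm]
      exact ⟨Submodule.add_mem _ (Jm_mem_ladderSpan ih.1) (Submodule.smul_mem _ _ ih.2.1),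
        Submodule.sub_mem _ (Jm_mem_ladderSpan ih.2.1) ih.2.2, Jm_mem_ladderSpan ih.2.2⟩
  have h : D.ladderSpan w ≤ (D.ladderSpan w).comap D.Kp := by
    refine Submodule.span_le.mpr ?_
    rintro _ ⟨⟨n, s⟩, rfl⟩
    exact (key n s).1
  exact h hx

theorem eq_smul_of_ladderSpan (hspan : D.ladderSpan w = ⊤) {f : Module.End ℂ W} {c : ℂ}
    (hJ : ∀ x, f (D.Jm x) = D.Jm (f x)) (hK : ∀ x, f (D.Kp x) = D.Kp (f x)) (hw : f w = c • w)
    (x : W) : f x = c • x := by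
  have hx : x ∈ D.ladderSpan w := by rw [hspan]; trivial
  induction hx using Submodule.span_induction with
  | mem x hx =>
    obtain ⟨⟨n, s⟩, rfl⟩ := hx
    have h1 : f ((D.Kp ^ n) w) = c • (D.Kp ^ n) w := by
      induction n with
      | zero => simpa using hw
      | succ n ih => rw [pow_succ', Module.End.mul_apply, hK, ih, map_smul]
    change f ((D.Jm ^ s) ((D.Kp ^ n) w)) = c • (D.Jm ^ s) ((D.Kp ^ n) w)
    induction s with
    | zero => simpa using h1
    | succ s ih => rw [pow_succ', Module.End.mul_apply, hJ, ih, map_smul]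
  | zero => simp
  | add x y _ _ hx hy => rw [map_add, hx, hy, smul_add]
  | smul d x _ hx => rw [map_smul, hx, smul_comm]

theorem prod_pow {A : Module.End ℂ W} {A' : Module.End ℂ W'} (n : ℕ) (x : W × W') :
    ((A.prodMap A') ^ n) x = ((A ^ n) x.1, (A' ^ n) x.2) := by
  induction n generalizing x with
  | zero => rfl
  | succ n ih => simp only [pow_succ, Module.End.mul_apply, ih]; rfl

theorem IsBottom.prod {D' : LadderOps W'} {w' : W'} (hw : D.IsBottom a j w)
    (hw' : D'.IsBottom a j w') : (D.prod D').IsBottom a j (w, w') where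
  highest := ⟨Prod.ext hw.highest.weight hw'.highest.weight,
    Prod.ext hw.highest.raise hw'.highest.raise⟩
  lower := Prod.ext hw.lower hw'.lower

/-- A module with scalar Casimirs that is generated by a vector of lowest spin maps to any other
module with the same Casimirs and a vector of the same lowest spin. -/
theorem IsBottom.intertwines {D' : LadderOps W'} {w' : W'} {q : ℕ} {φ : W →ₗ[ℂ] W'}
    (h1 : ∀ x, D.cas₁ x = a • x) (h2 : ∀ x, D.cas₂ x = b • x)
    (h1' : ∀ x, D'.cas₁ x = a • x) (h2' : ∀ x, D'.cas₂ x = b • x)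
    (hw : D.IsBottom a (q / 2) w) (hw' : D'.IsBottom a (q / 2) w')
    (hspan : D.ladderSpan w = ⊤)
    (hφ : ∀ n s : ℕ, φ ((D.Jm ^ s) ((D.Kp ^ n) w)) = (D'.Jm ^ s) ((D'.Kp ^ n) w')) :
    Intertwines D D' φ := by
  have hW := hw.prod hw'
  have g : ∀ y ∈ (D.prod D').ladderSpan (w, w'), y.2 = φ y.1 := by
    have : (D.prod D').ladderSpan (w, w') ≤ LinearMap.graph φ := by
      refine Submodule.span_le.mpr ?_
      rintro _ ⟨⟨n, s⟩, rfl⟩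
      simp only [SetLike.mem_coe, LinearMap.mem_graph_iff, LadderOps.prod, prod_pow, hφ]
    intro y hy
    exact (LinearMap.mem_graph_iff φ y).mp (this hy)
  have hmem : ∀ x, (x, φ x) ∈ (D.prod D').ladderSpan (w, w') := fun x => by
    have hx : x ∈ D.ladderSpan w := by rw [hspan]; trivial
    induction hx using Submodule.span_induction with
    | mem x hx =>
      obtain ⟨⟨n, s⟩, rfl⟩ := hx
      have := mem_ladderSpan (D := D.prod D') (w, w') n s
      simp only [LadderOps.prod, prod_pow] at this
      rwa [hφ]
    | zero => rw [map_zero]; exact Submodule.zero_mem _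
    | add x y _ _ hx hy => rw [map_add]; exact Submodule.add_mem _ hx hy
    | smul c x _ hx => rw [map_smul]; exact Submodule.smul_mem _ c hx
  have c1 : ∀ x, (D.prod D').cas₁ x = a • x := fun x => by
    have : (D.prod D').cas₁ x = (D.cas₁ x.1, D'.cas₁ x.2) := by
      simp [cas₁_apply, LadderOps.prod]
    rw [this, h1, h1']; rfl
  have c2 : ∀ x, (D.prod D').cas₂ x = b • x := fun x => by
    have : (D.prod D').cas₂ x = (D.cas₂ x.1, D'.cas₂ x.2) := by
      simp [cas₂_apply, LadderOps.prod]
    rw [this, h2, h2']; rfl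
  exact .of_generating
    (fun x => (g _ (Jp_mem_ladderSpan hW.highest (hmem x))).symm)
    (fun x => (g _ (Jm_mem_ladderSpan (hmem x))).symm)
    (fun x => (g _ (hW.Kp_mem_ladderSpan c1 c2 (hmem x))).symm)

end LadderOps
end Lorentz

namespace Lorentz

theorem iSup_eigenspace_eq_top_of_span {W ι : Type*} [AddCommGroup W] [Module ℂ W]
    {f : Module.End ℂ W} {e : ι → W} (he : Submodule.span ℂ (Set.range e) = ⊤)
    (h : ∀ i, ∃ μ : ℂ, f (e i) = μ • e i) : ⨆ μ, Module.End.eigenspace f μ = ⊤ := by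
  rw [eq_top_iff, ← he, Submodule.span_le]
  rintro _ ⟨i, rfl⟩
  obtain ⟨μ, hμ⟩ := h i
  exact Submodule.mem_iSup_of_mem μ (Module.End.mem_eigenspace_iff.mpr hμ)

theorem exists_pow_eq_zero_of_span {W ι : Type*} [AddCommGroup W] [Module ℂ W]
    {f : Module.End ℂ W} {e : ι → W} (he : Submodule.span ℂ (Set.range e) = ⊤)
    (h : ∀ i, ∃ N : ℕ, (f ^ N) (e i) = 0) (x : W) : ∃ N : ℕ, (f ^ N) x = 0 := by
  have key : ∀ {M N : ℕ} {y : W}, (f ^ N) y = 0 → (f ^ (M + N)) y = 0 := fun h => by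
    rw [pow_add, Module.End.mul_apply, h, map_zero]
  have hx : x ∈ Submodule.span ℂ (Set.range e) := by rw [he]; trivial
  induction hx using Submodule.span_induction with
  | mem x hx => obtain ⟨i, rfl⟩ := hx; exact h i
  | zero => exact ⟨0, map_zero _⟩
  | add x y _ _ hx hy =>
    obtain ⟨M, hM⟩ := hx
    obtain ⟨N, hN⟩ := hy
    exact ⟨M + N, by rw [map_add, key hN, add_comm M, key hM, add_zero]⟩
  | smul c x _ hx => obtain ⟨M, hM⟩ := hx; exact ⟨M, by rw [map_smul, hM, smul_zero]⟩

namespace V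

theorem sr_ne_zero {x : ℤ} (h : 0 < x) : sr x ≠ 0 := by
  intro h0
  have := sr_sq h.le
  rw [h0] at this
  have h1 : (x : ℂ) ≠ 0 := by exact_mod_cast h.ne'
  exact h1 (by rw [← this]; simp)

theorem sr_zero : sr 0 = 0 := sr_of_nonpos le_rfl

theorem sr_one : sr 1 = 1 := by simp [sr]

variable (k : ℤ) (ρ : ℂ)

/-- The operators of `V_{λ,ρ}`. -/
noncomputable def ladder : LadderOps (V k ρ) := ⟨J0 k ρ, Jp k ρ, Jm k ρ, K0 k ρ, Kp k ρ, Km k ρ,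
  relations k ρ⟩

/-- `V_{λ,ρ}` is not truncated. -/
def AllLevels : Prop := ∀ n : ℕ, IsLevel k ρ n

theorem pm_ne_zero_iff {n : ℤ} (hn : 1 ≤ n) :
    pm k ρ n ≠ 0 ↔ (2 * ρ) ^ 2 ≠ ((|k| + 2 * n : ℤ) : ℂ) ^ 2 := by
  rw [← pow_ne_zero_iff two_ne_zero, pm_sq]
  obtain ⟨N, hN⟩ : ∃ N : ℕ, |k| + 2 * n = N := ⟨(|k| + 2 * n).toNat, by have := abs_nonneg k; omega⟩
  have hN2 : 2 ≤ N := by have := abs_nonneg k; omega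
  have hk : (N : ℤ) ^ 2 - k ^ 2 ≠ 0 := by
    rw [← sq_abs k]
    have := abs_nonneg k
    nlinarith
  have hk' : (N : ℂ) ^ 2 - k ^ 2 ≠ 0 := by exact_mod_cast hk
  have h0 : (N : ℂ) ≠ 0 := by exact_mod_cast (by omega : N ≠ 0)
  have h1 : (N : ℂ) + 1 ≠ 0 := by exact_mod_cast (by omega : N + 1 ≠ 0)
  have h2 : (N : ℂ) - 1 ≠ 0 := sub_ne_zero.mpr (by exact_mod_cast (by omega : N ≠ 1))
  rw [hN, Int.cast_natCast, div_ne_zero_iff, mul_ne_zero_iff]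
  constructor
  · rintro ⟨⟨-, h⟩, -⟩ h'
    exact h (by linear_combination -h')
  · intro h
    refine ⟨⟨hk', fun h' => h (by linear_combination -h')⟩, ?_⟩
    simp [h0, h1, h2]

theorem isLevel_iff (n : ℕ) : IsLevel k ρ n ↔ ∀ n' : ℕ, n' < n → pm k ρ (n' + 1) ≠ 0 := by
  refine forall₂_congr fun n' _ => ?_
  rw [Pplus_eq, pm]

theorem allLevels_iff :
    AllLevels k ρ ↔ ∀ n : ℕ, (2 * ρ) ^ 2 ≠ ((|k| + 2 * (n + 1) : ℤ) : ℂ) ^ 2 := by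
  constructor
  · intro h n
    exact (pm_ne_zero_iff k ρ (by omega)).mp ((isLevel_iff k ρ (n + 1)).mp (h _) n (by omega))
  · intro h n
    exact (isLevel_iff k ρ n).mpr fun n' _ => (pm_ne_zero_iff k ρ (by omega)).mpr (h n')

/-- The basis of the `|j,m⟩`. -/
noncomputable def basis : Module.Basis (BasisIdx k ρ) ℂ (V k ρ) :=
  Module.Basis.ofRepr (LinearEquiv.refl ℂ (BasisIdx k ρ →₀ ℂ))

theorem basis_apply (p : BasisIdx k ρ) : basis k ρ p = ket k ρ p.n p.i := by
  have e : ket k ρ p.n p.i = Finsupp.single p (1 : ℂ) := by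
    have hp : 0 ≤ (p.n : ℤ) ∧ 0 ≤ (p.i : ℤ) ∧ IsLevel k ρ (p.n : ℤ).toNat ∧
      (p.i : ℤ).toNat ≤ k.natAbs + 2 * (p.n : ℤ).toNat :=
        ⟨by omega, by omega, by simpa using p.isLevel, by simpa using p.le⟩
    exact dif_pos hp
  rw [e]
  rfl

theorem span_ket : Submodule.span ℂ (Set.range fun p : BasisIdx k ρ => ket k ρ p.n p.i) = ⊤ := by
  rw [← (basis k ρ).span_eq]
  congr 2
  ext p
  rw [basis_apply]

theorem hom_ext {W : Type*} [AddCommGroup W] [Module ℂ W] {S T : V k ρ →ₗ[ℂ] W}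
    (h : ∀ n i : ℤ, 0 ≤ n → 0 ≤ i → 0 ≤ |k| + 2 * n - i → S (ket k ρ n i) = T (ket k ρ n i)) :
    S = T := by
  refine (basis k ρ).ext fun p => ?_
  rw [basis_apply]
  exact h p.n p.i (by omega) (by omega) (by have := p.le; rw [Int.abs_eq_natAbs]; omega)

theorem allLevels_of_not_finiteDimensional (h : ¬ FiniteDimensional ℂ (V k ρ)) :
    AllLevels k ρ := by
  by_contra hl
  obtain ⟨N, hN⟩ := not_forall.mp hl
  have hb : ∀ p : BasisIdx k ρ, p.n < N := fun p => by
    by_contra! hp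
    exact hN fun n' hn' => p.isLevel n' (by omega)
  have : Finite (BasisIdx k ρ) := by
    refine Finite.of_injective (β := Fin N × Fin (k.natAbs + 2 * N))
      (fun p => (⟨p.n, hb p⟩, ⟨p.i, by have := hb p; have := p.le; omega⟩)) ?_
    rintro ⟨n, i, _, _⟩ ⟨n', i', _, _⟩ h
    simp only [Prod.mk.injEq, Fin.mk.injEq] at h
    obtain ⟨rfl, rfl⟩ := h
    rfl
  exact h (Module.Finite.of_basis (basis k ρ))

theorem not_finiteDimensional_of_allLevels (h : AllLevels k ρ) :
    ¬ FiniteDimensional ℂ (V k ρ) := by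
  intro hf
  have : Finite (BasisIdx k ρ) := Module.Finite.finite_basis (basis k ρ)
  have : Function.Injective fun n : ℕ => (⟨n, 0, h n, by omega⟩ : BasisIdx k ρ) :=
    fun n n' hn => congrArg BasisIdx.n hn
  exact not_injective_infinite_finite _ this

open Classical in
/-- The coefficient along `|j,m⟩`. -/
noncomputable def coeff (n i : ℤ) : V k ρ →ₗ[ℂ] ℂ :=
  if h : 0 ≤ n ∧ 0 ≤ i ∧ IsLevel k ρ n.toNat ∧ i.toNat ≤ k.natAbs + 2 * n.toNat then
    (basis k ρ).coord ⟨n.toNat, i.toNat, h.2.2.1, h.2.2.2⟩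
  else 0

variable {k ρ}

open Classical in
theorem coeff_ket (hl : AllLevels k ρ) (n i n' i' : ℤ) :
    coeff k ρ n i (ket k ρ n' i') =
      if n = n' ∧ i = i' ∧ 0 ≤ n ∧ 0 ≤ i ∧ 0 ≤ |k| + 2 * n - i then 1 else 0 := by
  by_cases h' : 0 ≤ n' ∧ 0 ≤ i' ∧ IsLevel k ρ n'.toNat ∧ i'.toNat ≤ k.natAbs + 2 * n'.toNat
  · have e : ket k ρ n' i' = basis k ρ ⟨n'.toNat, i'.toNat, h'.2.2.1, h'.2.2.2⟩ := by
      rw [basis_apply]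
      simp [Int.toNat_of_nonneg h'.1, Int.toNat_of_nonneg h'.2.1]
    rw [e, coeff]
    rw [range_iff] at h'
    split_ifs with h1 h2 h2
    · rw [Module.Basis.coord_apply, Module.Basis.repr_self, Finsupp.single_apply, if_pos]
      simp [h2]
    · rw [Module.Basis.coord_apply, Module.Basis.repr_self, Finsupp.single_apply, if_neg]
      rw [range_iff] at h1
      simp only [BasisIdx.mk.injEq]
      omega
    · exact (h1 ((range_iff k ρ n i).mpr ⟨h2.2.2.1, h2.2.2.2.1, h2.2.2.2.2, hl _⟩)).elim
    · rfl
  · rw [ket_eq_zero k ρ h', map_zero, if_neg]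
    rw [range_iff] at h'
    rintro ⟨rfl, rfl, h1, h2, h3⟩
    exact h' ⟨h1, h2, h3, hl _⟩

theorem ext_coeff {x y : V k ρ}
    (h : ∀ n i : ℤ, 0 ≤ n → 0 ≤ i → 0 ≤ |k| + 2 * n - i → coeff k ρ n i x = coeff k ρ n i y) :
    x = y := by
  refine (basis k ρ).ext_elem fun p => ?_
  have hp : 0 ≤ (p.n : ℤ) ∧ 0 ≤ (p.i : ℤ) ∧ IsLevel k ρ (p.n : ℤ).toNat ∧
      (p.i : ℤ).toNat ≤ k.natAbs + 2 * (p.n : ℤ).toNat :=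
        ⟨by omega, by omega, by simpa using p.isLevel, by simpa using p.le⟩
  have := h p.n p.i (by omega) (by omega) (by have := p.le; rw [Int.abs_eq_natAbs]; omega)
  have e : coeff k ρ p.n p.i = (basis k ρ).coord p := dif_pos hp
  rwa [e] at this

theorem coeff_J0 (hl : AllLevels k ρ) (n i : ℤ) (x : V k ρ) :
    coeff k ρ n i (J0 k ρ x) = ((i : ℂ) - (|k| + 2 * n : ℤ) / 2) * coeff k ρ n i x := by
  have : coeff k ρ n i ∘ₗ J0 k ρ = ((i : ℂ) - (|k| + 2 * n : ℤ) / 2) • coeff k ρ n i := by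
    refine hom_ext k ρ fun n' i' _ _ _ => ?_
    simp only [LinearMap.comp_apply, J0_ket, map_smul, LinearMap.smul_apply, coeff_ket hl,
      smul_eq_mul]
    split_ifs with h
    · rw [h.1, h.2.1]
    · simp
  exact LinearMap.congr_fun this x

theorem coeff_Jp (hl : AllLevels k ρ) (n i : ℤ) (x : V k ρ) :
    coeff k ρ n (i + 1) (Jp k ρ x) =
      (sr (|k| + 2 * n - i) * sr (i + 1)) * coeff k ρ n i x := by
  have : coeff k ρ n (i + 1) ∘ₗ Jp k ρ = (sr (|k| + 2 * n - i) * sr (i + 1)) • coeff k ρ n i := by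
    refine hom_ext k ρ fun n' i' h1 h2 h3 => ?_
    simp only [LinearMap.comp_apply, Jp_ket, map_smul, LinearMap.smul_apply, coeff_ket hl,
      smul_eq_mul]
    by_cases h : n = n' ∧ i = i'
    · obtain ⟨rfl, rfl⟩ := h
      by_cases hi : |k| + 2 * n - i = 0
      · rw [hi, sr_zero]; simp
      · rw [if_pos ⟨rfl, rfl, h1, by omega, by omega⟩, if_pos ⟨rfl, rfl, h1, h2, h3⟩]
    · rw [if_neg (by omega), if_neg (by omega)]; simp
  exact LinearMap.congr_fun this x

theorem coeff_Jp_pow (hl : AllLevels k ρ) (n i : ℤ) (N : ℕ) (hi : 0 ≤ i)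
    (hN : i + N ≤ |k| + 2 * n) :
    ∃ c : ℂ, c ≠ 0 ∧ ∀ x, coeff k ρ n (i + N) ((Jp k ρ ^ N) x) = c * coeff k ρ n i x := by
  induction N with
  | zero => exact ⟨1, one_ne_zero, by simp⟩
  | succ N ih =>
    obtain ⟨c, hc, e⟩ := ih (by push_cast at hN ⊢; omega)
    refine ⟨(sr (|k| + 2 * n - (i + N)) * sr (i + N + 1)) * c, mul_ne_zero (mul_ne_zero
      (sr_ne_zero (by push_cast at hN; omega)) (sr_ne_zero (by omega))) hc, fun x => ?_⟩
    rw [pow_succ', Module.End.mul_apply]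
    push_cast
    rw [← add_assoc, coeff_Jp hl, e]
    ring

/-- The support of a weight vector on which a power of `J₊` vanishes. -/
theorem support_of_weight (hl : AllLevels k ρ) {μ : ℂ} {x : V k ρ} {N : ℕ}
    (hx : J0 k ρ x = μ • x) (hN : (Jp k ρ ^ N) x = 0) {n i : ℤ} (hi : 0 ≤ i)
    (h : coeff k ρ n i x ≠ 0) :
    (i : ℂ) - (|k| + 2 * n : ℤ) / 2 = μ ∧ |k| + 2 * n < i + N := by
  constructor
  · have := coeff_J0 hl n i x
    rw [hx, map_smul, smul_eq_mul] at this
    exact (mul_right_cancel₀ h this).symm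
  · by_contra! hlt
    obtain ⟨c, hc, e⟩ := coeff_Jp_pow hl n i N hi hlt
    have := e x
    rw [hN, map_zero, eq_comm, mul_eq_zero] at this
    exact this.elim hc h

theorem eq_smul_ket_of_isHighest (hl : AllLevels k ρ) {j : ℂ} {x : V k ρ} (hx0 : x ≠ 0)
    (hx : (ladder k ρ).rot.IsHighest j x) :
    ∃ n : ℕ, j = (|k| + 2 * n : ℤ) / 2 ∧ ∃ c : ℂ, c ≠ 0 ∧ x = c • ket k ρ n (|k| + 2 * n) := by
  have key : ∀ n i : ℤ, 0 ≤ i → 0 ≤ |k| + 2 * n - i → coeff k ρ n i x ≠ 0 →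
      i = |k| + 2 * n ∧ j = (|k| + 2 * n : ℤ) / 2 := fun n i hi hi' h => by
    obtain ⟨h1, h2⟩ := support_of_weight hl (N := 1) hx.weight
      (by rw [pow_one]; exact hx.raise) hi h
    have : i = |k| + 2 * n := by push_cast at h2; omega
    refine ⟨this, ?_⟩
    rw [← h1, this]; ring
  have : ∃ n i : ℤ, 0 ≤ n ∧ 0 ≤ i ∧ 0 ≤ |k| + 2 * n - i ∧ coeff k ρ n i x ≠ 0 := by
    by_contra! h
    exact hx0 (ext_coeff fun n i h1 h2 h3 => by rw [h n i h1 h2 h3, map_zero])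
  obtain ⟨n, i, h1, h2, h3, h4⟩ := this
  obtain ⟨h5, h6⟩ := key n i h2 h3 h4
  lift n to ℕ using h1
  refine ⟨n, h6, coeff k ρ n i x, h4, ext_coeff fun n' i' g1 g2 g3 => ?_⟩
  rw [map_smul, coeff_ket hl, smul_eq_mul]
  split_ifs with h
  · rw [h.1, h.2.1, h5, mul_one]
  · rw [mul_zero]
    by_contra h0
    obtain ⟨h7, h8⟩ := key n' i' g2 g3 h0
    rw [h6] at h8
    have : |k| + 2 * n' = |k| + 2 * n := by
      have h9 : ((|k| + 2 * n' : ℤ) : ℂ) = ((|k| + 2 * n : ℤ) : ℂ) := by linear_combination -2 * h8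
      exact_mod_cast h9
    omega

theorem Jm_pow_ket (n i : ℤ) (s : ℕ) (hi : s ≤ i) (hi' : i ≤ |k| + 2 * n) :
    ∃ c : ℂ, c ≠ 0 ∧ (Jm k ρ ^ s) (ket k ρ n i) = c • ket k ρ n (i - s) := by
  induction s with
  | zero => exact ⟨1, one_ne_zero, by simp⟩
  | succ s ih =>
    obtain ⟨c, hc, e⟩ := ih (by push_cast at hi; omega)
    refine ⟨c * (sr (i - s) * sr (|k| + 2 * n - (i - s) + 1)), mul_ne_zero hc (mul_ne_zero
      (sr_ne_zero (by push_cast at hi; omega)) (sr_ne_zero (by omega))), ?_⟩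
    rw [pow_succ', Module.End.mul_apply, e, map_smul, Jm_ket, smul_smul]
    push_cast
    rw [sub_sub]

variable (k ρ) in
/-- The highest weight vector of the lowest spin. -/
noncomputable def bottom : V k ρ := ket k ρ 0 |k|

theorem Kp_pow_bottom (hl : AllLevels k ρ) (n : ℕ) :
    ∃ c : ℂ, c ≠ 0 ∧ (Kp k ρ ^ n) (bottom k ρ) = c • ket k ρ n (|k| + 2 * n) := by
  induction n with
  | zero => exact ⟨1, one_ne_zero, by simp [bottom]⟩
  | succ n ih =>
    obtain ⟨c, hc, e⟩ := ih
    have hk := abs_nonneg k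
    refine ⟨c * (pm k ρ (n + 1) * (-(sr (|k| + 2 * n + 1) * sr (|k| + 2 * n + 2)))), mul_ne_zero hc
      (mul_ne_zero ((isLevel_iff k ρ (n + 1)).mp (hl _) n (by omega)) (neg_ne_zero.mpr
      (mul_ne_zero (sr_ne_zero (by omega)) (sr_ne_zero (by omega))))), ?_⟩
    rw [pow_succ', Module.End.mul_apply, e, map_smul, Kp_ket]
    simp only [sub_self, sr_zero, zero_mul, mul_zero, zero_smul, add_zero, smul_smul]
    push_cast
    congr 2
    ring

theorem Jm_pow_Kp_pow_bottom (hl : AllLevels k ρ) (n s : ℕ) (hs : s ≤ |k| + 2 * n) :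
    ∃ c : ℂ, c ≠ 0 ∧
      (Jm k ρ ^ s) ((Kp k ρ ^ n) (bottom k ρ)) = c • ket k ρ n (|k| + 2 * n - s) := by
  obtain ⟨c, hc, e⟩ := Kp_pow_bottom hl n
  obtain ⟨d, hd, e'⟩ := Jm_pow_ket (k := k) (ρ := ρ) n (|k| + 2 * n) s hs le_rfl
  exact ⟨c * d, mul_ne_zero hc hd, by rw [e, map_smul, e', smul_smul]⟩

theorem ladderSpan_bottom (hl : AllLevels k ρ) : (ladder k ρ).ladderSpan (bottom k ρ) = ⊤ := by
  rw [eq_top_iff, ← span_ket, Submodule.span_le]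
  rintro _ ⟨p, rfl⟩
  have hp : (p.i : ℤ) ≤ |k| + 2 * p.n := by have := p.le; rw [Int.abs_eq_natAbs]; omega
  obtain ⟨c, hc, e⟩ := Jm_pow_Kp_pow_bottom hl p.n (|k| + 2 * p.n - p.i).toNat (by omega)
  have h := LadderOps.mem_ladderSpan (D := ladder k ρ) (bottom k ρ) p.n
    (|k| + 2 * p.n - p.i).toNat
  have h' : c • ket k ρ p.n p.i ∈ (ladder k ρ).ladderSpan (bottom k ρ) := by
    have e2 : |k| + 2 * (p.n : ℤ) - ((|k| + 2 * p.n - p.i).toNat : ℤ) = p.i := by omega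
    rw [e2] at e
    rw [← e]
    exact h
  exact (Submodule.smul_mem_iff _ hc).mp h'

theorem bottom_isHighest : (ladder k ρ).rot.IsHighest ((|k| : ℤ) / 2) (bottom k ρ) := by
  constructor
  · change J0 k ρ (ket k ρ 0 |k|) = _ • ket k ρ 0 |k|
    rw [J0_ket]; congr 1; push_cast; ring
  · change Jp k ρ (ket k ρ 0 |k|) = 0
    rw [Jp_ket]; simp [sr_zero]

theorem bottom_ne_zero (hl : AllLevels k ρ) : bottom k ρ ≠ 0 := by
  intro h
  have := coeff_ket hl 0 |k| 0 |k|
  rw [bottom] at h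
  rw [h, map_zero, if_pos (by have := abs_nonneg k; omega)] at this
  exact zero_ne_one this

theorem iSup_weight : ⨆ μ, Module.End.eigenspace (J0 k ρ) μ = ⊤ :=
  iSup_eigenspace_eq_top_of_span (span_ket k ρ) fun p => ⟨_, J0_ket k ρ p.n p.i⟩

theorem Jp_pow_ket (n i : ℤ) (N : ℕ) (h : |k| + 2 * n < i + N) :
    (Jp k ρ ^ N) (ket k ρ n i) = 0 := by
  induction N generalizing i with
  | zero => rw [ket_of_gt k ρ (by push_cast at h; omega), map_zero]
  | succ N ih =>
    rw [pow_succ, Module.End.mul_apply, Jp_ket, map_smul, ih _ (by push_cast at h; omega),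
      smul_zero]

theorem Jm_pow_ket_eq_zero (n i : ℤ) (N : ℕ) (h : i < N) :
    (Jm k ρ ^ N) (ket k ρ n i) = 0 := by
  induction N generalizing i with
  | zero => rw [ket_of_lt_zero k ρ (by push_cast at h; omega), map_zero]
  | succ N ih =>
    rw [pow_succ, Module.End.mul_apply, Jm_ket, map_smul, ih _ (by push_cast at h; omega),
      smul_zero]

theorem Jp_nilpotent (x : V k ρ) : ∃ N : ℕ, (Jp k ρ ^ N) x = 0 :=
  exists_pow_eq_zero_of_span (span_ket k ρ) (fun p => ⟨(|k| + 2 * p.n - p.i + 1).toNat,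
    Jp_pow_ket _ _ _ (by omega)⟩) x

theorem Jm_nilpotent (x : V k ρ) : ∃ N : ℕ, (Jm k ρ ^ N) x = 0 :=
  exists_pow_eq_zero_of_span (span_ket k ρ) (fun p => ⟨((p.i : ℤ) + 1).toNat,
    Jm_pow_ket_eq_zero _ _ _ (by omega)⟩) x

theorem pz_zero_mul : pz k ρ 0 * (|k| : ℤ) * ((|k| : ℤ) + 2) = 2 * Complex.I * k * ρ := by
  rcases (abs_nonneg k).eq_or_lt with h | h
  · have : k = 0 := abs_eq_zero.mp h.symm
    simp [this]
  · have := pz_mul k ρ 0 (by omega)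
    rw [← this]; push_cast; ring

theorem K0_bottom : K0 k ρ (bottom k ρ) = (pm k ρ 1 * sr (|k| + 1)) • ket k ρ 1 (|k| + 1)
    + (pz k ρ 0 * ((|k| : ℤ) / 2)) • bottom k ρ := by
  have hp0 : pm k ρ 0 = 0 := Pminus_bot k ρ
  rw [bottom, K0_ket, hp0, zero_mul, zero_smul, add_zero]
  congr 2
  · simp [sr_one]
  · push_cast; ring

theorem Kp_bottom : Kp k ρ (bottom k ρ) =
    (-(pm k ρ 1 * (sr (|k| + 1) * sr (|k| + 2)))) • ket k ρ 1 (|k| + 2) := by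
  have hp0 : pm k ρ 0 = 0 := Pminus_bot k ρ
  rw [bottom, Kp_ket, hp0]
  simp [sr_zero]

theorem cas₁_bottom : (ladder k ρ).cas₁ (bottom k ρ) =
    (Complex.I * (k / 2) * ρ) • bottom k ρ := by
  rw [LadderOps.cas₁_highest bottom_isHighest]
  change _ • K0 k ρ (bottom k ρ) + (1 / 2 : ℂ) • Jm k ρ (Kp k ρ (bottom k ρ)) = _
  have hk := abs_nonneg k
  have e2 := sr_sq (x := |k| + 2) (by omega)
  rw [K0_bottom, Kp_bottom, map_smul, Jm_ket, show |k| + 2 - 1 = |k| + 1 by ring,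
    show |k| + 2 * 1 - (|k| + 2) + 1 = 1 by ring, sr_one]
  have hz := pz_zero_mul (k := k) (ρ := ρ)
  generalize |k| = κ at *
  push_cast at *
  match_scalars
  · linear_combination -(1 / 2) * pm k ρ 1 * sr (κ + 1) * e2
  · linear_combination (1 / 4) * hz

theorem cas₂_bottom : (ladder k ρ).cas₂ (bottom k ρ) =
    ((k / 2) ^ 2 + ρ ^ 2 - 1 : ℂ) • bottom k ρ := by
  rw [LadderOps.cas₂_highest bottom_isHighest]
  change _ • bottom k ρ - K0 k ρ (K0 k ρ (bottom k ρ)) - Km k ρ (Kp k ρ (bottom k ρ)) = _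
  have hk := abs_nonneg k
  have e1 := sr_sq (x := |k| + 1) (by omega)
  have e2 := sr_sq (x := |k| + 2) (by omega)
  have e22 := sr_sq (x := 2) (by omega)
  rw [K0_bottom, Kp_bottom, map_smul, map_add, map_smul, map_smul, K0_bottom, Km_ket, K0_ket,
    show |k| + 2 - 1 = |k| + 1 by ring, show |k| + 2 - 2 = |k| by ring,
    show |k| + 2 * 1 - (|k| + 2) + 1 = 1 by ring, show |k| + 2 * 1 - (|k| + 2) + 2 = 2 by ring,
    show |k| + 2 * 1 - (|k| + 1) = 1 by ring, show |k| + 1 - 1 = |k| by ring,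
    show |k| + 1 + 1 = |k| + 2 by ring, show (1 : ℤ) + 1 = 2 by norm_num,
    show (1 : ℤ) - 1 = 0 by norm_num, sr_one, ← bottom.eq_def]
  have hz := pz_zero_mul (k := k) (ρ := ρ)
  have hs := pz_step k ρ le_rfl
  have hp := pm_sq k ρ 1
  have hk2 : ((|k| : ℤ) : ℂ) ^ 2 = (k : ℂ) ^ 2 := by exact_mod_cast sq_abs k
  obtain ⟨N, hN⟩ : ∃ N : ℕ, |k| = N := ⟨|k|.toNat, by omega⟩
  rw [hN] at e1 e2 hz hs hp hk2 ⊢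
  push_cast at *
  have h1 : ((N : ℂ) + 1) ≠ 0 := by exact_mod_cast (by omega : N + 1 ≠ 0)
  have h2 : ((N : ℂ) + 2) ≠ 0 := by exact_mod_cast (by omega : N + 2 ≠ 0)
  have h3 : ((N : ℂ) + 3) ≠ 0 := by exact_mod_cast (by omega : N + 3 ≠ 0)
  have hp' : pm k ρ 1 ^ 2 * (((N : ℂ) + 1) * (N + 3)) =
      ((N + 2) ^ 2 - N ^ 2) * ((N + 2) ^ 2 - 4 * ρ ^ 2) / (4 * (N + 2) ^ 2) := by
    rw [hp, ← hk2, show (N : ℂ) + 2 + 1 = N + 3 by ring,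
      show (N : ℂ) + 2 - 1 = N + 1 by ring]
    field_simp
  have hz' : (pz k ρ 0 * N) ^ 2 = -(4 * N ^ 2 * ρ ^ 2) / (N + 2) ^ 2 := by
    rw [eq_div_iff (pow_ne_zero 2 h2), ← mul_pow, hz, hk2]
    simp only [mul_pow, Complex.I_sq]; ring
  have hfin : ((N : ℂ) / 2) ^ 2 + 2 * (N / 2)
      - ((N + 2) ^ 2 - N ^ 2) * ((N + 2) ^ 2 - 4 * ρ ^ 2) / (4 * (N + 2) ^ 2)
      - (-(4 * N ^ 2 * ρ ^ 2) / (N + 2) ^ 2) / 4 = N ^ 2 / 4 + ρ ^ 2 - 1 := by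
    field_simp
    ring
  match_scalars
  · linear_combination hfin - hp' - hz' / 4 + hk2 / 4 - pm k ρ 1 ^ 2 * e1
      - pm k ρ 1 ^ 2 * sr (N + 1) ^ 2 * e2 - pm k ρ 1 ^ 2 * (N + 2) * e1
  · ring
  · linear_combination pm k ρ 1 * sr (N + 1) * pz k ρ 1 * e2 - pm k ρ 1 * sr (N + 1) / 2 * hs

theorem cas₁_eq (hl : AllLevels k ρ) (x : V k ρ) :
    (ladder k ρ).cas₁ x = (Complex.I * (k / 2) * ρ) • x :=
  LadderOps.eq_smul_of_ladderSpan (ladderSpan_bottom hl) (ladder k ρ).cas₁_Jm (ladder k ρ).cas₁_Kp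
    cas₁_bottom x

theorem cas₂_eq (hl : AllLevels k ρ) (x : V k ρ) :
    (ladder k ρ).cas₂ x = ((k / 2) ^ 2 + ρ ^ 2 - 1 : ℂ) • x :=
  LadderOps.eq_smul_of_ladderSpan (ladderSpan_bottom hl) (ladder k ρ).cas₂_Jm (ladder k ρ).cas₂_Kp
    cas₂_bottom x

theorem half_cas_eq (hl : AllLevels k ρ) (A : ℤˣ) (x : V k ρ) :
    ((ladder k ρ).half A).cas x = ((ρ + ((A : ℤ) : ℂ) * k / 2) ^ 2) • x := by
  rw [LadderOps.half_cas]
  simp only [LinearMap.add_apply, LinearMap.sub_apply, LinearMap.smul_apply, cas₁_eq hl,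
    cas₂_eq hl, Module.End.one_apply]
  match_scalars
  linear_combination -(((A : ℤ) : ℂ) * k * ρ) * Complex.I_sq - k ^ 2 / 4 * sign_sq A

theorem bottom_isBottom (hl : AllLevels k ρ) :
    (ladder k ρ).IsBottom (Complex.I * (k / 2) * ρ) ((k.natAbs : ℂ) / 2) (bottom k ρ) := by
  have hk : ((|k| : ℤ) : ℂ) = (k.natAbs : ℂ) := by rw [Int.abs_eq_natAbs]; simp
  refine (LadderOps.isBottom_of_forall (cas₁_eq hl) Jm_nilpotent (hk ▸ bottom_isHighest)
    fun x hx => ?_).1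
  by_contra h
  obtain ⟨n, hn, -⟩ := eq_smul_ket_of_isHighest hl h hx
  push_cast at hn
  rw [hk] at hn
  have : ((2 * (n + 1) : ℕ) : ℂ) = (0 : ℕ) := by push_cast; linear_combination -2 * hn
  have := Nat.cast_injective this
  omega

theorem coeff_Kp (hl : AllLevels k ρ) (n i : ℤ) (hn : 0 ≤ n) (hi : 0 ≤ i)
    (hi' : i ≤ |k| + 2 * n) (x : V k ρ) :
    coeff k ρ (n + 1) (i + 2) (Kp k ρ x) =
      (pm k ρ (n + 1) * (-(sr (i + 1) * sr (i + 2)))) * coeff k ρ n i x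
      + (pz k ρ (n + 1) * (sr (|k| + 2 * (n + 1) - (i + 1)) * sr (i + 1 + 1)))
        * coeff k ρ (n + 1) (i + 1) x
      + (pm k ρ (n + 2) * (sr (|k| + 2 * (n + 2) - (i + 2)) * sr (|k| + 2 * (n + 2) - (i + 2) - 1)))
        * coeff k ρ (n + 2) (i + 2) x := by
  have : coeff k ρ (n + 1) (i + 2) ∘ₗ Kp k ρ =
      (pm k ρ (n + 1) * (-(sr (i + 1) * sr (i + 2)))) • coeff k ρ n i
      + (pz k ρ (n + 1) * (sr (|k| + 2 * (n + 1) - (i + 1)) * sr (i + 1 + 1)))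
        • coeff k ρ (n + 1) (i + 1)
      + (pm k ρ (n + 2) * (sr (|k| + 2 * (n + 2) - (i + 2)) * sr (|k| + 2 * (n + 2) - (i + 2) - 1)))
        • coeff k ρ (n + 2) (i + 2) := by
    refine hom_ext k ρ fun n' i' _ _ _ => ?_
    simp only [LinearMap.comp_apply, LinearMap.add_apply, Kp_ket, map_smul, map_add,
      LinearMap.smul_apply, coeff_ket hl, smul_eq_mul]
    by_cases h1 : n = n' ∧ i = i'
    · obtain ⟨rfl, rfl⟩ := h1
      rw [if_pos (by omega), if_neg (by omega), if_neg (by omega), if_pos (by omega),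
        if_neg (by omega), if_neg (by omega)]
      ring
    by_cases h2 : n' = n + 1 ∧ i' = i + 1
    · obtain ⟨rfl, rfl⟩ := h2
      rw [if_neg (by omega), if_pos (by omega), if_neg (by omega), if_neg (by omega),
        if_pos (by omega), if_neg (by omega)]
      ring
    by_cases h3 : n' = n + 2 ∧ i' = i + 2
    · obtain ⟨rfl, rfl⟩ := h3
      rw [if_neg (by omega), if_neg (by omega), if_pos (by omega), if_neg (by omega),
        if_neg (by omega), if_pos (by omega)]
      ring
    rw [if_neg (by omega), if_neg (by omega), if_neg (by omega), if_neg (by omega),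
        if_neg (by omega), if_neg (by omega)]
    simp
  exact LinearMap.congr_fun this x

theorem exists_coeff_eq_zero (hl : AllLevels k ρ) (x : V k ρ) :
    ∃ N : ℕ, ∀ n i : ℤ, N < n → coeff k ρ n i x = 0 := by
  have hx : x ∈ Submodule.span ℂ (Set.range fun p : BasisIdx k ρ => ket k ρ p.n p.i) := by
    rw [span_ket]; trivial
  induction hx using Submodule.span_induction with
  | mem x hx =>
    obtain ⟨p, rfl⟩ := hx
    exact ⟨p.n, fun n i h => by rw [coeff_ket hl, if_neg (by omega)]⟩
  | zero => exact ⟨0, fun n i _ => map_zero _⟩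
  | add x y _ _ hx hy =>
    obtain ⟨M, hM⟩ := hx
    obtain ⟨N, hN⟩ := hy
    exact ⟨M + N, fun n i h => by
      rw [map_add, hM n i (by push_cast at h; omega), hN n i (by push_cast at h; omega), add_zero]⟩
  | smul c x _ hx =>
    obtain ⟨M, hM⟩ := hx
    exact ⟨M, fun n i h => by rw [map_smul, hM n i h, smul_zero]⟩

/-- `J₊ + c K₊`, `c ≠ 0`, is injective. -/
theorem eq_zero_of_Jp_add_Kp (hl : AllLevels k ρ) {c : ℂ} (hc : c ≠ 0) {x : V k ρ}
    (hx : Jp k ρ x + c • Kp k ρ x = 0) : x = 0 := by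
  obtain ⟨N, hN⟩ := exists_coeff_eq_zero hl x
  have key : ∀ m : ℕ, ∀ n i : ℤ, 0 ≤ n → 0 ≤ i → i ≤ |k| + 2 * n → N < n + m →
      coeff k ρ n i x = 0 := by
    intro m
    induction m with
    | zero => intro n i _ _ _ h; exact hN n i (by simpa using h)
    | succ m ih =>
      intro n i h1 h2 h3 h4
      have e := congrArg (coeff k ρ (n + 1) (i + 2)) hx
      rw [map_add, map_smul, coeff_Kp hl n i h1 h2 h3, map_zero,
        show i + 2 = (i + 1) + 1 by ring, coeff_Jp hl,
        ih (n + 1) (i + 1) (by omega) (by omega) (by omega) (by push_cast at h4; omega),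
        ih (n + 2) (i + 1 + 1) (by omega) (by omega) (by omega) (by push_cast at h4; omega)] at e
      have hp : pm k ρ (n + 1) ≠ 0 := by
        lift n to ℕ using h1
        exact (isLevel_iff k ρ (n + 1)).mp (hl _) n (by omega)
      have h5 := sr_ne_zero (x := i + 1) (by omega)
      have h6 := sr_ne_zero (x := i + 1 + 1) (by omega)
      simpa [hc, hp, h5, h6] using e
  refine ext_coeff fun n i h1 h2 h3 => ?_
  rw [map_zero]
  exact key (N + 1) n i h1 h2 (by omega) (by push_cast; omega)

/-- `J₋ + c K₋`, `c ≠ 0`, is not nilpotent. -/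
theorem Jm_add_Km_pow_ne_zero (hl : AllLevels k ρ) {c : ℂ} (hc : c ≠ 0) (N : ℕ) :
    ∃ d : ℂ, d ≠ 0 ∧ ((Jm k ρ + c • Km k ρ) ^ N) (ket k ρ 0 0) = d • ket k ρ N 0 := by
  have hk := abs_nonneg k
  induction N with
  | zero => exact ⟨1, one_ne_zero, by simp⟩
  | succ N ih =>
    obtain ⟨d, hd, e⟩ := ih
    refine ⟨d * (c * (pm k ρ (N + 1) * (sr (|k| + 2 * N + 1) * sr (|k| + 2 * N + 2)))),
      mul_ne_zero hd (mul_ne_zero hc (mul_ne_zero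
        ((isLevel_iff k ρ (N + 1)).mp (hl _) N (by omega))
        (mul_ne_zero (sr_ne_zero (by omega)) (sr_ne_zero (by omega))))), ?_⟩
    rw [pow_succ', Module.End.mul_apply, e, map_smul, LinearMap.add_apply, LinearMap.smul_apply,
      Jm_ket, Km_ket]
    simp only [sr_zero, zero_mul, mul_zero, neg_zero, zero_smul, add_zero, zero_add, smul_smul,
      sub_zero]
    push_cast
    rfl

end V
end Lorentz

namespace Lorentz
namespace V

variable {k : ℤ} {ρ : ℂ}

theorem isLocallyFinite : (ladder k ρ).IsLocallyFinite := ⟨iSup_weight, Jp_nilpotent, Jm_nilpotent⟩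

theorem exists_linearMap (hl : AllLevels k ρ) {E : Type*} [AddCommGroup E] [Module ℂ E]
    {D : LadderOps E} (hD : D.IsLocallyFinite) {w : E}
    (hw : D.rot.IsHighest (k.natAbs / 2) w) :
    ∃ φ : V k ρ →ₗ[ℂ] E, ∀ n s : ℕ, φ ((Jm k ρ ^ s) ((Kp k ρ ^ n) (bottom k ρ))) =
      (D.Jm ^ s) ((D.Kp ^ n) w) := by
  have hc : ∀ n s : ℕ, ∃ c : ℂ, s ≤ |k| + 2 * n → c ≠ 0 ∧
      (Jm k ρ ^ s) ((Kp k ρ ^ n) (bottom k ρ)) = c • ket k ρ n (|k| + 2 * n - s) := fun n s => by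
    by_cases h : s ≤ |k| + 2 * n
    · obtain ⟨c, h1, h2⟩ := Jm_pow_Kp_pow_bottom (ρ := ρ) hl n s h
      exact ⟨c, fun _ => ⟨h1, h2⟩⟩
    · exact ⟨0, fun h' => absurd h' h⟩
  choose κ hκ using hc
  refine ⟨(basis k ρ).constr ℂ fun p => (κ p.n (k.natAbs + 2 * p.n - p.i))⁻¹ •
    (D.Jm ^ (k.natAbs + 2 * p.n - p.i)) ((D.Kp ^ p.n) w), fun n s => ?_⟩
  by_cases h : s ≤ |k| + 2 * n
  · have h' : s ≤ k.natAbs + 2 * n := by rw [Int.abs_eq_natAbs] at h; omega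
    obtain ⟨h1, h2⟩ := hκ n s h
    have e : ket k ρ n (|k| + 2 * n - s) =
        basis k ρ ⟨n, k.natAbs + 2 * n - s, hl n, by omega⟩ := by
      rw [basis_apply, Int.abs_eq_natAbs]
      congr 1
      push_cast [Nat.cast_sub h']
      ring
    rw [h2, map_smul, e, Module.Basis.constr_basis]
    simp only [Nat.sub_sub_self h']
    rw [smul_smul, mul_inv_cancel₀ h1, one_smul]
  · obtain ⟨c, -, e⟩ := Kp_pow_bottom (ρ := ρ) hl n
    rw [e, map_smul, Jm_pow_ket_eq_zero _ _ _ (by omega), smul_zero, map_zero]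
    have h3 := LadderOps.Kp_pow_highest hw n
    have h4 : (k.natAbs : ℂ) / 2 + n = ((k.natAbs + 2 * n : ℕ) : ℂ) / 2 := by push_cast; ring
    rw [h4] at h3
    have h5 : (D.Jm ^ (k.natAbs + 2 * n + 1)) ((D.Kp ^ n) w) = 0 := h3.Sm_pow_eq_zero hD.lower
    obtain ⟨t, ht⟩ : ∃ t, s = t + (k.natAbs + 2 * n + 1) :=
      ⟨s - (k.natAbs + 2 * n + 1), by rw [Int.abs_eq_natAbs] at h; omega⟩
    rw [ht, pow_add, Module.End.mul_apply, h5, map_zero]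

/-- A locally finite module with the Casimirs of `V_{λ,ρ}` in which all highest weight vectors come
from one of spin `|λ|` is isomorphic to `V_{λ,ρ}`. -/
theorem exists_equiv (hl : AllLevels k ρ) {E : Type*} [AddCommGroup E] [Module ℂ E]
    {D : LadderOps E} (hD : D.IsLocallyFinite)
    (h1 : ∀ x, D.cas₁ x = (Complex.I * (k / 2) * ρ) • x)
    (h2 : ∀ x, D.cas₂ x = ((k / 2) ^ 2 + ρ ^ 2 - 1 : ℂ) • x) {w : E}
    (hw : D.IsBottom (Complex.I * (k / 2) * ρ) (k.natAbs / 2) w)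
    (hne : ∀ n : ℕ, (D.Kp ^ n) w ≠ 0)
    (hHW : ∀ j x, D.rot.IsHighest j x → x ∈ D.ladderSpan w) :
    ∃ φ : V k ρ ≃ₗ[ℂ] E, LadderOps.Intertwines (ladder k ρ) D φ.toLinearMap := by
  obtain ⟨φ, hφ⟩ := exists_linearMap hl hD hw.highest
  have hi : LadderOps.Intertwines (ladder k ρ) D φ :=
    (bottom_isBottom hl).intertwines (cas₁_eq hl) (cas₂_eq hl) h1 h2 hw (ladderSpan_bottom hl) hφ
  have hinj : Function.Injective φ := by
    rw [← LinearMap.ker_eq_bot]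
    by_contra hk
    have := (Submodule.nontrivial_iff_ne_bot).mpr hk
    obtain ⟨n, ⟨x, hx⟩, hx0, hH⟩ := (isLocallyFinite.restrict hi.isStable_ker).exists_highest
    rw [LadderOps.isHighest_restrict] at hH
    have hx0' : x ≠ 0 := fun h => hx0 (Subtype.ext h)
    obtain ⟨m, -, c, hc, rfl⟩ := eq_smul_ket_of_isHighest hl hx0' hH
    obtain ⟨d, hd, e⟩ := Kp_pow_bottom (ρ := ρ) hl m
    apply hne m
    have h3 := hφ m 0
    simp only [pow_zero, Module.End.one_apply] at h3
    rw [← h3, e, map_smul]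
    rw [LinearMap.mem_ker, map_smul, smul_eq_zero] at hx
    rw [hx.resolve_left hc, smul_zero]
  have hsurj : LinearMap.range φ = ⊤ := by
    refine SpinOps.eq_top_of_highest (S := D.rot) ?_ ?_ hD.weight hD.raise hD.lower ?_
    · rintro _ ⟨x, rfl⟩; exact ⟨_, hi.Jp x⟩
    · rintro _ ⟨x, rfl⟩; exact ⟨_, hi.Jm x⟩
    · intro j x hx
      refine Submodule.span_le.mpr ?_ (hHW j x hx)
      rintro _ ⟨⟨n, s⟩, rfl⟩
      exact ⟨_, hφ n s⟩
  exact ⟨LinearEquiv.ofBijective φ ⟨hinj, LinearMap.range_eq_top.mp hsurj⟩, hi⟩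

end V
end Lorentz

namespace Lorentz
namespace SpinOps

variable {N : Type*} [AddCommGroup N] [Module ℂ N] {N' : Type*} [AddCommGroup N'] [Module ℂ N']
variable {M : Type*} [AddCommGroup M] [Module ℂ M]

/-- The tensor product of two representations of `𝔰𝔩₂`. -/
noncomputable def tensor (S : SpinOps N) (T : SpinOps M) : SpinOps (N ⊗[ℂ] M) where
  S0 := S.S0.rTensor M + T.S0.lTensor N
  Sp := S.Sp.rTensor M + T.Sp.lTensor N
  Sm := S.Sm.rTensor M + T.Sm.lTensor N
  zero_plus x := by
    induction x with
    | zero => simp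
    | tmul x y =>
      simp only [LinearMap.add_apply, LinearMap.rTensor_tmul, LinearMap.lTensor_tmul, map_add,
        S.zero_plus, T.zero_plus, TensorProduct.tmul_add, TensorProduct.add_tmul]
      abel
    | add x y hx hy => simp only [map_add, hx, hy]; abel
  zero_minus x := by
    induction x with
    | zero => simp
    | tmul x y =>
      simp only [LinearMap.add_apply, LinearMap.rTensor_tmul, LinearMap.lTensor_tmul, map_add,
        S.zero_minus, T.zero_minus, TensorProduct.tmul_sub, TensorProduct.sub_tmul]
      abel
    | add x y hx hy => simp only [map_add, hx, hy]; abel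
  plus_minus x := by
    induction x with
    | zero => simp
    | tmul x y =>
      simp only [LinearMap.add_apply, LinearMap.rTensor_tmul, LinearMap.lTensor_tmul, map_add,
        S.plus_minus, T.plus_minus, TensorProduct.tmul_add, TensorProduct.add_tmul, smul_add,
        TensorProduct.smul_tmul', TensorProduct.tmul_smul]
      abel
    | add x y hx hy => simp only [map_add, hx, hy, smul_add]; abel

variable (S : SpinOps N) (S' : SpinOps N') (T : SpinOps M)

theorem tensor_S0 (x : N) (y : M) : (S.tensor T).S0 (x ⊗ₜ y) = S.S0 x ⊗ₜ y + x ⊗ₜ T.S0 y := by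
  simp [tensor]
theorem tensor_Sp (x : N) (y : M) : (S.tensor T).Sp (x ⊗ₜ y) = S.Sp x ⊗ₜ y + x ⊗ₜ T.Sp y := by
  simp [tensor]
theorem tensor_Sm (x : N) (y : M) : (S.tensor T).Sm (x ⊗ₜ y) = S.Sm x ⊗ₜ y + x ⊗ₜ T.Sm y := by
  simp [tensor]

/-- Two maps `N → N'` that form a spin `1/2` tensor operator and are jointly surjective. -/
structure IsDoublet (S : SpinOps N) (S' : SpinOps N') (u v : N →ₗ[ℂ] N') : Prop where
  zero_up : ∀ x, S'.S0 (u x) = u (S.S0 x) + (1 / 2 : ℂ) • u x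
  zero_down : ∀ x, S'.S0 (v x) = v (S.S0 x) - (1 / 2 : ℂ) • v x
  plus_up : ∀ x, S'.Sp (u x) = u (S.Sp x)
  plus_down : ∀ x, S'.Sp (v x) = v (S.Sp x) + u x
  minus_up : ∀ x, S'.Sm (u x) = u (S.Sm x) + v x
  minus_down : ∀ x, S'.Sm (v x) = v (S.Sm x)
  surj : Function.Surjective (u.coprod v)

/-- Twice the scalar product of the spin `1/2` operators with `S`, shifted so that its square is
the Casimir of `S`. -/
noncomputable def dirac : Module.End ℂ (N × N) :=
  LinearMap.prod (LinearMap.coprod ((2 : ℂ) • S.S0 + 1) ((2 : ℂ) • S.Sm))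
    (LinearMap.coprod ((2 : ℂ) • S.Sp) (1 - (2 : ℂ) • S.S0))

theorem dirac_apply (y : N × N) : S.dirac y = ((2 : ℂ) • S.S0 y.1 + y.1 + (2 : ℂ) • S.Sm y.2,
    (2 : ℂ) • S.Sp y.1 + (y.2 - (2 : ℂ) • S.S0 y.2)) := rfl

theorem dirac_dirac (y : N × N) : S.dirac (S.dirac y) = (S.cas y.1, S.cas y.2) := by
  refine Prod.ext ?_ ?_ <;>
    simp only [dirac_apply, cas_apply, map_add, map_sub, map_smul, S.zero_plus, S.zero_minus,
      S.plus_minus] <;> module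

variable {S S' T} {u v : N →ₗ[ℂ] N'}

theorem IsDoublet.cas_coprod (h : IsDoublet S S' u v) (y : N × N) :
    S'.cas (u.coprod v y) =
      u.coprod v (S.dirac (S.dirac y) + (2 : ℂ) • S.dirac y + y) := by
  rw [dirac_dirac]
  simp only [LinearMap.coprod_apply, Prod.fst_add, Prod.snd_add, Prod.smul_fst, Prod.smul_snd,
    dirac_apply, cas_apply, map_add, map_sub, map_smul, h.zero_up, h.zero_down, h.plus_up,
    h.plus_down, h.minus_up, h.minus_down]
  module

theorem IsDoublet.cas_coprod_of_dirac (h : IsDoublet S S' u v) {y : N × N} {s : ℂ}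
    (hy : S.dirac y = s • y) : S'.cas (u.coprod v y) = (s + 1) ^ 2 • u.coprod v y := by
  rw [h.cas_coprod, hy, map_smul, hy, ← map_smul]
  congr 1
  module

/-- If the Casimir of `N` is diagonalisable with nonzero eigenvalues `s²`, that of `N'` is
diagonalisable with eigenvalues `(s ± 1)²`. -/
theorem IsDoublet.iSup_eigenspace (h : IsDoublet S S' u v) {ι : Type*} {s : ι → ℂ}
    (hs : ∀ i, s i ≠ 0) (hN : ⨆ i, Module.End.eigenspace S.cas (s i ^ 2) = ⊤)
    {P : Submodule ℂ N'} (hp : ∀ i, Module.End.eigenspace S'.cas ((s i + 1) ^ 2) ≤ P)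
    (hm : ∀ i, Module.End.eigenspace S'.cas ((s i - 1) ^ 2) ≤ P) : P = ⊤ := by
  have key : ∀ i (y : N × N), S.cas y.1 = s i ^ 2 • y.1 → S.cas y.2 = s i ^ 2 • y.2 →
      u.coprod v y ∈ P := by
    intro i y h1 h2
    have hd : S.dirac (S.dirac y) = s i ^ 2 • y := by rw [dirac_dirac, h1, h2]; rfl
    have e1 : S.dirac (y + (s i)⁻¹ • S.dirac y) = s i • (y + (s i)⁻¹ • S.dirac y) := by
      rw [map_add, map_smul, hd, smul_add, smul_smul, smul_smul, mul_inv_cancel₀ (hs i),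
        sq, ← mul_assoc, inv_mul_cancel₀ (hs i)]
      module
    have e2 : S.dirac (y - (s i)⁻¹ • S.dirac y) = (-s i) • (y - (s i)⁻¹ • S.dirac y) := by
      rw [map_sub, map_smul, hd, smul_sub, smul_smul, smul_smul, neg_mul, mul_inv_cancel₀ (hs i),
        sq, ← mul_assoc, inv_mul_cancel₀ (hs i)]
      module
    have m1 := hp i (Module.End.mem_eigenspace_iff.mpr (h.cas_coprod_of_dirac e1))
    have m2 := h.cas_coprod_of_dirac e2
    rw [show (-s i + 1) ^ 2 = (s i - 1) ^ 2 by ring] at m2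
    replace m2 := hm i (Module.End.mem_eigenspace_iff.mpr m2)
    have := P.smul_mem (1 / 2 : ℂ) (P.add_mem m1 m2)
    rw [← map_add, ← map_smul] at this
    convert this using 2
    module
  have hu : ∀ y, u y ∈ P := by
    suffices ⊤ ≤ P.comap u from fun y => this (Submodule.mem_top (x := y))
    rw [← hN]
    refine iSup_le fun i y hy => ?_
    have := key i (y, 0) (Module.End.mem_eigenspace_iff.mp hy) (by simp)
    simpa using this
  have hv : ∀ y, v y ∈ P := by
    suffices ⊤ ≤ P.comap v from fun y => this (Submodule.mem_top (x := y))
    rw [← hN]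
    refine iSup_le fun i y hy => ?_
    have := key i (0, y) (by simp) (Module.End.mem_eigenspace_iff.mp hy)
    simpa using this
  rw [eq_top_iff]
  intro x _
  obtain ⟨y, rfl⟩ := h.surj x
  exact P.add_mem (hu _) (hv _)

/-- An eigenvalue `c` of the transposed Casimir of `N'` is `(s + 1)²` for an eigenvalue `s²` of that
of `N`. -/
theorem IsDoublet.exists_eigenvalue (h : IsDoublet S S' u v) {f : N' →ₗ[ℂ] ℂ} (hf : f ≠ 0) {c : ℂ}
    (hc : ∀ x, f (S'.cas x) = c * f x) :
    ∃ (s : ℂ) (g : N →ₗ[ℂ] ℂ), g ≠ 0 ∧ (∀ x, g (S.cas x) = s ^ 2 * g x) ∧ c = (s + 1) ^ 2 := by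
  obtain ⟨μ, rfl⟩ : ∃ μ : ℂ, μ ^ 2 = c := IsAlgClosed.exists_pow_nat_eq c two_pos
  have red : ∀ (s : ℂ) (g : N × N →ₗ[ℂ] ℂ), g ≠ 0 → (∀ y, g (S.dirac y) = s * g y) →
      ∃ (g : N →ₗ[ℂ] ℂ), g ≠ 0 ∧ (∀ x, g (S.cas x) = s ^ 2 * g x) := by
    intro s g hg hs
    have h2 : ∀ y : N × N, g (S.cas y.1, S.cas y.2) = s ^ 2 * g y := fun y => by
      rw [← dirac_dirac, hs, hs]; ring
    by_cases h0 : g ∘ₗ LinearMap.inl ℂ N N = 0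
    · refine ⟨g ∘ₗ LinearMap.inr ℂ N N, fun h1 => hg (LinearMap.prod_ext h0 h1), fun x => ?_⟩
      have := h2 (0, x)
      rwa [map_zero] at this
    · refine ⟨g ∘ₗ LinearMap.inl ℂ N N, h0, fun x => ?_⟩
      have := h2 (x, 0)
      rwa [map_zero] at this
  set g : N × N →ₗ[ℂ] ℂ := f ∘ₗ u.coprod v with hgdef
  have hg : g ≠ 0 := fun h0 => hf (LinearMap.ext fun x => by
    obtain ⟨y, rfl⟩ := h.surj x
    exact LinearMap.congr_fun h0 y)
  have hg2 : ∀ y, g (S.dirac (S.dirac y)) = (μ ^ 2 - 1) * g y - 2 * g (S.dirac y) := fun y => by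
    have := hc (u.coprod v y)
    rw [h.cas_coprod] at this
    change g (_ + _ + _) = _ * g y at this
    rw [map_add, map_add, map_smul, smul_eq_mul] at this
    linear_combination this
  by_cases h1 : ∀ y, g (S.dirac y) = (μ - 1) * g y
  · obtain ⟨g', h2, h3⟩ := red _ g hg h1
    exact ⟨μ - 1, g', h2, h3, by ring⟩
  · obtain ⟨g', h2, h3⟩ := red (-μ - 1) (g ∘ₗ S.dirac - (μ - 1) • g)
      (fun h0 => h1 fun y => by
        have := LinearMap.congr_fun h0 y
        simpa [sub_eq_zero] using this)
      (fun y => by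
        simp only [LinearMap.sub_apply, LinearMap.comp_apply, LinearMap.smul_apply, smul_eq_mul,
          hg2]
        ring)
    exact ⟨-μ - 1, g', h2, h3, by ring⟩

end SpinOps

namespace F

variable (A : ℤˣ) (a : ℕ)

/-- The rotation operators of `F^A_γ`. -/
noncomputable def spin : SpinOps (F A a) where
  S0 := J0 A a
  Sp := Jp A a
  Sm := Jm A a
  zero_plus x := LadderOps.apply_comm (rel1 A a) x
  zero_minus x := by
    rw [LadderOps.apply_comm (rel2 A a) x, LinearMap.neg_apply, sub_eq_add_neg]
  plus_minus x := LadderOps.apply_comm (rel3 A a) x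

/-- Multiplication by the upper component of a spinor. -/
noncomputable def up : F A a →ₗ[ℂ] F A (a + 1) :=
  Finsupp.linearCombination ℂ fun i : Fin (a + 1) => V.sr ((i : ℕ) + 1) • ket A (a + 1) ((i : ℕ) + 1)

/-- Multiplication by the lower component of a spinor. -/
noncomputable def down : F A a →ₗ[ℂ] F A (a + 1) :=
  Finsupp.linearCombination ℂ fun i : Fin (a + 1) => V.sr (a + 1 - (i : ℕ)) • ket A (a + 1) (i : ℕ)

variable {A a}

theorem ket_of_nat {i : ℕ} (h : i < a + 1) :
    ket A a i = Finsupp.single (⟨i, h⟩ : Fin (a + 1)) (1 : ℂ) := dif_pos ⟨by omega, h⟩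

theorem hom_ext {W : Type*} [AddCommGroup W] [Module ℂ W] {S T : F A a →ₗ[ℂ] W}
    (h : ∀ i : ℤ, 0 ≤ i → 0 ≤ a - i → S (ket A a i) = T (ket A a i)) : S = T := by
  refine Finsupp.lhom_ext' fun p => LinearMap.ext_ring ?_
  have := h (p : ℕ) (by omega) (by have := p.isLt; omega)
  rwa [ket_of_nat p.isLt] at this

variable (A a) in
/-- The basis of the `|γ_A,μ⟩`. -/
noncomputable def basis : Module.Basis (Fin (a + 1)) ℂ (F A a) :=
  .ofRepr (LinearEquiv.refl ℂ (Fin (a + 1) →₀ ℂ))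

theorem basis_apply (i : Fin (a + 1)) : basis A a i = ket A a (i : ℕ) := by
  rw [ket_of_nat i.isLt]; rfl

theorem span_ket : Submodule.span ℂ (Set.range fun i : Fin (a + 1) => ket A a (i : ℕ)) = ⊤ := by
  rw [← (basis A a).span_eq]
  exact congrArg _ (congrArg _ (funext fun i => (basis_apply i).symm))

theorem up_ket (i : ℤ) : up A a (ket A a i) = V.sr (i + 1) • ket A (a + 1) (i + 1) := by
  by_cases h : 0 ≤ i ∧ i.toNat < a + 1
  · lift i to ℕ using h.1
    rw [ket_of_nat (by simpa using h.2)]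
    exact (Finsupp.linearCombination_single ℂ _ _).trans (one_smul _ _)
  · rw [ket_eq_zero A a h, map_zero]
    by_cases hi : i = -1
    · simp [hi, V.sr_zero]
    · rw [ket_eq_zero A (a + 1) (by omega), smul_zero]

theorem down_ket (i : ℤ) : down A a (ket A a i) = V.sr (a + 1 - i) • ket A (a + 1) i := by
  by_cases h : 0 ≤ i ∧ i.toNat < a + 1
  · lift i to ℕ using h.1
    rw [ket_of_nat (by simpa using h.2)]
    exact (Finsupp.linearCombination_single ℂ _ _).trans (one_smul _ _)
  · rw [ket_eq_zero A a h, map_zero]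
    by_cases hi : i = a + 1
    · simp [hi, V.sr_zero]
    · rw [ket_eq_zero A (a + 1) (by omega), smul_zero]

theorem isDoublet_aux :
    (∀ x, J0 A (a + 1) (up A a x) = up A a (J0 A a x) + (1 / 2 : ℂ) • up A a x) ∧
    (∀ x, J0 A (a + 1) (down A a x) = down A a (J0 A a x) - (1 / 2 : ℂ) • down A a x) ∧
    (∀ x, Jp A (a + 1) (up A a x) = up A a (Jp A a x)) ∧
    (∀ x, Jp A (a + 1) (down A a x) = down A a (Jp A a x) + up A a x) ∧
    (∀ x, Jm A (a + 1) (up A a x) = up A a (Jm A a x) + down A a x) ∧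
    (∀ x, Jm A (a + 1) (down A a x) = down A a (Jm A a x)) := by
  refine ⟨fun x => ?_, fun x => ?_, fun x => ?_, fun x => ?_, fun x => ?_, fun x => ?_⟩
  · refine LinearMap.congr_fun (f := J0 A (a + 1) ∘ₗ up A a)
      (g := up A a ∘ₗ J0 A a + (1 / 2 : ℂ) • up A a) (hom_ext fun i _ _ => ?_) x
    simp only [LinearMap.comp_apply, LinearMap.add_apply, LinearMap.smul_apply, up_ket, map_smul,
      J0_ket]
    match_scalars
    push_cast
    ring
  · refine LinearMap.congr_fun (f := J0 A (a + 1) ∘ₗ down A a)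
      (g := down A a ∘ₗ J0 A a - (1 / 2 : ℂ) • down A a) (hom_ext fun i _ _ => ?_) x
    simp only [LinearMap.comp_apply, LinearMap.sub_apply, LinearMap.smul_apply, down_ket, map_smul,
      J0_ket]
    match_scalars
    push_cast
    ring
  · refine LinearMap.congr_fun (f := Jp A (a + 1) ∘ₗ up A a) (g := up A a ∘ₗ Jp A a)
      (hom_ext fun i _ _ => ?_) x
    simp only [LinearMap.comp_apply, up_ket, map_smul, Jp_ket]
    rw [show ((a + 1 : ℕ) : ℤ) - (i + 1) = a - i by push_cast; ring]
    match_scalars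
    ring
  · refine LinearMap.congr_fun (f := Jp A (a + 1) ∘ₗ down A a) (g := down A a ∘ₗ Jp A a + up A a)
      (hom_ext fun i _ _ => ?_) x
    simp only [LinearMap.comp_apply, LinearMap.add_apply, down_ket, up_ket, map_smul, Jp_ket]
    have h1 := V.sr_sq (x := a - i) (by omega)
    have h2 := V.sr_sq (x := a + 1 - i) (by omega)
    rw [show ((a + 1 : ℕ) : ℤ) - i = a + 1 - i by push_cast; ring,
      show (a : ℤ) + 1 - (i + 1) = a - i by ring]
    match_scalars
    push_cast at h1 h2
    linear_combination V.sr (i + 1) * (h2 - h1)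
  · refine LinearMap.congr_fun (f := Jm A (a + 1) ∘ₗ up A a) (g := up A a ∘ₗ Jm A a + down A a)
      (hom_ext fun i _ _ => ?_) x
    simp only [LinearMap.comp_apply, LinearMap.add_apply, down_ket, up_ket, map_smul, Jm_ket]
    have h1 := V.sr_sq (x := i) (by omega)
    have h2 := V.sr_sq (x := i + 1) (by omega)
    rw [show ((a + 1 : ℕ) : ℤ) - (i + 1) + 1 = a + 1 - i by push_cast; ring,
      show (a : ℤ) - i + 1 = a + 1 - i by ring, show i + 1 - 1 = i by ring,
      show i - 1 + 1 = i by ring]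
    match_scalars
    push_cast at h1 h2
    linear_combination V.sr (a + 1 - i) * (h2 - h1)
  · refine LinearMap.congr_fun (f := Jm A (a + 1) ∘ₗ down A a) (g := down A a ∘ₗ Jm A a)
      (hom_ext fun i _ _ => ?_) x
    simp only [LinearMap.comp_apply, down_ket, map_smul, Jm_ket]
    rw [show ((a + 1 : ℕ) : ℤ) - i + 1 = a + 1 - (i - 1) by push_cast; ring,
      show (a : ℤ) - i + 1 = a + 1 - i by ring]
    match_scalars
    ring

variable {M : Type*} [AddCommGroup M] [Module ℂ M] (T : SpinOps M)

theorem isDoublet : SpinOps.IsDoublet ((spin A a).tensor T) ((spin A (a + 1)).tensor T)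
    ((up A a).rTensor M) ((down A a).rTensor M) := by
  obtain ⟨h1, h2, h3, h4, h5, h6⟩ := isDoublet_aux (A := A) (a := a)
  refine ⟨fun x => ?_, fun x => ?_, fun x => ?_, fun x => ?_, fun x => ?_, fun x => ?_, ?_⟩
  iterate 6
    induction x with
    | zero => simp
    | tmul x y =>
      simp only [SpinOps.tensor_S0, SpinOps.tensor_Sp, SpinOps.tensor_Sm, LinearMap.rTensor_tmul,
        map_add, spin, h1, h2, h3, h4, h5, h6, TensorProduct.add_tmul, TensorProduct.sub_tmul,
        TensorProduct.smul_tmul']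
      try abel
    | add x y hx hy => simp only [map_add, hx, hy, smul_add]; try abel
  rw [← LinearMap.range_eq_top, eq_top_iff, ← TensorProduct.span_tmul_eq_top, Submodule.span_le]
  rintro _ ⟨x, y, rfl⟩
  set R := LinearMap.range (((up A a).rTensor M).coprod ((down A a).rTensor M))
  have key : ∀ i : ℤ, 0 ≤ i → i ≤ a + 1 → ket A (a + 1) i ⊗ₜ[ℂ] y ∈ R := fun i h0 h => by
    rcases h0.eq_or_lt with rfl | h0
    · have h7 : V.sr (a + 1) • ket A (a + 1) 0 ⊗ₜ[ℂ] y ∈ R := by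
        refine ⟨(0, ket A a 0 ⊗ₜ y), ?_⟩
        simp [down_ket, TensorProduct.smul_tmul']
      exact (R.smul_mem_iff (V.sr_ne_zero (by omega))).mp h7
    · have h7 : V.sr i • ket A (a + 1) i ⊗ₜ[ℂ] y ∈ R := by
        refine ⟨(ket A a (i - 1) ⊗ₜ y, 0), ?_⟩
        simp [up_ket, TensorProduct.smul_tmul']
      exact (R.smul_mem_iff (V.sr_ne_zero h0)).mp h7
  have : (⊤ : Submodule ℂ (F A (a + 1))) ≤ R.comap ((TensorProduct.mk ℂ _ M).flip y) := by
    rw [← span_ket, Submodule.span_le]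
    rintro _ ⟨p, rfl⟩
    exact key (p : ℕ) (by omega) (by have := p.isLt; omega)
  exact this (Submodule.mem_top (x := x))

end F
end Lorentz

namespace Lorentz
namespace F

variable {A : ℤˣ} {a : ℕ} {M : Type*} [AddCommGroup M] [Module ℂ M]

variable (A a) in
/-- The coefficient of a vector of `F^A_γ` along `|γ_A,μ⟩`, `μ = -γ + i`. -/
noncomputable def coeff (i : ℤ) : F A a →ₗ[ℂ] ℂ :=
  Finsupp.linearCombination ℂ fun p : Fin (a + 1) => if ((p : ℕ) : ℤ) = i then (1 : ℂ) else 0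

theorem coeff_ket (i i' : ℤ) :
    coeff A a i (ket A a i') = if i' = i ∧ 0 ≤ i ∧ i ≤ a then 1 else 0 := by
  by_cases h : 0 ≤ i' ∧ i'.toNat < a + 1
  · lift i' to ℕ using h.1
    rw [ket_of_nat (by simpa using h.2)]
    refine ((Finsupp.linearCombination_single ℂ _ _).trans (one_smul _ _)).trans ?_
    exact if_congr (by simp only [Int.toNat_natCast] at h ⊢; omega) rfl rfl
  · rw [ket_eq_zero A a h, map_zero, if_neg (by omega)]

variable (A a M) in
/-- The component of a vector of `F^A_γ ⊗ M` along `|γ_A,μ⟩`, `μ = -γ + i`. -/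
noncomputable def component (i : ℤ) : F A a ⊗[ℂ] M →ₗ[ℂ] M :=
  (TensorProduct.lid ℂ M).toLinearMap ∘ₗ (coeff A a i).rTensor M

theorem component_tmul (i : ℤ) (x : F A a) (m : M) :
    component A a M i (x ⊗ₜ m) = coeff A a i x • m := by simp [component]

theorem component_ket (i i' : ℤ) (m : M) : component A a M i (ket A a i' ⊗ₜ m) =
    if i' = i ∧ 0 ≤ i ∧ i ≤ a then m else 0 := by
  rw [component_tmul, coeff_ket]
  split_ifs <;> simp

theorem component_of_not {i : ℤ} (h : ¬(0 ≤ i ∧ i ≤ a)) (x : F A a ⊗[ℂ] M) :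
    component A a M i x = 0 := by
  have : coeff A a i = 0 := hom_ext fun i' _ _ => by
    rw [coeff_ket, if_neg (by tauto)]; rfl
  rw [component, this]; simp

theorem tensor_hom_ext {W : Type*} [AddCommGroup W] [Module ℂ W] {f g : F A a ⊗[ℂ] M →ₗ[ℂ] W}
    (h : ∀ (i : ℤ) (m : M), 0 ≤ i → i ≤ a → f (ket A a i ⊗ₜ m) = g (ket A a i ⊗ₜ m)) : f = g := by
  refine TensorProduct.ext (hom_ext fun i h0 h1 => LinearMap.ext fun m => ?_)
  exact h i m h0 (by omega)

theorem sum_component (x : F A a ⊗[ℂ] M) :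
    ∑ p : Fin (a + 1), ket A a (p : ℕ) ⊗ₜ component A a M (p : ℕ) x = x := by
  have : ∑ p : Fin (a + 1), TensorProduct.mk ℂ (F A a) M (ket A a (p : ℕ)) ∘ₗ
      component A a M (p : ℕ) = LinearMap.id := tensor_hom_ext fun i m h0 h1 => by
    lift i to ℕ using h0
    simp only [LinearMap.sum_apply, LinearMap.comp_apply, component_ket, LinearMap.id_apply]
    rw [Finset.sum_eq_single (⟨i, by omega⟩ : Fin (a + 1))]
    · simp [h1]
    · intro p _ hp
      rw [if_neg, map_zero]
      rintro ⟨h, -⟩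
      exact hp (Fin.ext (by simpa using h.symm))
    · simp
  have h := LinearMap.congr_fun this x
  rwa [LinearMap.sum_apply] at h

theorem ext_component {x y : F A a ⊗[ℂ] M}
    (h : ∀ i : ℤ, 0 ≤ i → i ≤ a → component A a M i x = component A a M i y) : x = y := by
  rw [← sum_component x, ← sum_component y]
  refine Finset.sum_congr rfl fun p _ => ?_
  rw [h _ (by omega) (by omega)]

variable (T : SpinOps M)

variable (A a) in
/-- The Casimir of `F^A_γ ⊗ M`. -/
noncomputable abbrev tensorCas : Module.End ℂ (F A a ⊗[ℂ] M) := ((spin A a).tensor T).cas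

theorem tensorCas_ket (i : ℤ) (m : M) : tensorCas A a T (ket A a i ⊗ₜ m) =
    (4 * (V.sr (a - i) * V.sr (i + 1))) • ket A a (i + 1) ⊗ₜ T.Sm m
    + (4 * (V.sr i * V.sr (a - i + 1))) • ket A a (i - 1) ⊗ₜ T.Sp m
    + ket A a i ⊗ₜ (T.cas m + (8 * ((i : ℂ) - a / 2)) • T.S0 m
      + (4 * ((V.sr (a - i) * V.sr (i + 1)) ^ 2 + ((i : ℂ) - a / 2) ^ 2 + (i - a / 2))) • m) := by
  simp only [SpinOps.cas_apply, SpinOps.tensor_S0, SpinOps.tensor_Sp, SpinOps.tensor_Sm, map_add,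
    spin, J0_ket, Jp_ket, Jm_ket, map_smul, TensorProduct.tmul_add, TensorProduct.tmul_smul,
    ← TensorProduct.smul_tmul']
  rw [show i + 1 - 1 = i by ring, show (a : ℤ) - (i + 1) + 1 = a - i by ring]
  module

theorem tensorCas_of_eq_zero {t : ℂ} (hT : ∀ m, T.cas m = t ^ 2 • m) (x : F A 0 ⊗[ℂ] M) :
    tensorCas A 0 T x = t ^ 2 • x := by
  have : tensorCas A 0 T = t ^ 2 • LinearMap.id := tensor_hom_ext fun i m h0 h1 => by
    obtain rfl : i = 0 := by push_cast at h1; omega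
    rw [tensorCas_ket, hT]
    simp [V.sr_zero]
  rw [this]; rfl

/-- If the Casimir of `M` is `t²`, where `t` is not an integer in `(-2γ, 2γ)`, then that of
`F^A_γ ⊗ M` is diagonalisable, with eigenvalues `(t + 2μ)²`. -/
theorem iSup_eigenspace_tensorCas {t : ℂ} (hT : ∀ m, T.cas m = t ^ 2 • m)
    (ht : ∀ n : ℤ, -(a : ℤ) < n → n < a → t ≠ n) :
    ⨆ i : Fin (a + 1), Module.End.eigenspace (tensorCas A a T) ((t + a - 2 * (i : ℕ)) ^ 2) = ⊤ := by
  induction a with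
  | zero =>
    rw [eq_top_iff]
    intro x _
    refine (le_iSup (fun i : Fin (0 + 1) => Module.End.eigenspace (tensorCas A 0 T)
      ((t + (0 : ℕ) - 2 * (i : ℕ)) ^ 2)) 0) (Module.End.mem_eigenspace_iff.mpr ?_)
    rw [tensorCas_of_eq_zero T hT]
    simp
  | succ a ih =>
    refine SpinOps.IsDoublet.iSup_eigenspace (isDoublet T)
      (s := fun i : Fin (a + 1) => t + a - 2 * (i : ℕ)) (fun i h => ?_)
      (ih fun n h1 h2 => ht n (by push_cast; omega) (by push_cast; omega))
      (fun i => ?_) (fun i => ?_)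
    · refine ht (2 * (i : ℕ) - a) (by omega) (by omega) ?_
      push_cast
      linear_combination h
    · refine le_iSup_of_le (Fin.castSucc i) (le_of_eq ?_)
      congr 1
      simp only [Fin.val_castSucc]; push_cast; ring
    · refine le_iSup_of_le (Fin.succ i) (le_of_eq ?_)
      congr 1
      simp only [Fin.val_succ]; push_cast; ring

/-- The eigenvalues of the transposed Casimir of `F^A_γ ⊗ M`. -/
theorem exists_eigenvalue_tensorCas {t : ℂ} (hT : ∀ m, T.cas m = t ^ 2 • m)
    {f : F A a ⊗[ℂ] M →ₗ[ℂ] ℂ} (hf : f ≠ 0) {c : ℂ}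
    (hc : ∀ x, f (tensorCas A a T x) = c * f x) :
    ∃ i : Fin (a + 1), c = (t + a - 2 * (i : ℕ)) ^ 2 := by
  induction a generalizing c with
  | zero =>
    refine ⟨0, ?_⟩
    obtain ⟨x, hx⟩ : ∃ x, f x ≠ 0 := by
      by_contra! h
      exact hf (LinearMap.ext h)
    have := hc x
    rw [tensorCas_of_eq_zero T hT, map_smul, smul_eq_mul] at this
    simpa using (mul_right_cancel₀ hx this).symm
  | succ a ih =>
    obtain ⟨s, g, hg, hs, rfl⟩ := SpinOps.IsDoublet.exists_eigenvalue (isDoublet T) hf hc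
    obtain ⟨i, hi⟩ := ih hg hs
    rcases sq_eq_sq_iff_eq_or_eq_neg.mp hi with rfl | rfl
    · refine ⟨Fin.castSucc i, ?_⟩
      simp only [Fin.val_castSucc]; push_cast; ring
    · refine ⟨Fin.succ i, ?_⟩
      simp only [Fin.val_succ]; push_cast; ring

theorem component_tensorCas_of_forall {D : ℤ} (hD : 0 ≤ D) {x : F A a ⊗[ℂ] M}
    (hx : ∀ i, D < i → component A a M i x = 0) :
    (∀ i, D + 1 < i → component A a M i (tensorCas A a T x) = 0) ∧
    (D + 1 ≤ a → component A a M (D + 1) (tensorCas A a T x) =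
      (4 * (V.sr (a - D) * V.sr (D + 1))) • T.Sm (component A a M D x)) := by
  have key : ∀ i, D < i → i ≤ a → component A a M i (tensorCas A a T x) =
      (4 * (V.sr (a - (i - 1)) * V.sr i)) • T.Sm (component A a M (i - 1) x) := by
    intro i hi hia
    conv_lhs => rw [← sum_component x]
    conv_rhs => rw [← sum_component x]
    simp only [map_sum, Finset.smul_sum]
    refine Finset.sum_congr rfl fun p _ => ?_
    by_cases hp : D < (p : ℕ)
    · rw [hx _ hp]; simp
    · simp only [tensorCas_ket, map_add, map_smul, component_ket]
      rw [if_neg (by omega : ¬(((p : ℕ) : ℤ) - 1 = i ∧ _)),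
        if_neg (by omega : ¬(((p : ℕ) : ℤ) = i ∧ _))]
      by_cases hpi : ((p : ℕ) : ℤ) = i - 1
      · rw [if_pos ⟨by omega, by omega, hia⟩, if_pos ⟨hpi, by omega, by omega⟩, hpi]
        simp
      · rw [if_neg (by omega), if_neg (by omega)]
        simp
  refine ⟨fun i hi => ?_, fun h => ?_⟩
  · by_cases hia : i ≤ a
    · rw [key i (by omega) hia, hx _ (by omega)]
      simp
    · exact component_of_not (by omega) _
  · rw [key (D + 1) (by omega) h]
    simp

theorem component_tensorCas_pow (m : M) (D : ℕ) :
    (∀ i : ℤ, D < i → component A a M i ((tensorCas A a T ^ D) (ket A a 0 ⊗ₜ m)) = 0) ∧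
    (D ≤ a → ∃ κ : ℂ, κ ≠ 0 ∧
      component A a M D ((tensorCas A a T ^ D) (ket A a 0 ⊗ₜ m)) = κ • (T.Sm ^ D) m) := by
  induction D with
  | zero =>
    refine ⟨fun i hi => ?_, fun _ => ⟨1, one_ne_zero, ?_⟩⟩
    · rw [pow_zero, Module.End.one_apply, component_ket, if_neg]
      push_cast at hi; omega
    · rw [pow_zero, pow_zero, Module.End.one_apply, component_ket, if_pos (by simp)]
      simp
  | succ D ih =>
    obtain ⟨h1, h2⟩ := component_tensorCas_of_forall T (by omega) ih.1
    rw [← Module.End.mul_apply, ← pow_succ'] at h2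
    refine ⟨fun i hi => ?_, fun hD => ?_⟩
    · rw [pow_succ', Module.End.mul_apply]
      exact h1 i (by push_cast at hi; omega)
    · obtain ⟨κ, hκ, e⟩ := ih.2 (by omega)
      refine ⟨4 * (V.sr (a - D) * V.sr (D + 1)) * κ, ?_, ?_⟩
      · have := V.sr_ne_zero (x := (a : ℤ) - D) (by omega)
        have := V.sr_ne_zero (x := (D : ℤ) + 1) (by omega)
        simp_all
      · push_cast at h2 ⊢
        rw [h2 (by omega), e, map_smul, smul_smul, pow_succ' T.Sm, Module.End.mul_apply]

/-- If `S₋` is not nilpotent on `M`, the Casimir of `F^A_γ ⊗ M` has at least `2γ + 1` eigenvalues. -/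
theorem lt_card_of_iSup_eigenspace {m : M} (hm : (T.Sm ^ a) m ≠ 0) {s : Finset ℂ}
    (hs : ⨆ c ∈ s, Module.End.eigenspace (tensorCas A a T) c = ⊤) : a < s.card := by
  by_contra! hle
  set q : Polynomial ℂ := ∏ c ∈ s, (Polynomial.X - Polynomial.C c)
  have hdeg : q.natDegree = s.card := by simp [q]
  have hmon : q.Monic := Polynomial.monic_prod_of_monic _ _ fun c _ => Polynomial.monic_X_sub_C c
  have hq : Polynomial.aeval (tensorCas A a T) q = 0 := by
    suffices ⊤ ≤ LinearMap.ker (Polynomial.aeval (tensorCas A a T) q) from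
      LinearMap.ker_eq_top.mp (top_le_iff.mp this)
    rw [← hs]
    refine iSup₂_le fun c hc x hx => ?_
    rw [LinearMap.mem_ker]
    by_cases hx0 : x = 0
    · simp [hx0]
    · rw [Module.End.aeval_apply_of_hasEigenvector ⟨hx, hx0⟩, Polynomial.eval_prod,
        Finset.prod_eq_zero hc (by simp), zero_smul]
  have h0 := congrArg (component A a M s.card) (LinearMap.congr_fun hq (ket A a 0 ⊗ₜ m))
  rw [Polynomial.aeval_eq_sum_range, hdeg, Finset.sum_range_succ, LinearMap.add_apply, map_add,
    LinearMap.sum_apply, map_sum, Finset.sum_eq_zero, zero_add] at h0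
  · obtain ⟨κ, hκ, e⟩ := (component_tensorCas_pow (A := A) T m s.card).2 hle
    rw [LinearMap.smul_apply, map_smul, e, ← hdeg, hmon.coeff_natDegree, one_smul, hdeg,
      LinearMap.zero_apply, map_zero] at h0
    refine hm ?_
    obtain ⟨r, hr⟩ := Nat.exists_eq_add_of_le' hle
    rw [hr, pow_add, Module.End.mul_apply, (smul_eq_zero.mp h0).resolve_left hκ, map_zero]
  · intro n hn
    rw [LinearMap.smul_apply, map_smul, (component_tensorCas_pow T m n).1 _
      (by have := Finset.mem_range.mp hn; omega), smul_zero]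

/-- If the Casimir of `F^A_γ ⊗ M` is diagonalisable, then its eigenvalues are among the
`(t + 2μ)²`. -/
theorem iSup_eigenspace_of_diagonalisable {t : ℂ} (hT : ∀ m, T.cas m = t ^ 2 • m)
    (hd : ⨆ c, Module.End.eigenspace (tensorCas A a T) c = ⊤) :
    ⨆ i : Fin (a + 1), Module.End.eigenspace (tensorCas A a T) ((t + a - 2 * (i : ℕ)) ^ 2) = ⊤ := by
  rw [eq_top_iff, ← hd]
  refine iSup_le fun c => ?_
  by_cases hc : ∃ i : Fin (a + 1), c = (t + a - 2 * (i : ℕ)) ^ 2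
  · obtain ⟨i, rfl⟩ := hc
    exact le_iSup (fun i : Fin (a + 1) =>
      Module.End.eigenspace (tensorCas A a T) ((t + a - 2 * (i : ℕ)) ^ 2)) i
  · set P := ⨆ (μ) (_ : μ ≠ c), Module.End.eigenspace (tensorCas A a T) μ with hP
    have hr : ∀ x, tensorCas A a T x - c • x ∈ P := by
      intro x
      suffices ⊤ ≤ P.comap (tensorCas A a T - c • (1 : Module.End ℂ (F A a ⊗[ℂ] M))) from
        this (Submodule.mem_top (x := x))
      rw [← hd]
      refine iSup_le fun μ y hy => ?_
      have e : (tensorCas A a T - c • (1 : Module.End ℂ (F A a ⊗[ℂ] M))) y = (μ - c) • y := by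
        rw [LinearMap.sub_apply, Module.End.mem_eigenspace_iff.mp hy, sub_smul]; rfl
      rw [Submodule.mem_comap, e]
      by_cases hμ : μ = c
      · simp [hμ]
      · exact P.smul_mem _ ((le_iSup₂_of_le μ hμ le_rfl : _ ≤ P) hy)
    have hPt : P = ⊤ := by
      by_contra hne
      obtain ⟨f, hf, hfP⟩ := Submodule.exists_le_ker_of_lt_top P (lt_top_iff_ne_top.mpr hne)
      refine hc (exists_eigenvalue_tensorCas T hT hf fun x => ?_)
      have := LinearMap.mem_ker.mp (hfP (hr x))
      rw [map_sub, map_smul, sub_eq_zero] at this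
      exact this
    have := (Module.End.eigenspaces_iSupIndep (tensorCas A a T)) c
    rw [← hP, hPt, disjoint_top] at this
    rw [this]
    exact bot_le

/-- If the Casimir of `F^A_γ ⊗ M` is diagonalisable, then `t` is not an integer in `(-2γ, 2γ)`. -/
theorem ne_intCast_of_diagonalisable {t : ℂ} (hT : ∀ m, T.cas m = t ^ 2 • m) {m : M}
    (hm : (T.Sm ^ a) m ≠ 0) (hd : ⨆ c, Module.End.eigenspace (tensorCas A a T) c = ⊤)
    {n : ℤ} (h1 : -(a : ℤ) < n) (h2 : n < a) : t ≠ n := by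
  classical
  rintro rfl
  have h := iSup_eigenspace_of_diagonalisable T hT hd
  set g : Fin (a + 1) → ℂ := fun i => ((n : ℂ) + a - 2 * (i : ℕ)) ^ 2 with hg
  have hlt := lt_card_of_iSup_eigenspace T hm (s := Finset.univ.image g)
    (by rw [Finset.iSup_finset_image]; simpa using h)
  have hinj : Function.Injective g := by
    have h3 : (Finset.univ.image g).card = (Finset.univ : Finset (Fin (a + 1))).card :=
      le_antisymm Finset.card_image_le (by simpa using hlt)
    exact fun x y => (Finset.card_image_iff.mp h3) (by simp) (by simp)
  have key : ∀ i i' : ℕ, i < a + 1 → i' < a + 1 → (i : ℤ) + i' = n + a → i = i' := by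
    intro i i' hi hi' e
    have e' : (i : ℂ) + i' = n + a := by exact_mod_cast e
    have h4 : g ⟨i, hi⟩ = g ⟨i', hi'⟩ := by
      simp only [hg]
      linear_combination 4 * ((i : ℂ) - i') * e'
    have := hinj h4
    simpa using this
  rcases le_total 0 n with h0 | h0
  · have := key a n.toNat (by omega) (by omega) (by omega)
    omega
  · have := key 0 (n + a).toNat (by omega) (by omega) (by omega)
    omega

/-- All the eigenspaces of the Casimir of `F^A_γ ⊗ M` are nonzero. -/
theorem eigenspace_tensorCas_ne_bot {t : ℂ} (hT : ∀ m, T.cas m = t ^ 2 • m) {m : M}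
    (hm : (T.Sm ^ a) m ≠ 0) (ht : ∀ n : ℤ, -(a : ℤ) < n → n < a → t ≠ n) (i : Fin (a + 1)) :
    Module.End.eigenspace (tensorCas A a T) ((t + a - 2 * (i : ℕ)) ^ 2) ≠ ⊥ := by
  classical
  intro h0
  set g : Fin (a + 1) → ℂ := fun i => (t + a - 2 * (i : ℕ)) ^ 2 with hg
  have hlt := lt_card_of_iSup_eigenspace (A := A) (a := a) T hm
    (s := (Finset.univ.erase i).image g) (by
      rw [eq_top_iff, ← iSup_eigenspace_tensorCas T hT ht]
      refine iSup_le fun i' => ?_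
      by_cases hi : i' = i
      · rw [hi, h0]; exact bot_le
      · exact le_iSup₂_of_le (g i') (Finset.mem_image_of_mem g (by simp [hi])) le_rfl)
  have := hlt.trans_le Finset.card_image_le
  simp at this

end F
end Lorentz

namespace Lorentz

namespace Spin31

theorem sub_rot (x y : Spin31) : (x - y).rot = x.rot - y.rot := rfl
theorem sub_boost (x y : Spin31) : (x - y).boost = x.boost - y.boost := rfl
theorem neg_rot (x : Spin31) : (-x).rot = -x.rot := rfl
theorem neg_boost (x : Spin31) : (-x).boost = -x.boost := rfl

theorem eq_sum (x : Spin31) : x = x.rot 0 • J 0 + x.rot 1 • J 1 + x.rot 2 • J 2 +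
    (x.boost 0 • K 0 + x.boost 1 • K 1 + x.boost 2 • K 2) := by
  ext i <;> fin_cases i <;> simp [J, K]

end Spin31

/-- The operators `J₀, J±, K₀, K±` on a module. -/
noncomputable def LadderOps.ofLie (W : Type*) [AddCommGroup W] [Module ℂ W] [LieRingModule Spin31 W]
    [LieModule ℂ Spin31 W] : LadderOps W where
  J0 := LieModule.toEnd ℂ Spin31 W (Spin31.J 0)
  Jp := LieModule.toEnd ℂ Spin31 W (Spin31.J 1 + Complex.I • Spin31.J 2)
  Jm := LieModule.toEnd ℂ Spin31 W (Spin31.J 1 - Complex.I • Spin31.J 2)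
  K0 := LieModule.toEnd ℂ Spin31 W (Spin31.K 0)
  Kp := LieModule.toEnd ℂ Spin31 W (Spin31.K 1 + Complex.I • Spin31.K 2)
  Km := LieModule.toEnd ℂ Spin31 W (Spin31.K 1 - Complex.I • Spin31.K 2)
  rel := by
    have h : ∀ x y z : Spin31, ⁅x, y⁆ = z → LieModule.toEnd ℂ Spin31 W x *
        LieModule.toEnd ℂ Spin31 W y - LieModule.toEnd ℂ Spin31 W y *
        LieModule.toEnd ℂ Spin31 W x = LieModule.toEnd ℂ Spin31 W z := by
      rintro x y z rfl
      ext w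
      exact (lie_lie x y w).symm
    refine .of_generating (h _ _ _ ?_) ((h _ _ (-_) ?_).trans (map_neg _ _))
      ((h _ _ ((2 : ℂ) • _) ?_).trans (map_smul _ _ _)) (h _ _ _ ?_) ((h _ _ 0 ?_).trans (map_zero _))
      ((h _ _ (-(2 : ℂ) • _) ?_).trans (map_smul _ _ _)) (h _ _ _ ?_)
      ((h _ _ 0 ?_).trans (map_zero _)) ((h _ _ (-_) ?_).trans (map_neg _ _))
    all_goals
      ext i <;> fin_cases i <;>
      simp [Spin31.lie_rot, Spin31.lie_boost, cross_apply, Spin31.J, Spin31.K, Spin31.sub_rot,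
        Spin31.sub_boost, Spin31.neg_rot, Spin31.neg_boost] <;>
      ring_nf

section

variable {W : Type*} [AddCommGroup W] [Module ℂ W] [LieRingModule Spin31 W] [LieModule ℂ Spin31 W]
  {W' : Type*} [AddCommGroup W'] [Module ℂ W'] [LieRingModule Spin31 W'] [LieModule ℂ Spin31 W']

theorem ofLie_Jp (w : W) :
    (LadderOps.ofLie W).Jp w = ⁅Spin31.J 1, w⁆ + Complex.I • ⁅Spin31.J 2, w⁆ := by
  simp [LadderOps.ofLie]

theorem ofLie_Jm (w : W) :
    (LadderOps.ofLie W).Jm w = ⁅Spin31.J 1, w⁆ - Complex.I • ⁅Spin31.J 2, w⁆ := by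
  simp [LadderOps.ofLie]

theorem ofLie_Kp (w : W) :
    (LadderOps.ofLie W).Kp w = ⁅Spin31.K 1, w⁆ + Complex.I • ⁅Spin31.K 2, w⁆ := by
  simp [LadderOps.ofLie]

theorem ofLie_Km (w : W) :
    (LadderOps.ofLie W).Km w = ⁅Spin31.K 1, w⁆ - Complex.I • ⁅Spin31.K 2, w⁆ := by
  simp [LadderOps.ofLie]

theorem LadderOps.Intertwines.map_lie {φ : W →ₗ[ℂ] W'}
    (h : Intertwines (ofLie W) (ofLie W') φ) (x : Spin31) (w : W) : φ ⁅x, w⁆ = ⁅x, φ w⁆ := by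
  have aux : ∀ {a b a' b' : W'}, a + Complex.I • b = a' + Complex.I • b' →
      a - Complex.I • b = a' - Complex.I • b' → a = a' ∧ b = b' := by
    intro a b a' b' h1 h2
    have e1 : (2 : ℂ) • a = (2 : ℂ) • a' := by
      rw [two_smul, two_smul]
      calc a + a = (a + Complex.I • b) + (a - Complex.I • b) := by abel
        _ = _ := by rw [h1, h2]; abel
    have e2 := smul_right_injective _ (two_ne_zero (α := ℂ)) e1
    subst e2
    exact ⟨rfl, smul_right_injective _ Complex.I_ne_zero (add_left_cancel h1)⟩
  obtain ⟨j1, j2⟩ := aux (by simpa [ofLie_Jp] using h.Jp w) (by simpa [ofLie_Jm] using h.Jm w)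
  obtain ⟨k1, k2⟩ := aux (by simpa [ofLie_Kp] using h.Kp w) (by simpa [ofLie_Km] using h.Km w)
  have j0 : φ ⁅Spin31.J 0, w⁆ = ⁅Spin31.J 0, φ w⁆ := h.J0 w
  have k0 : φ ⁅Spin31.K 0, w⁆ = ⁅Spin31.K 0, φ w⁆ := h.K0 w
  rw [x.eq_sum]
  simp only [add_lie, smul_lie, map_add, map_smul, j0, j1, j2, k0, k1, k2]

theorem casimir₁_eq : casimir₁ W = (LadderOps.ofLie W).cas₁ := by
  ext w
  rw [LadderOps.cas₁_apply, ofLie_Jp, ofLie_Jm, ofLie_Kp, ofLie_Km]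
  simp only [casimir₁, Fin.sum_univ_three, LinearMap.add_apply, Module.End.mul_apply,
    LieModule.toEnd_apply_apply, lie_add, lie_sub, lie_smul, smul_add, smul_sub, smul_smul,
    Complex.I_mul_I, LadderOps.ofLie]
  module

theorem casimir₂_eq : casimir₂ W = (LadderOps.ofLie W).cas₂ := by
  ext w
  rw [LadderOps.cas₂_apply]
  simp only [ofLie_Jp, ofLie_Jm, ofLie_Kp, ofLie_Km]
  simp only [casimir₂, Fin.sum_univ_three, LinearMap.add_apply, LinearMap.sub_apply, sq,
    Module.End.mul_apply, LieModule.toEnd_apply_apply, lie_add, lie_sub, lie_smul, smul_add,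
    smul_sub, smul_smul, Complex.I_mul_I, LadderOps.ofLie]
  module

end

theorem ladderMap_generators {W : Type*} [AddCommGroup W] [Module ℂ W]
    (J0 Jp Jm K0 Kp Km : Module.End ℂ W) :
    ladderMap J0 Jp Jm K0 Kp Km (Spin31.J 0) = J0 ∧
    ladderMap J0 Jp Jm K0 Kp Km (Spin31.J 1 + Complex.I • Spin31.J 2) = Jp ∧
    ladderMap J0 Jp Jm K0 Kp Km (Spin31.J 1 - Complex.I • Spin31.J 2) = Jm ∧
    ladderMap J0 Jp Jm K0 Kp Km (Spin31.K 0) = K0 ∧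
    ladderMap J0 Jp Jm K0 Kp Km (Spin31.K 1 + Complex.I • Spin31.K 2) = Kp ∧
    ladderMap J0 Jp Jm K0 Kp Km (Spin31.K 1 - Complex.I • Spin31.K 2) = Km := by
  have h0 : Complex.I * (Complex.I⁻¹ * 2⁻¹) = 2⁻¹ := by
    rw [← mul_assoc, mul_inv_cancel₀ Complex.I_ne_zero, one_mul]
  have I2 : Complex.I ^ 2 = -1 := Complex.I_sq
  refine ⟨?_, ?_, ?_, ?_, ?_, ?_⟩ <;>
    simp [ladderMap, Spin31.J, Spin31.K, Spin31.sub_rot, Spin31.sub_boost, smul_smul, h0] <;>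
    match_scalars <;>
    first | ring1 | linear_combination (-1 / 2 : ℂ) * I2 | linear_combination (1 / 2 : ℂ) * I2

theorem LadderOps.ext {W : Type*} [AddCommGroup W] [Module ℂ W] {D D' : LadderOps W}
    (h : Intertwines D D' LinearMap.id) : D = D' := by
  obtain ⟨h1, h2, h3, h4, h5, h6⟩ := h
  cases D; cases D'
  simp only [LinearMap.id_apply] at *
  obtain rfl := LinearMap.ext h1
  obtain rfl := LinearMap.ext h2
  obtain rfl := LinearMap.ext h3
  obtain rfl := LinearMap.ext h4
  obtain rfl := LinearMap.ext h5
  obtain rfl := LinearMap.ext h6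
  rfl

theorem V.ofLie_eq (k : ℤ) (ρ : ℂ) : LadderOps.ofLie (V k ρ) = V.ladder k ρ := by
  obtain ⟨h1, h2, h3, h4, h5, h6⟩ := ladderMap_generators (V.J0 k ρ) (V.Jp k ρ) (V.Jm k ρ)
    (V.K0 k ρ) (V.Kp k ρ) (V.Km k ρ)
  exact LadderOps.ext ⟨LinearMap.congr_fun h1, LinearMap.congr_fun h2, LinearMap.congr_fun h3,
    LinearMap.congr_fun h4, LinearMap.congr_fun h5, LinearMap.congr_fun h6⟩

section

variable {N M : Type*} [AddCommGroup N] [Module ℂ N] [AddCommGroup M] [Module ℂ M] {c : ℂ}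

theorem half_tensor_of_sq (hc : c * c = -1) (j : Module.End ℂ N) (j' k' : Module.End ℂ M) :
    (1 / 2 : ℂ) • (j.rTensor M + j'.lTensor N - c • ((c • j).rTensor M + k'.lTensor N)) =
      j.rTensor M + ((1 / 2 : ℂ) • (j' - c • k')).lTensor N := by
  rw [LinearMap.rTensor_smul, LinearMap.lTensor_smul, LinearMap.lTensor_sub, LinearMap.lTensor_smul,
    smul_add, smul_smul, hc]
  module

theorem half_neg_tensor_of_sq (hc : c * c = -1) (j : Module.End ℂ N) (j' k' : Module.End ℂ M) :
    (1 / 2 : ℂ) • (j.rTensor M + j'.lTensor N - (-c) • ((c • j).rTensor M + k'.lTensor N)) =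
      ((1 / 2 : ℂ) • (j' - (-c) • k')).lTensor N := by
  rw [LinearMap.rTensor_smul, LinearMap.lTensor_smul, LinearMap.lTensor_sub, LinearMap.lTensor_smul,
    smul_add, smul_smul, neg_mul, hc]
  module

end

namespace F

variable (A : ℤˣ) (a : ℕ)

/-- The operators on `F^A_γ`. -/
noncomputable def ladder : LadderOps (F A a) :=
  ⟨J0 A a, Jp A a, Jm A a, K0 A a, Kp A a, Km A a, relations A a⟩

theorem ofLie_eq : LadderOps.ofLie (F A a) = ladder A a := by
  obtain ⟨h1, h2, h3, h4, h5, h6⟩ := ladderMap_generators (J0 A a) (Jp A a) (Jm A a)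
    (K0 A a) (Kp A a) (Km A a)
  exact LadderOps.ext ⟨LinearMap.congr_fun h1, LinearMap.congr_fun h2, LinearMap.congr_fun h3,
    LinearMap.congr_fun h4, LinearMap.congr_fun h5, LinearMap.congr_fun h6⟩

variable (M : Type*) [AddCommGroup M] [Module ℂ M] [LieRingModule Spin31 M] [LieModule ℂ Spin31 M]

theorem ofLie_tensor :
    (LadderOps.ofLie (F A a ⊗[ℂ] M)).J0 = (J0 A a).rTensor M + (LadderOps.ofLie M).J0.lTensor _ ∧
    (LadderOps.ofLie (F A a ⊗[ℂ] M)).Jp = (Jp A a).rTensor M + (LadderOps.ofLie M).Jp.lTensor _ ∧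
    (LadderOps.ofLie (F A a ⊗[ℂ] M)).Jm = (Jm A a).rTensor M + (LadderOps.ofLie M).Jm.lTensor _ ∧
    (LadderOps.ofLie (F A a ⊗[ℂ] M)).K0 = (K0 A a).rTensor M + (LadderOps.ofLie M).K0.lTensor _ ∧
    (LadderOps.ofLie (F A a ⊗[ℂ] M)).Kp = (Kp A a).rTensor M + (LadderOps.ofLie M).Kp.lTensor _ ∧
    (LadderOps.ofLie (F A a ⊗[ℂ] M)).Km = (Km A a).rTensor M + (LadderOps.ofLie M).Km.lTensor _ := by
  have h := ofLie_eq A a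
  have h1 := congrArg LadderOps.J0 h
  have h2 := congrArg LadderOps.Jp h
  have h3 := congrArg LadderOps.Jm h
  have h4 := congrArg LadderOps.K0 h
  have h5 := congrArg LadderOps.Kp h
  have h6 := congrArg LadderOps.Km h
  simp only [ladder] at h1 h2 h3 h4 h5 h6
  rw [← h1, ← h2, ← h3, ← h4, ← h5, ← h6]
  refine ⟨?_, ?_, ?_, ?_, ?_, ?_⟩ <;>
  · refine TensorProduct.ext' fun x m => ?_
    exact TensorProduct.LieModule.lie_tmul_right _ x m

theorem half_ofLie_tensor :
    (LadderOps.ofLie (F A a ⊗[ℂ] M)).half A = (spin A a).tensor ((LadderOps.ofLie M).half A) := by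
  obtain ⟨h1, h2, h3, h4, h5, h6⟩ := ofLie_tensor A a M
  have hA : (Complex.I * ((A : ℤ) : ℂ)) * (Complex.I * ((A : ℤ) : ℂ)) = -1 := by
    linear_combination Complex.I ^ 2 * sign_sq A + Complex.I_sq
  simp only [LadderOps.half, SpinOps.tensor, spin, h1, h2, h3, h4, h5, h6, SpinOps.mk.injEq]
  exact ⟨half_tensor_of_sq hA _ _ _, half_tensor_of_sq hA _ _ _, half_tensor_of_sq hA _ _ _⟩

theorem half_neg_ofLie_tensor :
    ((LadderOps.ofLie (F A a ⊗[ℂ] M)).half (-A)).S0 = ((LadderOps.ofLie M).half (-A)).S0.lTensor _ ∧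
    ((LadderOps.ofLie (F A a ⊗[ℂ] M)).half (-A)).Sp = ((LadderOps.ofLie M).half (-A)).Sp.lTensor _ ∧
    ((LadderOps.ofLie (F A a ⊗[ℂ] M)).half (-A)).Sm = ((LadderOps.ofLie M).half (-A)).Sm.lTensor _ := by
  obtain ⟨h1, h2, h3, h4, h5, h6⟩ := ofLie_tensor A a M
  have hA : (Complex.I * ((A : ℤ) : ℂ)) * (Complex.I * ((A : ℤ) : ℂ)) = -1 := by
    linear_combination Complex.I ^ 2 * sign_sq A + Complex.I_sq
  have hn : Complex.I * (((-A : ℤˣ) : ℤ) : ℂ) = -(Complex.I * ((A : ℤ) : ℂ)) := by simp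
  simp only [LadderOps.half, h1, h2, h3, h4, h5, h6, hn]
  exact ⟨half_neg_tensor_of_sq hA _ _ _, half_neg_tensor_of_sq hA _ _ _,
    half_neg_tensor_of_sq hA _ _ _⟩

theorem half_neg_cas_ofLie_tensor (x : F A a) (m : M) :
    ((LadderOps.ofLie (F A a ⊗[ℂ] M)).half (-A)).cas (x ⊗ₜ m) =
      x ⊗ₜ ((LadderOps.ofLie M).half (-A)).cas m := by
  obtain ⟨h1, h2, h3⟩ := half_neg_ofLie_tensor A a M
  simp only [SpinOps.cas_apply, h1, h2, h3, LinearMap.lTensor_tmul, TensorProduct.tmul_add,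
    TensorProduct.tmul_smul]

end F
end Lorentz

namespace Lorentz

namespace LadderOps

/-- The highest weight vectors of weight `j`. -/
def highest {W : Type*} [AddCommGroup W] [Module ℂ W] (D : LadderOps W) (j : ℂ) : Submodule ℂ W where
  carrier := {x | D.rot.IsHighest j x}
  zero_mem' := ⟨by simp, by simp⟩
  add_mem' hx hy := ⟨by rw [map_add, hx.weight, hy.weight, smul_add],
    by rw [map_add, hx.raise, hy.raise, add_zero]⟩
  smul_mem' c x hx := ⟨by rw [map_smul, hx.weight, smul_comm], by rw [map_smul, hx.raise, smul_zero]⟩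

theorem mem_highest {W : Type*} [AddCommGroup W] [Module ℂ W] {D : LadderOps W} {j : ℂ} {x : W} :
    x ∈ D.highest j ↔ D.rot.IsHighest j x := Iff.rfl

end LadderOps

theorem pow_tensor_eq_zero {N M : Type*} [AddCommGroup N] [Module ℂ N] [AddCommGroup M] [Module ℂ M]
    {f : Module.End ℂ N} {g : Module.End ℂ M} {n m : ℕ} {x : N} {y : M} (hx : (f ^ n) x = 0)
    (hy : (g ^ m) y = 0) : ((f.rTensor M + g.lTensor N) ^ (n + m)) (x ⊗ₜ[ℂ] y) = 0 := by
  induction h : n + m generalizing n m x y with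
  | zero =>
    obtain rfl : n = 0 := by omega
    rw [pow_zero, Module.End.one_apply] at hx
    simp [hx]
  | succ N ih =>
    rcases n with _ | n
    · rw [pow_zero, Module.End.one_apply] at hx
      simp [hx]
    rcases m with _ | m
    · rw [pow_zero, Module.End.one_apply] at hy
      simp [hy]
    rw [pow_succ, Module.End.mul_apply, LinearMap.add_apply, LinearMap.rTensor_tmul,
      LinearMap.lTensor_tmul, map_add, ih (n := n) (m := m + 1) (by rwa [pow_succ] at hx) hy (by omega),
      ih (n := n + 1) (m := m) hx (by rwa [pow_succ] at hy) (by omega), add_zero]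

namespace F

variable {A : ℤˣ} {a : ℕ}

section

variable {M : Type*} [AddCommGroup M] [Module ℂ M] (f : Module.End ℂ M)

theorem component_lTensor (i : ℤ) (x : F A a ⊗[ℂ] M) :
    component A a M i (f.lTensor _ x) = f (component A a M i x) := by
  induction x with
  | zero => simp
  | tmul x m => simp [component_tmul]
  | add x y hx hy => simp only [map_add, hx, hy]

theorem component_J0 (i : ℤ) (x : F A a ⊗[ℂ] M) :
    component A a M i ((J0 A a).rTensor M x) = ((i : ℂ) - a / 2) • component A a M i x := by
  have : component A a M i ∘ₗ (J0 A a).rTensor M = ((i : ℂ) - a / 2) • component A a M i :=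
    tensor_hom_ext fun i' m h0 h1 => by
      simp only [LinearMap.comp_apply, LinearMap.rTensor_tmul, J0_ket, TensorProduct.smul_tmul',
        map_smul, LinearMap.smul_apply, component_ket, ← TensorProduct.smul_tmul']
      split_ifs with h
      · rw [h.1]
      · simp
  exact LinearMap.congr_fun this x

theorem component_Jp {i : ℤ} (h : 0 ≤ i ∧ i ≤ a) (x : F A a ⊗[ℂ] M) :
    component A a M i ((Jp A a).rTensor M x) =
      (V.sr (a - (i - 1)) * V.sr i) • component A a M (i - 1) x := by
  have : component A a M i ∘ₗ (Jp A a).rTensor M =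
      (V.sr (a - (i - 1)) * V.sr i) • component A a M (i - 1) :=
    tensor_hom_ext fun i' m h0 h1 => by
      simp only [LinearMap.comp_apply, LinearMap.rTensor_tmul, Jp_ket, TensorProduct.smul_tmul',
        map_smul, LinearMap.smul_apply, component_ket, ← TensorProduct.smul_tmul']
      by_cases hi : i' = i - 1
      · rw [if_pos (by omega), if_pos (by omega), hi, sub_add_cancel]
      · rw [if_neg (by omega), if_neg (by omega), smul_zero, smul_zero]
  exact LinearMap.congr_fun this x

theorem component_of_raise {x : F A a ⊗[ℂ] M}
    (hx : ((Jp A a).rTensor M + f.lTensor (F A a)) x = 0) {s : ℕ} (hs : s ≤ a) :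
    ∃ c : ℂ, c ≠ 0 ∧ component A a M (a - s) x = c • (f ^ s) (component A a M a x) := by
  induction s with
  | zero => exact ⟨1, one_ne_zero, by simp⟩
  | succ s ih =>
    obtain ⟨c, hc, e⟩ := ih (by omega)
    have h := congrArg (component A a M (a - s)) hx
    rw [LinearMap.add_apply, map_add, component_lTensor, component_Jp (by omega),
      map_zero, e, map_smul] at h
    have h1 : V.sr (a - (a - s - 1)) ≠ 0 := V.sr_ne_zero (by omega)
    have h2 : V.sr (a - s) ≠ 0 := V.sr_ne_zero (by omega)
    refine ⟨-((V.sr (a - (a - s - 1)) * V.sr (a - s))⁻¹ * c), by simp [h1, h2, hc], ?_⟩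
    rw [pow_succ', Module.End.mul_apply, show (a : ℤ) - (s + 1 : ℕ) = a - s - 1 by push_cast; ring,
      eq_neg_of_add_eq_zero_left h |> fun e => (inv_smul_smul₀ (mul_ne_zero h1 h2) _).symm.trans
        (congrArg _ e), smul_neg, smul_smul, neg_smul]

theorem eq_zero_of_component {x : F A a ⊗[ℂ] M}
    (hx : ((Jp A a).rTensor M + f.lTensor (F A a)) x = 0) (h : component A a M a x = 0) : x = 0 := by
  refine ext_component fun i h0 h1 => ?_
  obtain ⟨s, rfl⟩ : ∃ s : ℕ, i = a - s := ⟨(a - i).toNat, by omega⟩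
  obtain ⟨c, -, e⟩ := component_of_raise f hx (s := s) (by omega)
  rw [e, h]; simp

theorem pow_component_eq_zero {x : F A a ⊗[ℂ] M}
    (hx : ((Jp A a).rTensor M + f.lTensor (F A a)) x = 0) :
    (f ^ (a + 1)) (component A a M a x) = 0 := by
  obtain ⟨c, hc, e⟩ := component_of_raise f hx le_rfl
  have h := congrArg (component A a M 0) hx
  rw [sub_self] at e
  rw [LinearMap.add_apply, map_add, component_lTensor, component_Jp (by omega),
    map_zero, e, map_smul, V.sr_zero, mul_zero, zero_smul, zero_add] at h
  rw [pow_succ', Module.End.mul_apply]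
  exact (smul_eq_zero.mp h).resolve_left hc

end

theorem exists_Jp_pow_ket (i : ℤ) (s : ℕ) : ∃ c : ℂ, (Jp A a ^ s) (ket A a i) = c • ket A a (i + s) := by
  induction s with
  | zero => exact ⟨1, by simp⟩
  | succ s ih =>
    obtain ⟨c, e⟩ := ih
    refine ⟨c * (V.sr (a - (i + s)) * V.sr (i + s + 1)), ?_⟩
    rw [pow_succ', Module.End.mul_apply, e, map_smul, Jp_ket, smul_smul]
    push_cast
    rw [add_assoc i]

theorem exists_Jm_pow_ket (i : ℤ) (s : ℕ) : ∃ c : ℂ, (Jm A a ^ s) (ket A a i) = c • ket A a (i - s) := by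
  induction s with
  | zero => exact ⟨1, by simp⟩
  | succ s ih =>
    obtain ⟨c, e⟩ := ih
    refine ⟨c * (V.sr (i - s) * V.sr (a - (i - s) + 1)), ?_⟩
    rw [pow_succ', Module.End.mul_apply, e, map_smul, Jm_ket, smul_smul]
    push_cast
    rw [← sub_sub i]

theorem Jp_pow_eq_zero {i : ℤ} (h0 : 0 ≤ i) : (Jp A a ^ (a + 1)) (ket A a i) = 0 := by
  obtain ⟨c, e⟩ := exists_Jp_pow_ket (A := A) (a := a) i (a + 1)
  rw [e, ket_eq_zero A a (by omega), smul_zero]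

theorem Jm_pow_eq_zero {i : ℤ} (h0 : i ≤ a) : (Jm A a ^ (a + 1)) (ket A a i) = 0 := by
  obtain ⟨c, e⟩ := exists_Jm_pow_ket (A := A) (a := a) i (a + 1)
  rw [e, ket_eq_zero A a (by omega), smul_zero]

theorem span_tmul {M ι : Type*} [AddCommGroup M] [Module ℂ M] {e : ι → M}
    (he : Submodule.span ℂ (Set.range e) = ⊤) :
    Submodule.span ℂ (Set.range fun p : Fin (a + 1) × ι => ket A a (p.1 : ℕ) ⊗ₜ[ℂ] e p.2) = ⊤ := by
  set R := Submodule.span ℂ (Set.range fun p : Fin (a + 1) × ι => ket A a (p.1 : ℕ) ⊗ₜ[ℂ] e p.2)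
  have h1 : ∀ (p : Fin (a + 1)) (m : M), ket A a (p : ℕ) ⊗ₜ[ℂ] m ∈ R := fun p m => by
    suffices ⊤ ≤ R.comap (TensorProduct.mk ℂ _ _ (ket A a (p : ℕ))) from
      this (Submodule.mem_top (x := m))
    rw [← he, Submodule.span_le]
    rintro _ ⟨i, rfl⟩
    exact Submodule.subset_span ⟨(p, i), rfl⟩
  rw [eq_top_iff]
  intro x _
  rw [← sum_component x]
  exact Submodule.sum_mem _ fun p _ => h1 _ _

variable (A a) in
/-- The operators on `F^A_γ ⊗ V_{λ,ρ}`. -/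
noncomputable abbrev tensorLadder (k : ℤ) (ρ : ℂ) : LadderOps (F A a ⊗[ℂ] V k ρ) := .ofLie _

variable {k : ℤ} {ρ : ℂ}

theorem tensorLadder_apply :
    (tensorLadder A a k ρ).J0 = (J0 A a).rTensor _ + (V.J0 k ρ).lTensor _ ∧
    (tensorLadder A a k ρ).Jp = (Jp A a).rTensor _ + (V.Jp k ρ).lTensor _ ∧
    (tensorLadder A a k ρ).Jm = (Jm A a).rTensor _ + (V.Jm k ρ).lTensor _ := by
  obtain ⟨h1, h2, h3, -⟩ := ofLie_tensor A a (V k ρ)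
  rw [V.ofLie_eq] at h1 h2 h3
  exact ⟨h1, h2, h3⟩

theorem isLocallyFinite_tensor : (tensorLadder A a k ρ).IsLocallyFinite := by
  obtain ⟨h1, h2, h3⟩ := tensorLadder_apply (A := A) (a := a) (k := k) (ρ := ρ)
  have hs := span_tmul (A := A) (a := a) (V.span_ket k ρ)
  refine ⟨iSup_eigenspace_eq_top_of_span hs fun p => ?_,
    exists_pow_eq_zero_of_span hs fun p => ?_, exists_pow_eq_zero_of_span hs fun p => ?_⟩
  · refine ⟨(((p.1 : ℕ) : ℤ) - a / 2 : ℂ) + ((p.2.i : ℤ) - (|k| + 2 * (p.2.n : ℤ) : ℤ) / 2 : ℂ), ?_⟩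
    rw [h1, LinearMap.add_apply, LinearMap.rTensor_tmul, LinearMap.lTensor_tmul, J0_ket, V.J0_ket,
      TensorProduct.tmul_smul, ← TensorProduct.smul_tmul', ← add_smul]
  · obtain ⟨N, hN⟩ := V.Jp_nilpotent (V.ket k ρ p.2.n p.2.i)
    exact ⟨_, by rw [h2]; exact pow_tensor_eq_zero (Jp_pow_eq_zero (by omega)) hN⟩
  · obtain ⟨N, hN⟩ := V.Jm_nilpotent (V.ket k ρ p.2.n p.2.i)
    exact ⟨_, by rw [h3]; exact pow_tensor_eq_zero (Jm_pow_eq_zero (by omega)) hN⟩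

/-- The summands of `F^A_γ ⊗ V_{λ,ρ}` in which the spin `q / 2` occurs. -/
def summands (a : ℕ) (k : ℤ) (q : ℕ) : Finset (Fin (a + 1)) :=
  {i | |k + 2 * (i : ℕ) - a| ≤ q ∧ (q + (k + 2 * (i : ℕ) - a)) % 2 = 0}

theorem mem_summands {q : ℕ} {i : Fin (a + 1)} : i ∈ summands a k q ↔
    |k + 2 * (i : ℕ) - a| ≤ q ∧ (q + (k + 2 * (i : ℕ) - a)) % 2 = 0 := by simp [summands]

theorem exists_injective_highest (hl : V.AllLevels k ρ) (q : ℕ) :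
    ∃ θ : (tensorLadder A a k ρ).highest (q / 2) →ₗ[ℂ] (summands a k q → ℂ),
      Function.Injective θ := by
  obtain ⟨e1, e2, -⟩ := tensorLadder_apply (A := A) (a := a) (k := k) (ρ := ρ)
  let N : ℕ → ℤ := fun i => q + a - min (|k| + a) q +
    if 0 ≤ k then k + 2 * (i : ℕ) - a else -(k + 2 * (i : ℕ) - a)
  refine ⟨LinearMap.pi fun i => V.coeff k ρ ((N (i : Fin (a + 1)) - |k|) / 2)
    ((N (i : Fin (a + 1)) + q - a) / 2) ∘ₗ component A a _ a ∘ₗ Submodule.subtype _, ?_⟩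
  rw [← LinearMap.ker_eq_bot, Submodule.eq_bot_iff]
  rintro ⟨x, hx⟩ h0
  have hw : (tensorLadder A a k ρ).J0 x = ((q : ℂ) / 2) • x := hx.weight
  have hr : (tensorLadder A a k ρ).Jp x = 0 := hx.raise
  rw [e1] at hw
  rw [e2] at hr
  refine Subtype.ext (eq_zero_of_component _ hr (V.ext_coeff fun n i h1 h2 h3 => ?_))
  rw [map_zero]
  by_contra hne
  have hw' : V.J0 k ρ (component A a _ a x) = ((q : ℂ) / 2 - a / 2) • component A a _ a x := by
    have := congrArg (component A a _ a) hw
    rw [LinearMap.add_apply, map_add, component_lTensor, component_J0, map_smul] at this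
    rw [sub_smul, ← this]
    push_cast
    module
  obtain ⟨h4, h5⟩ := V.support_of_weight hl hw' (pow_component_eq_zero _ hr) h2 hne
  have h6 : 2 * i - (|k| + 2 * n) = q - a := by
    have : ((2 * i - (|k| + 2 * n) : ℤ) : ℂ) = ((q - a : ℤ) : ℂ) := by
      push_cast at h4 ⊢
      linear_combination 2 * h4
    exact_mod_cast this
  push_cast at h5
  obtain ⟨i', h7, h8, h9, h10⟩ : ∃ i' : ℕ, i' ≤ a ∧ N i' = |k| + 2 * n ∧
      |k + 2 * i' - a| ≤ q ∧ (q + (k + 2 * i' - a)) % 2 = 0 := by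
    rcases le_or_gt 0 k with hk | hk
    · simp only [N, if_pos hk, abs_of_nonneg hk, abs_le] at *
      rcases le_total (k + a) q with hq | hq
      · simp only [min_eq_left hq]
        exact ⟨((k + 2 * n - q - a + (k + a) - k + a) / 2).toNat, by omega, by omega, by omega,
          by omega⟩
      · simp only [min_eq_right hq]
        exact ⟨((k + 2 * n - q - a + q - k + a) / 2).toNat, by omega, by omega, by omega,
          by omega⟩
    · simp only [N, if_neg hk.not_ge, abs_of_neg hk, abs_le] at *
      rcases le_total (-k + a) q with hq | hq
      · simp only [min_eq_left hq]
        exact ⟨((-(-k + 2 * n - q - a + (-k + a)) - k + a) / 2).toNat, by omega, by omega,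
          by omega, by omega⟩
      · simp only [min_eq_right hq]
        exact ⟨((-(-k + 2 * n - q - a + q) - k + a) / 2).toNat, by omega, by omega, by omega,
          by omega⟩
  have h11 := congrFun (LinearMap.mem_ker.mp h0) ⟨⟨i', by omega⟩, mem_summands.mpr ⟨h9, h10⟩⟩
  simp only [LinearMap.pi_apply, LinearMap.comp_apply, h8, Submodule.subtype_apply] at h11
  rw [show (|k| + 2 * n - |k|) / 2 = n by omega, show (|k| + 2 * n + q - a) / 2 = i by omega] at h11
  exact hne h11

theorem finite_highest (hl : V.AllLevels k ρ) (q : ℕ) :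
    Module.Finite ℂ ((tensorLadder A a k ρ).highest (q / 2)) := by
  obtain ⟨θ, hθ⟩ := exists_injective_highest (A := A) (a := a) hl q
  exact Module.Finite.of_injective θ hθ

theorem finrank_highest_le (hl : V.AllLevels k ρ) (q : ℕ) :
    Module.finrank ℂ ((tensorLadder A a k ρ).highest (q / 2)) ≤ (summands a k q).card := by
  obtain ⟨θ, hθ⟩ := exists_injective_highest (A := A) (a := a) hl q
  simpa using LinearMap.finrank_le_finrank_of_injective hθ

end F
end Lorentz

namespace Lorentz

namespace LadderOps

variable {W : Type*} [AddCommGroup W] [Module ℂ W] {D : LadderOps W}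

theorem cas₁_Jp (x : W) : D.cas₁ (D.Jp x) = D.Jp (D.cas₁ x) := by
  have h1 : ∀ y, D.Jm (D.Jp y) = D.Jp (D.Jm y) - (2 : ℂ) • D.J0 y := fun y => by
    rw [D.Jp_Jm]; module
  have h2 : ∀ y, D.Km (D.Jp y) = D.Jp (D.Km y) - (2 : ℂ) • D.K0 y := fun y => by
    rw [D.Jp_Km]; module
  have h3 : ∀ y, D.K0 (D.Jp y) = D.Jp (D.K0 y) + D.Kp y := fun y => by
    rw [D.Jp_K0]; module
  have h4 : ∀ y, D.Kp (D.Jp y) = D.Jp (D.Kp y) := fun y => (D.Jp_Kp y).symm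
  simp only [cas₁_apply, map_add, map_sub, map_smul, h1, h2, h3, h4, D.J0_Jp, D.J0_Kp]
  module

theorem cas₂_Jp (x : W) : D.cas₂ (D.Jp x) = D.Jp (D.cas₂ x) := by
  have h1 : ∀ y, D.Jm (D.Jp y) = D.Jp (D.Jm y) - (2 : ℂ) • D.J0 y := fun y => by
    rw [D.Jp_Jm]; module
  have h2 : ∀ y, D.Km (D.Jp y) = D.Jp (D.Km y) - (2 : ℂ) • D.K0 y := fun y => by
    rw [D.Jp_Km]; module
  have h3 : ∀ y, D.K0 (D.Jp y) = D.Jp (D.K0 y) + D.Kp y := fun y => by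
    rw [D.Jp_K0]; module
  have h4 : ∀ y, D.Kp (D.Jp y) = D.Jp (D.Kp y) := fun y => (D.Jp_Kp y).symm
  simp only [cas₂_apply, map_add, map_sub, map_smul, h1, h2, h3, h4, D.J0_Jp, D.J0_Kp]
  rw [D.K0_Kp]
  module

theorem half_cas_intertwines (A : ℤˣ) : Intertwines D D (D.half A).cas := by
  rw [D.half_cas]
  refine .of_generating (fun x => ?_) (fun x => ?_) (fun x => ?_) <;>
  simp only [LinearMap.add_apply, LinearMap.sub_apply, LinearMap.smul_apply, Module.End.one_apply,
    cas₁_Jp, cas₂_Jp, cas₁_Jm, cas₂_Jm, cas₁_Kp, cas₂_Kp, map_add, map_sub, map_smul]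

theorem Intertwines.isStable_eigenspace {f : Module.End ℂ W} (h : Intertwines D D f) (c : ℂ) :
    D.IsStable (Module.End.eigenspace f c) := by
  constructor <;> intro x hx <;> rw [Module.End.mem_eigenspace_iff] at hx ⊢
  · rw [h.J0, hx, map_smul]
  · rw [h.Jp, hx, map_smul]
  · rw [h.Jm, hx, map_smul]
  · rw [h.K0, hx, map_smul]
  · rw [h.Kp, hx, map_smul]
  · rw [h.Km, hx, map_smul]

theorem cas_of_half_cas {A : ℤˣ} {s u : ℂ} {x : W} (hs : (D.half A).cas x = s ^ 2 • x)
    (hu : (D.half (-A)).cas x = u ^ 2 • x) :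
    D.cas₁ x = (Complex.I * ((A : ℤ) : ℂ) * (s ^ 2 - u ^ 2) / 4) • x ∧
      D.cas₂ x = ((s ^ 2 + u ^ 2) / 2 - 1) • x := by
  rw [half_cas] at hs hu
  have hn : (((-A : ℤˣ) : ℤ) : ℂ) = -((A : ℤ) : ℂ) := by simp
  simp only [LinearMap.add_apply, LinearMap.sub_apply, LinearMap.smul_apply, Module.End.one_apply,
    hn] at hs hu
  have I2 : Complex.I ^ 2 = -1 := Complex.I_sq
  have hA := sign_sq A
  constructor
  · have h : (-(4 * Complex.I * ((A : ℤ) : ℂ))) • D.cas₁ x = (s ^ 2 - u ^ 2) • x := by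
      rw [sub_smul, ← hs, ← hu]; module
    have := congrArg (fun y => (Complex.I * ((A : ℤ) : ℂ) / 4) • y) h
    simp only [smul_smul] at this
    rw [show Complex.I * ((A : ℤ) : ℂ) / 4 * -(4 * Complex.I * ((A : ℤ) : ℂ)) = 1 by
      linear_combination (-((A : ℤ) : ℂ) ^ 2) * I2 + hA, one_smul] at this
    rw [this]; congr 1; ring
  · have h : (2 : ℂ) • D.cas₂ x = (s ^ 2 + u ^ 2 - 2) • x := by
      rw [sub_smul, add_smul, ← hs, ← hu]; module
    have := congrArg (fun y => (1 / 2 : ℂ) • y) h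
    simp only [smul_smul] at this
    rw [show (1 / 2 : ℂ) * 2 = 1 by norm_num, one_smul] at this
    rw [this]; congr 1; ring

end LadderOps

theorem V.half_Sm_pow_ne_zero {k : ℤ} {ρ : ℂ} (hl : V.AllLevels k ρ) (A : ℤˣ) (N : ℕ) :
    (((V.ladder k ρ).half A).Sm ^ N) (V.ket k ρ 0 0) ≠ 0 := by
  have hc : -(Complex.I * ((A : ℤ) : ℂ)) ≠ 0 := by simp [Complex.I_ne_zero]
  have e : ((V.ladder k ρ).half A).Sm =
      (1 / 2 : ℂ) • (V.Jm k ρ + (-(Complex.I * ((A : ℤ) : ℂ))) • V.Km k ρ) := by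
    rw [neg_smul, ← sub_eq_add_neg]; rfl
  obtain ⟨d, hd, h⟩ := V.Jm_add_Km_pow_ne_zero hl hc N
  rw [e, smul_pow, LinearMap.smul_apply, h, smul_smul]
  refine smul_ne_zero (mul_ne_zero (by simp) hd) fun h0 => ?_
  have := V.coeff_ket hl N 0 N 0
  rw [h0, map_zero, if_pos ⟨rfl, rfl, by omega, le_rfl, by have := abs_nonneg k; omega⟩] at this
  exact zero_ne_one this

theorem V.half_Sp_injective {k : ℤ} {ρ : ℂ} (hl : V.AllLevels k ρ) (A : ℤˣ) {x : V k ρ}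
    (hx : ((V.ladder k ρ).half A).Sp x = 0) : x = 0 := by
  have hc : -(Complex.I * ((A : ℤ) : ℂ)) ≠ 0 := by simp [Complex.I_ne_zero]
  refine V.eq_zero_of_Jp_add_Kp hl hc ?_
  have e : ((V.ladder k ρ).half A).Sp =
      (1 / 2 : ℂ) • (V.Jp k ρ + (-(Complex.I * ((A : ℤ) : ℂ))) • V.Kp k ρ) := by
    rw [neg_smul, ← sub_eq_add_neg]; rfl
  rw [e, LinearMap.smul_apply] at hx
  exact (smul_eq_zero.mp hx).resolve_left (by norm_num)

namespace F

variable {A : ℤˣ} {a : ℕ} {k : ℤ} {ρ : ℂ}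

theorem half_tensorLadder :
    ((tensorLadder A a k ρ).half A).cas = tensorCas A a ((V.ladder k ρ).half A) := by
  rw [half_ofLie_tensor, V.ofLie_eq]

theorem half_neg_tensorLadder (hl : V.AllLevels k ρ) (x : F A a ⊗[ℂ] V k ρ) :
    ((tensorLadder A a k ρ).half (-A)).cas x = (ρ - ((A : ℤ) : ℂ) * k / 2) ^ 2 • x := by
  induction x with
  | zero => simp
  | tmul x m =>
    rw [half_neg_cas_ofLie_tensor, V.ofLie_eq, V.half_cas_eq hl, TensorProduct.tmul_smul]
    congr 2
    simp only [Units.val_neg, Int.cast_neg]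
    ring
  | add x y hx hy => rw [map_add, hx, hy, smul_add]

variable (A a k ρ) in
/-- The summand of `F^A_γ ⊗ V_{λ,ρ}` isomorphic to `V_{λ+μ, ρ+Aμ}`, `μ = -γ + i`, as an eigenspace. -/
noncomputable def sector (i : ℕ) : Submodule ℂ (F A a ⊗[ℂ] V k ρ) :=
  Module.End.eigenspace ((tensorLadder A a k ρ).half A).cas
    ((ρ + ((A : ℤ) : ℂ) * k / 2 + ((A : ℤ) : ℂ) * (2 * i - a)) ^ 2)

theorem sector_eq (i : Fin (a + 1)) : sector A a k ρ i =
    Module.End.eigenspace (tensorCas A a ((V.ladder k ρ).half A))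
      ((ρ + ((A : ℤ) : ℂ) * k / 2 + a -
        2 * ((if A = 1 then Fin.rev i else i : Fin (a + 1)) : ℕ)) ^ 2) := by
  rw [sector, half_tensorLadder]
  congr 2
  rcases Int.units_eq_one_or A with rfl | rfl
  · have h : ((Fin.rev i : Fin (a + 1)) : ℕ) + (i : ℕ) = a := by rw [Fin.val_rev]; omega
    have h' : (((Fin.rev i : Fin (a + 1)) : ℕ) : ℂ) + (i : ℕ) = a := by exact_mod_cast h
    rw [if_pos rfl]
    push_cast
    linear_combination (2 : ℂ) * h'
  · rw [if_neg (by decide)]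
    push_cast
    ring

theorem isStable_sector (i : ℕ) : (tensorLadder A a k ρ).IsStable (sector A a k ρ i) :=
  (LadderOps.half_cas_intertwines A).isStable_eigenspace _

theorem iSup_sector (hl : V.AllLevels k ρ)
    (ht : ∀ n : ℤ, -(a : ℤ) < n → n < a → ρ + ((A : ℤ) : ℂ) * k / 2 ≠ n) :
    ⨆ i : Fin (a + 1), sector A a k ρ i = ⊤ := by
  rw [eq_top_iff, ← iSup_eigenspace_tensorCas ((V.ladder k ρ).half A) (V.half_cas_eq hl A) ht]
  refine iSup_le fun i => ?_
  refine le_iSup_of_le (if A = 1 then Fin.rev i else i) (le_of_eq ?_)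
  rw [sector_eq]
  congr 2
  split_ifs <;> simp

theorem sector_ne_bot (hl : V.AllLevels k ρ)
    (ht : ∀ n : ℤ, -(a : ℤ) < n → n < a → ρ + ((A : ℤ) : ℂ) * k / 2 ≠ n) (i : Fin (a + 1)) :
    sector A a k ρ i ≠ ⊥ := by
  rw [sector_eq]
  exact eigenspace_tensorCas_ne_bot _ (V.half_cas_eq hl A) (V.half_Sm_pow_ne_zero hl A a) ht _

theorem iSupIndep_sector (ht : ∀ n : ℤ, -(a : ℤ) < n → n < a → ρ + ((A : ℤ) : ℂ) * k / 2 ≠ n) :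
    iSupIndep fun i : Fin (a + 1) => sector A a k ρ i := by
  refine (Module.End.eigenspaces_iSupIndep ((tensorLadder A a k ρ).half A).cas).comp
    (f := fun i : Fin (a + 1) =>
      (ρ + ((A : ℤ) : ℂ) * k / 2 + ((A : ℤ) : ℂ) * (2 * (i : ℕ) - a)) ^ 2) ?_
  intro i j hij
  have hA : ((A : ℤ) : ℂ) ≠ 0 := by simp
  rcases sq_eq_sq_iff_eq_or_eq_neg.mp hij with h | h
  · have h' : ((i : ℕ) : ℂ) = ((j : ℕ) : ℂ) := by
      have := mul_left_cancel₀ hA (add_left_cancel h)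
      linear_combination this / 2
    exact Fin.ext (by exact_mod_cast h')
  · by_contra hne
    have hne' : (i : ℕ) ≠ j := fun h => hne (Fin.ext h)
    have h' : ρ + ((A : ℤ) : ℂ) * k / 2 = (((A : ℤ) * (a - i - j) : ℤ) : ℂ) := by
      push_cast
      linear_combination h / 2
    rcases Int.units_eq_one_or A with rfl | rfl <;>
    exact ht _ (by push_cast; omega) (by push_cast; omega) h'

theorem cas_sector (hl : V.AllLevels k ρ) {i : ℕ} {x : F A a ⊗[ℂ] V k ρ}
    (hx : x ∈ sector A a k ρ i) :
    (tensorLadder A a k ρ).cas₁ x = (Complex.I * (((k + 2 * i - a : ℤ) : ℂ) / 2) *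
      (ρ + ((A : ℤ) : ℂ) * (i - a / 2))) • x ∧
    (tensorLadder A a k ρ).cas₂ x = ((((k + 2 * i - a : ℤ) : ℂ) / 2) ^ 2 +
      (ρ + ((A : ℤ) : ℂ) * (i - a / 2)) ^ 2 - 1) • x := by
  have hA := sign_sq A
  obtain ⟨h1, h2⟩ := LadderOps.cas_of_half_cas (Module.End.mem_eigenspace_iff.mp hx)
    (half_neg_tensorLadder hl x)
  rw [h1, h2]
  constructor <;> congr 1 <;> push_cast
  · linear_combination (Complex.I * ((2 * i - a) + k) * ((A : ℤ) : ℂ) / 4 * (2 * i - a) +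
      Complex.I * ρ * (2 * i - a + k) / 2) * hA
  · linear_combination (k ^ 2 / 4 + (2 * i - a) ^ 2 / 4 + k * (2 * i - a) / 2 : ℂ) * hA

/-- `Λ, P` of each summand are such that `V_{Λ,P}` is infinite-dimensional. -/
theorem allLevels_summand (hl : V.AllLevels k ρ)
    (ht : ∀ n : ℤ, -(a : ℤ) < n → n < a → ρ + ((A : ℤ) : ℂ) * k / 2 ≠ n) {i : ℕ} (hi : i ≤ a) :
    V.AllLevels (k + 2 * i - a) (ρ + ((A : ℤ) : ℂ) * (i - a / 2)) := by
  rw [V.allLevels_iff] at hl ⊢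
  intro n h
  obtain ⟨M, hM, hM'⟩ : ∃ M : ℤ, 2 * (ρ + ((A : ℤ) : ℂ) * (i - a / 2)) = M ∧
      |M| = |k + 2 * i - a| + 2 * (n + 1) := by
    have h0 : 0 ≤ |k + 2 * i - a| + 2 * ((n : ℤ) + 1) := by positivity
    rcases sq_eq_sq_iff_eq_or_eq_neg.mp h with h | h
    · exact ⟨_, h, abs_of_nonneg h0⟩
    · exact ⟨-(|k + 2 * i - a| + 2 * (n + 1)), by rw [h]; push_cast; ring, by rw [abs_neg, abs_of_nonneg h0]⟩
  have hR : 2 * ρ = ((M - A * (2 * i - a) : ℤ) : ℂ) := by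
    push_cast
    linear_combination hM
  have hT : ∀ m : ℤ, 2 * m = M - A * (2 * i - a) + A * k → m ≤ -(a : ℤ) ∨ a ≤ m := by
    intro m hm
    by_contra! hlt
    refine ht m hlt.1 hlt.2 ?_
    have : (2 * m : ℂ) = ((M - A * (2 * i - a) + A * k : ℤ) : ℂ) := by rw [← hm]; push_cast; ring
    push_cast at this hR
    linear_combination hR / 2 - this / 2
  have hR' : ∀ n' : ℕ, (M - A * (2 * i - a)) ^ 2 ≠ (|k| + 2 * (n' + 1)) ^ 2 := fun n' h' => by
    refine hl n' ?_
    rw [hR]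
    exact_mod_cast h'
  have hR2 : ∀ n' : ℕ, |M - A * (2 * i - a)| ≠ |k| + 2 * (n' + 1) := fun n' h' => by
    refine hR' n' ?_
    rw [← sq_abs, h']
  rcases Int.units_eq_one_or A with rfl | rfl <;>
  simp only [Units.val_one, Units.val_neg, one_mul, neg_mul, sub_neg_eq_add] at hT hR2
  · have h1 := hT ((M - (2 * i - a) + k) / 2)
    have h2 := hR2 (((|M - (2 * i - a)| - |k|) / 2) - 1).toNat
    rcases abs_cases M with h3 | h3 <;> rcases abs_cases (k + 2 * i - a) with h4 | h4 <;>
    rcases abs_cases k with h5 | h5 <;> rcases abs_cases (M - (2 * i - a)) with h6 | h6 <;>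
    omega
  · have h1 := hT ((M + (2 * i - a) - k) / 2)
    have h2 := hR2 (((|M + (2 * i - a)| - |k|) / 2) - 1).toNat
    rcases abs_cases M with h3 | h3 <;> rcases abs_cases (k + 2 * i - a) with h4 | h4 <;>
    rcases abs_cases k with h5 | h5 <;> rcases abs_cases (M + (2 * i - a)) with h6 | h6 <;>
    omega

end F
end Lorentz

namespace Lorentz

namespace LadderOps

variable {W : Type*} [AddCommGroup W] [Module ℂ W] {D : LadderOps W}

theorem IsLocallyFinite.exists_isBottom [Nontrivial W] (hD : D.IsLocallyFinite) {a b : ℂ}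
    (h1 : ∀ x, D.cas₁ x = a • x) (h2 : ∀ x, D.cas₂ x = b • x) :
    ∃ (q : ℕ) (w : W), w ≠ 0 ∧ D.IsBottom a (q / 2) w ∧
      ((q : ℂ) / 2) ^ 4 - (b + 1) * ((q : ℂ) / 2) ^ 2 - a ^ 2 = 0 := by
  classical
  have hex := hD.exists_highest
  obtain ⟨w, hw0, hw⟩ := Nat.find_spec hex
  set q := Nat.find hex with hq
  have hmin : ∀ x, D.rot.IsHighest ((q : ℂ) / 2 - 1) x → x = 0 := by
    intro x hx
    by_contra hx0
    obtain ⟨n, hn⟩ := hx.exists_nat hx0 (hD.lower x)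
    have hn' : (q : ℤ) - 2 = n := by
      have : ((q - 2 : ℤ) : ℂ) = ((n : ℤ) : ℂ) := by
        push_cast
        linear_combination hn
      exact_mod_cast this
    refine Nat.find_min hex (m := n) (by omega) ⟨x, hx0, ?_⟩
    rwa [show (n : ℂ) / 2 = q / 2 - 1 by linear_combination -hn / 2]
  obtain ⟨hb, h0⟩ := isBottom_of_forall h1 hD.lower hw hmin
  refine ⟨q, w, hw0, hb, hb.polynomial_eq_zero ?_ ?_ ?_ ?_ h1 h2 hw0 fun hj => h0 ?_ hw0⟩
  · rw [show (q : ℂ) / 2 + 1 = ((q + 2 : ℕ) : ℂ) / 2 by push_cast; ring]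
    exact div_ne_zero (Nat.cast_ne_zero.mpr (by omega)) two_ne_zero
  · rw [show 2 * ((q : ℂ) / 2) + 3 = ((q + 3 : ℕ) : ℂ) by push_cast; ring]
    exact Nat.cast_ne_zero.mpr (by omega)
  · rw [show 2 * ((q : ℂ) / 2) + 1 = ((q + 1 : ℕ) : ℂ) by push_cast; ring]
    exact Nat.cast_ne_zero.mpr (by omega)
  · rw [show (q : ℂ) / 2 + 2 = ((q + 4 : ℕ) : ℂ) / 2 by push_cast; ring]
    exact div_ne_zero (Nat.cast_ne_zero.mpr (by omega)) two_ne_zero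
  · simpa using hj

theorem coe_cas_restrict {P : Submodule ℂ W} (h : D.IsStable P) (x : P) :
    ((D.restrict h).cas₁ x : W) = D.cas₁ x ∧ ((D.restrict h).cas₂ x : W) = D.cas₂ x := by
  rw [cas₁_apply, cas₂_apply, cas₁_apply, cas₂_apply]
  exact ⟨rfl, rfl⟩

end LadderOps

theorem finrank_eq_ite_of_iSupIndep {W ι : Type*} [AddCommGroup W] [Module ℂ W] [Fintype ι]
    [DecidableEq ι] {H : Submodule ℂ W} [Module.Finite ℂ H] {p : ι → Submodule ℂ W}
    (hp : iSupIndep p) (hle : ∀ i, p i ≤ H) {s : Finset ι} (hs : Module.finrank ℂ H ≤ s.card)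
    (hne : ∀ i ∈ s, p i ≠ ⊥) (i : ι) : Module.finrank ℂ (p i) = if i ∈ s then 1 else 0 := by
  have hfin : ∀ i, Module.Finite ℂ (p i) := fun i =>
    Module.Finite.of_injective _ (Submodule.inclusion_injective (hle i))
  have hsum : ∑ i, Module.finrank ℂ (p i) ≤ ∑ i, if i ∈ s then 1 else 0 := by
    rw [← Module.finrank_directSum]
    refine le_trans ?_ (hs.trans (by simp))
    refine LinearMap.finrank_le_finrank_of_injective
      (f := (DirectSum.coeLinearMap p).codRestrict H fun x => ?_) ?_
    · induction x using DirectSum.induction_on with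
      | zero => simp
      | of i x => simpa using hle i x.2
      | add x y hx hy => rw [map_add]; exact H.add_mem hx hy
    · intro x y hxy
      exact hp.dfinsupp_lsum_injective (congrArg Subtype.val hxy)
  have hge : ∀ i ∈ Finset.univ, (if i ∈ s then 1 else 0) ≤ Module.finrank ℂ (p i) := fun i _ => by
    split_ifs with h
    · exact Submodule.one_le_finrank_iff.mpr (hne i h)
    · exact Nat.zero_le _
  exact ((Finset.sum_eq_sum_iff_of_le hge).mp (le_antisymm (Finset.sum_le_sum hge) hsum) i
    (Finset.mem_univ i)).symm

namespace F

variable {A : ℤˣ} {a : ℕ} {k : ℤ} {ρ : ℂ}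

theorem eq_zero_of_Kp (hl : V.AllLevels k ρ) {x : F A a ⊗[ℂ] V k ρ}
    (h1 : (tensorLadder A a k ρ).Jp x = 0) (h2 : (tensorLadder A a k ρ).Kp x = 0) : x = 0 := by
  have h3 : ((tensorLadder A a k ρ).half (-A)).Sp x = 0 := by
    simp [LadderOps.half, h1, h2]
  rw [(half_neg_ofLie_tensor A a (V k ρ)).2.1, V.ofLie_eq] at h3
  refine ext_component fun i _ _ => ?_
  rw [map_zero]
  refine V.half_Sp_injective hl (-A) ?_
  rw [← component_lTensor, h3, map_zero]

theorem Kp_pow_ne_zero (hl : V.AllLevels k ρ) {j : ℂ} {x : F A a ⊗[ℂ] V k ρ} (hx0 : x ≠ 0)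
    (hx : (tensorLadder A a k ρ).rot.IsHighest j x) (n : ℕ) :
    ((tensorLadder A a k ρ).Kp ^ n) x ≠ 0 := by
  induction n with
  | zero => simpa
  | succ n ih =>
    rw [pow_succ', Module.End.mul_apply]
    exact fun h => ih (eq_zero_of_Kp hl (LadderOps.Kp_pow_highest hx n).raise h)

theorem exists_mem_summands (hl : V.AllLevels k ρ) {q : ℕ} {x : F A a ⊗[ℂ] V k ρ} (hx0 : x ≠ 0)
    (hx : (tensorLadder A a k ρ).rot.IsHighest (q / 2) x) : ∃ i, i ∈ summands a k q := by
  have := finite_highest (A := A) (a := a) hl q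
  have h1 : 1 ≤ Module.finrank ℂ ((tensorLadder A a k ρ).highest (q / 2)) :=
    Submodule.one_le_finrank_iff.mpr fun h => hx0 (by
      have hx' : x ∈ (tensorLadder A a k ρ).highest (q / 2) := hx
      rw [h] at hx'
      exact hx')
  exact Finset.card_pos.mp (h1.trans (finrank_highest_le hl q))

/-- The lowest spin in a sector is at most that of the corresponding `V_{Λ,P}`. -/
theorem exists_isBottom_sector (hl : V.AllLevels k ρ)
    (ht : ∀ n : ℤ, -(a : ℤ) < n → n < a → ρ + ((A : ℤ) : ℂ) * k / 2 ≠ n) (i : Fin (a + 1)) :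
    ∃ (q : ℕ) (w : sector A a k ρ i), (w : F A a ⊗[ℂ] V k ρ) ≠ 0 ∧
      ((tensorLadder A a k ρ).restrict (isStable_sector i)).IsBottom
        (Complex.I * (((k + 2 * (i : ℕ) - a : ℤ) : ℂ) / 2) *
          (ρ + ((A : ℤ) : ℂ) * ((i : ℕ) - a / 2))) (q / 2) w ∧
      q ≤ |k + 2 * (i : ℕ) - a| ∧ (q + (k + 2 * (i : ℕ) - a)) % 2 = 0 := by
  have := Submodule.nontrivial_iff_ne_bot.mpr (sector_ne_bot hl ht i)
  obtain ⟨q, w, hw0, hw, hq⟩ := ((isLocallyFinite_tensor (A := A) (a := a) (k := k)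
    (ρ := ρ)).restrict (isStable_sector (i : ℕ))).exists_isBottom
    (fun x => Subtype.ext (((LadderOps.coe_cas_restrict _ x).1).trans (cas_sector hl x.2).1))
    (fun x => Subtype.ext (((LadderOps.coe_cas_restrict _ x).2).trans (cas_sector hl x.2).2))
  have hw0' : (w : F A a ⊗[ℂ] V k ρ) ≠ 0 := fun h => hw0 (Subtype.ext h)
  obtain ⟨i', hi'⟩ := exists_mem_summands hl hw0'
    ((LadderOps.isHighest_restrict _).mp hw.highest)
  obtain ⟨-, hpar⟩ := mem_summands.mp hi'
  have hpar' : ((q : ℤ) + (k + 2 * (i : ℕ) - a)) % 2 = 0 := by omega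
  refine ⟨q, w, hw0', hw, ?_, hpar'⟩
  by_contra! hlt
  have hlev := (V.allLevels_iff _ _).mp (allLevels_summand hl ht (i := i) (by omega))
  have h2 := abs_cases (k + 2 * ((i : ℕ) : ℤ) - a)
  have hn : (q : ℤ) = |k + 2 * (i : ℕ) - a| + 2 * (((q - |k + 2 * (i : ℕ) - a|) / 2 - 1).toNat + 1) := by
    omega
  have hf : (((q : ℤ) : ℂ) ^ 2 - ((k + 2 * (i : ℕ) - a : ℤ) : ℂ) ^ 2) *
      (((q : ℤ) : ℂ) ^ 2 - (2 * (ρ + ((A : ℤ) : ℂ) * ((i : ℕ) - a / 2))) ^ 2) = 0 := by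
    have I2 : Complex.I ^ 2 = -1 := Complex.I_sq
    push_cast at hq ⊢
    linear_combination 16 * hq + 16 * (((k + 2 * (i : ℕ) - a : ℂ)) / 2) ^ 2 *
      (ρ + ((A : ℤ) : ℂ) * ((i : ℕ) - a / 2)) ^ 2 * I2
  rcases mul_eq_zero.mp hf with h | h
  · have h3 : (q : ℤ) ^ 2 = (k + 2 * (i : ℕ) - a) ^ 2 := by
      have := sub_eq_zero.mp h
      exact_mod_cast this
    rw [← sq_abs (k + _ - _)] at h3
    have h4 := abs_nonneg (k + 2 * ((i : ℕ) : ℤ) - a)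
    nlinarith
  · refine hlev ((q - |k + 2 * (i : ℕ) - a|) / 2 - 1).toNat ?_
    rw [← hn]
    linear_combination -h

theorem finrank_highest_inf_sector (hl : V.AllLevels k ρ)
    (ht : ∀ n : ℤ, -(a : ℤ) < n → n < a → ρ + ((A : ℤ) : ℂ) * k / 2 ≠ n) (q : ℕ) (i : Fin (a + 1)) :
    Module.finrank ℂ ((tensorLadder A a k ρ).highest (q / 2) ⊓ sector A a k ρ i :
      Submodule ℂ (F A a ⊗[ℂ] V k ρ)) = if i ∈ summands a k q then 1 else 0 := by
  have := finite_highest (A := A) (a := a) hl q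
  refine finrank_eq_ite_of_iSupIndep
    (p := fun i : Fin (a + 1) => (tensorLadder A a k ρ).highest (q / 2) ⊓ sector A a k ρ i)
    ((iSupIndep_sector ht).mono fun i => inf_le_right) (fun i => inf_le_left)
    (finrank_highest_le hl q) (fun i hi => ?_) i
  obtain ⟨q', w, hw0, hw, hq', hpar'⟩ := exists_isBottom_sector hl ht i
  obtain ⟨hle, hpar⟩ := mem_summands.mp hi
  obtain ⟨m, rfl⟩ : ∃ m, q = q' + 2 * m := ⟨(q - q') / 2, by omega⟩
  have hH := (LadderOps.isHighest_restrict _).mp hw.highest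
  intro h
  refine Kp_pow_ne_zero hl hw0 hH m ((Submodule.eq_bot_iff _).mp h _ ⟨?_, ?_⟩)
  · have := LadderOps.Kp_pow_highest hH m
    rw [SetLike.mem_coe, LadderOps.mem_highest]
    rwa [show ((q' + 2 * m : ℕ) : ℂ) / 2 = q' / 2 + m by push_cast; ring]
  · rw [← LadderOps.coe_restrict_pow (isStable_sector (i : ℕ)).Kp]
    exact Subtype.prop _

/-- Each sector is isomorphic to the corresponding `V_{Λ,P}`. -/
theorem exists_equiv_sector (hl : V.AllLevels k ρ)
    (ht : ∀ n : ℤ, -(a : ℤ) < n → n < a → ρ + ((A : ℤ) : ℂ) * k / 2 ≠ n) (i : Fin (a + 1)) :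
    ∃ φ : V (k + 2 * (i : ℕ) - a) (ρ + ((A : ℤ) : ℂ) * ((i : ℕ) - a / 2)) ≃ₗ[ℂ] sector A a k ρ i,
      LadderOps.Intertwines (V.ladder _ _) ((tensorLadder A a k ρ).restrict (isStable_sector i))
        φ.toLinearMap := by
  obtain ⟨q, w, hw0, hw, hq, hpar⟩ := exists_isBottom_sector hl ht i
  have hH := (LadderOps.isHighest_restrict _).mp hw.highest
  have hlf := (isLocallyFinite_tensor (A := A) (a := a) (k := k)
    (ρ := ρ)).restrict (isStable_sector (i : ℕ))
  have hmem : ∀ {q : ℕ} {x : F A a ⊗[ℂ] V k ρ}, x ∈ sector A a k ρ i → x ≠ 0 →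
      (tensorLadder A a k ρ).rot.IsHighest (q / 2) x → i ∈ summands a k q ∧
        Module.finrank ℂ ((tensorLadder A a k ρ).highest (q / 2) ⊓ sector A a k ρ i :
          Submodule ℂ (F A a ⊗[ℂ] V k ρ)) = 1 := by
    intro q x hx hx0 hxH
    have h1 := finrank_highest_inf_sector hl ht q i
    by_cases hi : i ∈ summands a k q
    · rw [if_pos hi] at h1
      exact ⟨hi, h1⟩
    · rw [if_neg hi] at h1
      have := finite_highest (A := A) (a := a) hl q
      have hfin : Module.Finite ℂ ((tensorLadder A a k ρ).highest (q / 2) ⊓ sector A a k ρ i :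
          Submodule ℂ (F A a ⊗[ℂ] V k ρ)) :=
        Module.Finite.of_injective _ (Submodule.inclusion_injective inf_le_left)
      rw [Submodule.finrank_eq_zero] at h1
      exact (hx0 ((Submodule.eq_bot_iff _).mp h1 x ⟨hxH, hx⟩)).elim
  have hqk : q = (k + 2 * (i : ℕ) - a).natAbs := by
    have := (mem_summands.mp (hmem w.2 hw0 hH).1).1
    zify
    exact le_antisymm hq this
  rw [hqk] at hw
  refine V.exists_equiv (allLevels_summand hl ht (by omega)) hlf
    (fun x => Subtype.ext (((LadderOps.coe_cas_restrict _ x).1).trans (cas_sector hl x.2).1))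
    (fun x => Subtype.ext (((LadderOps.coe_cas_restrict _ x).2).trans (cas_sector hl x.2).2))
    hw (fun n h => ?_) (fun j x hx => ?_)
  · refine Kp_pow_ne_zero hl hw0 hH n ?_
    have := congrArg Subtype.val h
    exact (LadderOps.coe_restrict_pow (isStable_sector (i : ℕ)).Kp n w).symm.trans this
  · by_cases hx0 : x = 0
    · rw [hx0]; exact Submodule.zero_mem _
    have hx0' : (x : F A a ⊗[ℂ] V k ρ) ≠ 0 := fun h => hx0 (Subtype.ext h)
    obtain ⟨q', hq'⟩ := hx.exists_nat hx0 (hlf.lower x)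
    have hxH := (LadderOps.isHighest_restrict _).mp hx
    rw [show j = (q' : ℂ) / 2 by linear_combination hq' / 2] at hxH
    obtain ⟨h1, h2⟩ := hmem x.2 hx0' hxH
    obtain ⟨h3, h4⟩ := mem_summands.mp h1
    obtain ⟨m, rfl⟩ : ∃ m, q' = q + 2 * m := ⟨(q' - q) / 2, by omega⟩
    have hy : ((tensorLadder A a k ρ).Kp ^ m) w ∈
        ((tensorLadder A a k ρ).highest ((q + 2 * m : ℕ) / 2) ⊓ sector A a k ρ i :
          Submodule ℂ (F A a ⊗[ℂ] V k ρ)) := by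
      constructor
      · have := LadderOps.Kp_pow_highest hH m
        rw [SetLike.mem_coe, LadderOps.mem_highest]
        rwa [show ((q + 2 * m : ℕ) : ℂ) / 2 = q / 2 + m by push_cast; ring]
      · rw [← LadderOps.coe_restrict_pow (isStable_sector (i : ℕ)).Kp]
        exact Subtype.prop _
    obtain ⟨c, hc⟩ := (finrank_eq_one_iff_of_nonzero' ⟨_, hy⟩ (fun h =>
      Kp_pow_ne_zero hl hw0 hH m (congrArg Subtype.val h))).mp h2 ⟨x, hxH, x.2⟩
    have hxe : x = c • (((tensorLadder A a k ρ).restrict (isStable_sector (i : ℕ))).Kp ^ m) w := by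
      refine Subtype.ext ((congrArg Subtype.val hc).symm.trans ?_)
      exact congrArg (c • ·) (LadderOps.coe_restrict_pow (isStable_sector (i : ℕ)).Kp m w).symm
    rw [hxe]
    have hs := LadderOps.mem_ladderSpan
      (D := (tensorLadder A a k ρ).restrict (isStable_sector (i : ℕ))) w m 0
    exact Submodule.smul_mem _ _ hs

end F
end Lorentz

namespace Lorentz

/-- A decomposition of a module into a finite direct sum of modules. -/
structure Decomposition (M : Type*) [AddCommGroup M] [Module ℂ M] [LieRingModule Spin31 M]
    {ι : Type*} [Fintype ι] (N : ι → Type*) [∀ i, AddCommGroup (N i)] [∀ i, Module ℂ (N i)]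
    [∀ i, LieRingModule Spin31 (N i)] where
  /-- the inclusions -/
  incl : ∀ i, N i →ₗ[ℂ] M
  /-- the projections -/
  proj : ∀ i, M →ₗ[ℂ] N i
  incl_lie : ∀ i (x : Spin31) v, incl i ⁅x, v⁆ = ⁅x, incl i v⁆
  proj_incl : ∀ i v, proj i (incl i v) = v
  proj_incl_of_ne : ∀ i j v, i ≠ j → proj j (incl i v) = 0
  sum_incl_proj : ∀ m, ∑ i, incl i (proj i m) = m

namespace Decomposition

variable {M : Type*} [AddCommGroup M] [Module ℂ M] [LieRingModule Spin31 M]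
  {ι : Type*} [Fintype ι] {N : ι → Type*} [∀ i, AddCommGroup (N i)]
  [∀ i, Module ℂ (N i)] [∀ i, LieRingModule Spin31 (N i)] (d : Decomposition M N)

theorem proj_lie (i : ι) (x : Spin31) (m : M) : d.proj i ⁅x, m⁆ = ⁅x, d.proj i m⁆ := by
  classical
  conv_lhs => rw [← d.sum_incl_proj m, lie_sum, map_sum]
  rw [Finset.sum_eq_single i]
  · rw [← d.incl_lie, d.proj_incl]
  · intro j _ hj
    rw [← d.incl_lie, d.proj_incl_of_ne _ _ _ hj]
  · simp

/-- Transport along an isomorphism. -/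
def congr {M' : Type*} [AddCommGroup M'] [Module ℂ M'] [LieRingModule Spin31 M'] (e : M ≃ₗ[ℂ] M')
    (he : ∀ (x : Spin31) m, e ⁅x, m⁆ = ⁅x, e m⁆) : Decomposition M' N where
  incl i := e.toLinearMap ∘ₗ d.incl i
  proj i := d.proj i ∘ₗ e.symm.toLinearMap
  incl_lie i x v := by simp [d.incl_lie, he]
  proj_incl i v := by simp [d.proj_incl]
  proj_incl_of_ne i j v h := by simp [d.proj_incl_of_ne i j v h]
  sum_incl_proj m := by
    simp only [LinearMap.comp_apply, LinearEquiv.coe_coe]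
    rw [← map_sum, d.sum_incl_proj, e.apply_symm_apply]

/-- A decomposition of the summands. -/
def trans {κ : Type*} [Fintype κ] {N' : ι → κ → Type*} [∀ i j, AddCommGroup (N' i j)]
    [∀ i j, Module ℂ (N' i j)] [∀ i j, LieRingModule Spin31 (N' i j)]
    (d' : ∀ i, Decomposition (N i) (N' i)) :
    Decomposition M fun p : κ × ι => N' p.2 p.1 where
  incl p := d.incl p.2 ∘ₗ (d' p.2).incl p.1
  proj p := (d' p.2).proj p.1 ∘ₗ d.proj p.2
  incl_lie p x v := by simp [d.incl_lie, (d' p.2).incl_lie]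
  proj_incl p v := by simp [d.proj_incl, (d' p.2).proj_incl]
  proj_incl_of_ne p p' v h := by
    obtain ⟨j, i⟩ := p
    obtain ⟨j', i'⟩ := p'
    simp only [LinearMap.comp_apply]
    by_cases hi : i = i'
    · subst hi
      rw [d.proj_incl, (d' i).proj_incl_of_ne]
      rintro rfl
      exact h rfl
    · rw [d.proj_incl_of_ne _ _ _ hi, map_zero]
  sum_incl_proj m := by
    rw [Fintype.sum_prod_type_right]
    simp only [LinearMap.comp_apply]
    conv_rhs => rw [← d.sum_incl_proj m]
    refine Finset.sum_congr rfl fun i _ => ?_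
    rw [← map_sum (d.incl i)]
    change d.incl i (∑ j, (d' i).incl j ((d' i).proj j (d.proj i m))) = _
    rw [(d' i).sum_incl_proj]

theorem incl_injective (i : ι) : Function.Injective (d.incl i) :=
  Function.LeftInverse.injective (d.proj_incl i)

/-- The isomorphism with the direct sum, as vector spaces. -/
noncomputable def linearEquiv [DecidableEq ι] : (⨁ i, N i) ≃ₗ[ℂ] M :=
  LinearEquiv.ofLinearMap (DirectSum.toModule ℂ ι M d.incl)
    (∑ i, DirectSum.lof ℂ ι N i ∘ₗ d.proj i)
    (by ext m; simp [LinearMap.sum_apply, d.sum_incl_proj])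
    (by
      refine DirectSum.linearMap_ext ℂ fun i => LinearMap.ext fun v => ?_
      simp only [LinearMap.comp_apply, DirectSum.toModule_lof, LinearMap.sum_apply,
        LinearMap.id_apply]
      rw [Finset.sum_eq_single i]
      · rw [d.proj_incl]
      · intro j _ hj
        rw [d.proj_incl_of_ne _ _ _ hj.symm, map_zero]
      · simp)

theorem linearEquiv_lof [DecidableEq ι] (i : ι) (v : N i) :
    d.linearEquiv (DirectSum.lof ℂ ι N i v) = d.incl i v := DirectSum.toModule_lof ..

variable [LieModule ℂ Spin31 M] [∀ i, LieModule ℂ Spin31 (N i)]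

/-- The decomposition of a tensor product. -/
noncomputable def lTensor (P : Type*) [AddCommGroup P] [Module ℂ P] [LieRingModule Spin31 P]
    [LieModule ℂ Spin31 P] : Decomposition (P ⊗[ℂ] M) fun i => P ⊗[ℂ] N i where
  incl i := (d.incl i).lTensor P
  proj i := (d.proj i).lTensor P
  incl_lie i x v := by
    induction v with
    | zero => simp
    | tmul y v => simp [TensorProduct.LieModule.lie_tmul_right, d.incl_lie]
    | add v w hv hw => simp only [lie_add, map_add, hv, hw]
  proj_incl i v := by
    rw [← LinearMap.comp_apply, ← LinearMap.lTensor_comp]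
    rw [show d.proj i ∘ₗ d.incl i = LinearMap.id from LinearMap.ext (d.proj_incl i),
      LinearMap.lTensor_id, LinearMap.id_apply]
  proj_incl_of_ne i j v h := by
    rw [← LinearMap.comp_apply, ← LinearMap.lTensor_comp]
    rw [show d.proj j ∘ₗ d.incl i = 0 from LinearMap.ext fun v => d.proj_incl_of_ne i j v h,
      LinearMap.lTensor_zero, LinearMap.zero_apply]
  sum_incl_proj m := by
    induction m with
    | zero => simp
    | tmul y m => simp [← TensorProduct.tmul_sum, d.sum_incl_proj]
    | add v w hv hw =>
      simp only [map_add, Finset.sum_add_distrib]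
      rw [hv, hw]

/-- The isomorphism with the direct sum. -/
noncomputable def equiv [DecidableEq ι] : M ≃ₗ⁅ℂ, Spin31⁆ ⨁ i, N i :=
  LieModuleEquiv.symm
    { d.linearEquiv with
      map_lie' := by
        intro x v
        change d.linearEquiv ⁅x, v⁆ = ⁅x, d.linearEquiv v⁆
        induction v using DirectSum.induction_on with
        | zero => simp
        | of i v =>
          have h1 : ⁅x, DirectSum.lof ℂ ι N i v⁆ = DirectSum.lof ℂ ι N i ⁅x, v⁆ :=
            ((DirectSum.lieModuleOf ℂ ι Spin31 N i).map_lie x v).symm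
          change d.linearEquiv ⁅x, DirectSum.lof ℂ ι N i v⁆ =
            ⁅x, d.linearEquiv (DirectSum.lof ℂ ι N i v)⁆
          rw [h1, linearEquiv_lof, linearEquiv_lof, d.incl_lie]
        | add v w hv hw => rw [lie_add, map_add, map_add, lie_add, hv, hw] }

end Decomposition

section

variable {W W' : Type*} [AddCommGroup W] [Module ℂ W] [LieRingModule Spin31 W]
  [LieModule ℂ Spin31 W] [AddCommGroup W'] [Module ℂ W'] [LieRingModule Spin31 W']
  [LieModule ℂ Spin31 W']

theorem map_casimir {φ : W →ₗ[ℂ] W'} (h : ∀ (x : Spin31) w, φ ⁅x, w⁆ = ⁅x, φ w⁆) (w : W) :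
    φ (casimir₁ W w) = casimir₁ W' (φ w) ∧ φ (casimir₂ W w) = casimir₂ W' (φ w) := by
  constructor
  · simp [casimir₁, Fin.sum_univ_three, h]
  · simp [casimir₂, Fin.sum_univ_three, h, sq]

end

theorem CasimirsDiagonalisable.congr {W W' : Type} [AddCommGroup W] [Module ℂ W]
    [LieRingModule Spin31 W] [LieModule ℂ Spin31 W] [AddCommGroup W'] [Module ℂ W']
    [LieRingModule Spin31 W'] [LieModule ℂ Spin31 W'] (h : CasimirsDiagonalisable W)
    (e : W ≃ₗ[ℂ] W') (he : ∀ (x : Spin31) w, e ⁅x, w⁆ = ⁅x, e w⁆) :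
    CasimirsDiagonalisable W' := by
  obtain ⟨ι, B, hB⟩ := h
  refine ⟨ι, B.map e, fun i => ?_⟩
  obtain ⟨c₁, c₂, h1, h2⟩ := hB i
  refine ⟨c₁, c₂, ?_⟩
  obtain ⟨h3, h4⟩ := map_casimir (φ := e.toLinearMap) he (B i)
  simp only [LinearEquiv.coe_coe] at h3 h4
  rw [Module.Basis.map_apply, ← h3, ← h4, h1, h2, map_smul, map_smul]
  exact ⟨rfl, rfl⟩

theorem V.casimir_eq {k : ℤ} {ρ : ℂ} (hl : V.AllLevels k ρ) (x : V k ρ) :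
    casimir₁ (V k ρ) x = (casimirValues (k / 2, ρ)).1 • x ∧
      casimir₂ (V k ρ) x = (casimirValues (k / 2, ρ)).2 • x := by
  rw [casimir₁_eq, casimir₂_eq, V.ofLie_eq]
  exact ⟨V.cas₁_eq hl x, V.cas₂_eq hl x⟩

namespace Decomposition

variable {M : Type} [AddCommGroup M] [Module ℂ M] [LieRingModule Spin31 M]
  [LieModule ℂ Spin31 M] {ι : Type} [Fintype ι] {K : ι → ℤ} {R : ι → ℂ}

theorem diagonalisable [DecidableEq ι] (d : Decomposition M fun i => V (K i) (R i))
    (hl : ∀ i, V.AllLevels (K i) (R i)) : CasimirsDiagonalisable M := by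
  refine ⟨Σ i, BasisIdx (K i) (R i), (DFinsupp.basis fun i => V.basis (K i) (R i)).map
    d.linearEquiv, fun p => ⟨(casimirValues (K p.1 / 2, R p.1)).1,
      (casimirValues (K p.1 / 2, R p.1)).2, ?_⟩⟩
  obtain ⟨i, p⟩ := p
  have e : ((DFinsupp.basis fun i => V.basis (K i) (R i)).map
      d.linearEquiv) ⟨i, p⟩ = d.incl i (V.basis (K i) (R i) p) := by
    rw [Module.Basis.map_apply, ← linearEquiv_lof]
    congr 1
    change (DFinsupp.mapRange.linearEquiv fun i => (V.basis (K i) (R i)).repr).symm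
      (sigmaFinsuppEquivDFinsupp (Finsupp.single ⟨i, p⟩ (1 : ℂ))) = _
    rw [sigmaFinsuppEquivDFinsupp_single, LinearEquiv.symm_apply_eq]
    change _ = DFinsupp.mapRange (fun i => (V.basis (K i) (R i)).repr) (fun _ => map_zero _)
      (DFinsupp.single (β := fun i => V (K i) (R i)) i (V.basis (K i) (R i) p))
    rw [DFinsupp.mapRange_single]
    simp
  obtain ⟨h1, h2⟩ := map_casimir (d.incl_lie i) (V.basis (K i) (R i) p)
  obtain ⟨h3, h4⟩ := V.casimir_eq (hl i) (V.basis (K i) (R i) p)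
  rw [e, ← h1, ← h2, h3, h4, map_smul, map_smul]
  exact ⟨rfl, rfl⟩

theorem exists_eigenvector_iff (d : Decomposition M fun i => V (K i) (R i))
    (hl : ∀ i, V.AllLevels (K i) (R i)) (c : ℂ × ℂ) :
    (∃ v : M, v ≠ 0 ∧ casimir₁ M v = c.1 • v ∧ casimir₂ M v = c.2 • v) ↔
      ∃ i, c = casimirValues ((K i : ℂ) / 2, R i) := by
  constructor
  · rintro ⟨v, hv, h1, h2⟩
    obtain ⟨i, hi⟩ : ∃ i, d.proj i v ≠ 0 := by
      by_contra! h
      refine hv ?_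
      rw [← d.sum_incl_proj v]
      exact Finset.sum_eq_zero fun i _ => by rw [h i, map_zero]
    refine ⟨i, ?_⟩
    obtain ⟨h3, h4⟩ := map_casimir (d.proj_lie i) v
    obtain ⟨h5, h6⟩ := V.casimir_eq (hl i) (d.proj i v)
    rw [h1, map_smul, h5] at h3
    rw [h2, map_smul, h6] at h4
    exact Prod.ext (smul_left_injective ℂ hi h3) (smul_left_injective ℂ hi h4)
  · rintro ⟨i, rfl⟩
    refine ⟨d.incl i (V.bottom (K i) (R i)), fun h => V.bottom_ne_zero (hl i)
      (d.incl_injective i (h.trans (map_zero _).symm)), ?_, ?_⟩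
    · rw [← (map_casimir (d.incl_lie i) _).1, (V.casimir_eq (hl i) _).1, map_smul]
    · rw [← (map_casimir (d.incl_lie i) _).2, (V.casimir_eq (hl i) _).2, map_smul]

end Decomposition

end Lorentz

namespace Lorentz
namespace F

variable {A : ℤˣ} {a : ℕ} {k : ℤ} {ρ : ℂ}

/-- The decomposition of `F^A_γ ⊗ V_{λ,ρ}`. -/
theorem nonempty_decomposition (hl : V.AllLevels k ρ)
    (ht : ∀ n : ℤ, -(a : ℤ) < n → n < a → ρ + ((A : ℤ) : ℂ) * k / 2 ≠ n) :
    Nonempty (Decomposition (F A a ⊗[ℂ] V k ρ) fun i : Fin (a + 1) =>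
      V (k + 2 * (i : ℕ) - a) (ρ + ((A : ℤ) : ℂ) * ((i : ℕ) - a / 2))) := by
  classical
  choose φ hφ using exists_equiv_sector (A := A) (a := a) hl ht
  have hint : DirectSum.IsInternal fun i : Fin (a + 1) => sector A a k ρ i :=
    DirectSum.isInternal_submodule_of_iSupIndep_of_iSup_eq_top (iSupIndep_sector ht)
      (iSup_sector hl ht)
  let e : (⨁ i : Fin (a + 1), sector A a k ρ i) ≃ₗ[ℂ] F A a ⊗[ℂ] V k ρ :=
    LinearEquiv.ofBijective (DirectSum.coeLinearMap fun i : Fin (a + 1) => sector A a k ρ i) hint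
  have he : ∀ (i : Fin (a + 1)) (x : sector A a k ρ i), e.symm x = DirectSum.lof ℂ _ _ i x :=
    fun i x => (LinearEquiv.symm_apply_eq e).mpr (DirectSum.coeLinearMap_lof
      (fun i : Fin (a + 1) => sector A a k ρ i) i x).symm
  refine ⟨⟨fun i => (sector A a k ρ i).subtype ∘ₗ (φ i).toLinearMap,
    fun i => (φ i).symm.toLinearMap ∘ₗ DirectSum.component ℂ _ _ i ∘ₗ e.symm.toLinearMap,
    fun i x v => ?_, fun i v => ?_, fun i j v hij => ?_, fun m => ?_⟩⟩
  · refine LadderOps.Intertwines.map_lie ?_ x v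
    rw [V.ofLie_eq]
    exact ⟨fun v => congrArg Subtype.val ((hφ i).J0 v), fun v => congrArg Subtype.val ((hφ i).Jp v),
      fun v => congrArg Subtype.val ((hφ i).Jm v), fun v => congrArg Subtype.val ((hφ i).K0 v),
      fun v => congrArg Subtype.val ((hφ i).Kp v), fun v => congrArg Subtype.val ((hφ i).Km v)⟩
  · simp only [LinearMap.comp_apply, Submodule.subtype_apply, LinearEquiv.coe_coe, he]
    rw [DirectSum.component.lof_self, LinearEquiv.symm_apply_apply]
  · simp only [LinearMap.comp_apply, Submodule.subtype_apply, LinearEquiv.coe_coe, he]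
    rw [DirectSum.component.of, dif_neg hij, map_zero]
  · simp only [LinearMap.comp_apply, Submodule.subtype_apply, LinearEquiv.coe_coe,
      LinearEquiv.apply_symm_apply]
    obtain ⟨y, rfl⟩ := e.surjective m
    rw [LinearEquiv.symm_apply_apply]
    change _ = DirectSum.coeLinearMap _ y
    rw [DirectSum.coeLinearMap_eq_dfinsuppSum, DFinsupp.sum_eq_sum_fintype]
    · rfl
    · simp

/-- If the Casimirs are diagonalisable on `F^A_γ ⊗ M`, then `t` is not an integer in
`(-2γ, 2γ)`. -/
theorem ne_intCast_of_casimirsDiagonalisable {M : Type} [AddCommGroup M] [Module ℂ M]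
    [LieRingModule Spin31 M] [LieModule ℂ Spin31 M] {t : ℂ}
    (hT : ∀ m : M, ((LadderOps.ofLie M).half A).cas m = t ^ 2 • m) {m : M}
    (hm : (((LadderOps.ofLie M).half A).Sm ^ a) m ≠ 0)
    (hd : CasimirsDiagonalisable (F A a ⊗[ℂ] M)) {n : ℤ} (h1 : -(a : ℤ) < n) (h2 : n < a) :
    t ≠ n := by
  refine ne_intCast_of_diagonalisable (A := A) _ hT hm ?_ h1 h2
  obtain ⟨ι, B, hB⟩ := hd
  refine iSup_eigenspace_eq_top_of_span B.span_eq fun i => ?_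
  obtain ⟨c₁, c₂, h3, h4⟩ := hB i
  refine ⟨c₂ - 2 * Complex.I * ((A : ℤ) : ℂ) * c₁ + 1, ?_⟩
  rw [casimir₁_eq] at h3
  rw [casimir₂_eq] at h4
  rw [tensorCas, ← half_ofLie_tensor, LadderOps.half_cas, LinearMap.add_apply, LinearMap.sub_apply,
    LinearMap.smul_apply, h3, h4, Module.End.one_apply]
  module

theorem half_neg_Sm_pow_ne_zero (hl : V.AllLevels k ρ) (N : ℕ) :
    ∃ m : F A a ⊗[ℂ] V k ρ, (((tensorLadder A a k ρ).half (-A)).Sm ^ N) m ≠ 0 := by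
  refine ⟨ket A a 0 ⊗ₜ V.ket k ρ 0 0, fun h => V.half_Sm_pow_ne_zero hl (-A) N ?_⟩
  have h1 := congrArg (component A a _ 0) h
  rw [(half_neg_ofLie_tensor A a (V k ρ)).2.2, V.ofLie_eq, LinearMap.lTensor_pow,
    LinearMap.lTensor_tmul, component_ket, if_pos (by simp), map_zero] at h1
  exact h1

end F

section

variable {P Q M : Type} [AddCommGroup P] [Module ℂ P] [LieRingModule Spin31 P]
  [LieModule ℂ Spin31 P] [AddCommGroup Q] [Module ℂ Q] [LieRingModule Spin31 Q]
  [LieModule ℂ Spin31 Q] [AddCommGroup M] [Module ℂ M] [LieRingModule Spin31 M]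
  [LieModule ℂ Spin31 M]

theorem assoc_lie (x : Spin31) (w : (P ⊗[ℂ] Q) ⊗[ℂ] M) :
    TensorProduct.assoc ℂ P Q M ⁅x, w⁆ = ⁅x, TensorProduct.assoc ℂ P Q M w⁆ := by
  induction w with
  | zero => simp
  | tmul y m =>
    induction y with
    | zero => simp
    | tmul p q =>
      simp only [TensorProduct.LieModule.lie_tmul_right, TensorProduct.add_tmul, map_add,
        TensorProduct.assoc_tmul, TensorProduct.tmul_add]
      abel
    | add y z hy hz => simp only [TensorProduct.add_tmul, lie_add, map_add, hy, hz]
  | add v w hv hw => simp only [lie_add, map_add, hv, hw]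

theorem leftComm_lie (x : Spin31) (w : P ⊗[ℂ] (Q ⊗[ℂ] M)) :
    TensorProduct.leftComm ℂ P Q M ⁅x, w⁆ = ⁅x, TensorProduct.leftComm ℂ P Q M w⁆ := by
  induction w with
  | zero => simp
  | tmul p y =>
    induction y with
    | zero => simp
    | tmul q m =>
      simp only [TensorProduct.LieModule.lie_tmul_right, TensorProduct.tmul_add, map_add,
        TensorProduct.leftComm_tmul]
      abel
    | add y z hy hz => simp only [TensorProduct.tmul_add, lie_add, map_add, hy, hz]
  | add v w hv hw => simp only [lie_add, map_add, hv, hw]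

end

section

variable {a b : ℕ} {k : ℤ} {ρ : ℂ}

theorem condition_of_diagonalisable (hl : V.AllLevels k ρ)
    (h : CasimirsDiagonalisable (FinDim a b ⊗[ℂ] V k ρ)) :
    (¬ ∃ n : ℤ, -(a : ℤ) < n ∧ n < a ∧ ρ - (k : ℂ) / 2 = n) ∧
      (¬ ∃ n : ℤ, -(b : ℤ) < n ∧ n < b ∧ ρ + (k : ℂ) / 2 = n) := by
  have h' := h.congr (TensorProduct.assoc ℂ _ _ _) assoc_lie
  have h'' := h'.congr (TensorProduct.leftComm ℂ _ _ _) leftComm_lie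
  constructor
  · rintro ⟨n, h1, h2, h3⟩
    obtain ⟨m, hm⟩ := F.half_neg_Sm_pow_ne_zero (A := 1) (a := b) hl a
    refine F.ne_intCast_of_casimirsDiagonalisable (fun m => ?_) hm h' h1 h2 h3
    rw [F.half_neg_tensorLadder hl]
    simp
  · rintro ⟨n, h1, h2, h3⟩
    obtain ⟨m, hm⟩ := F.half_neg_Sm_pow_ne_zero (A := -1) (a := a) hl b
    rw [neg_neg] at hm
    refine F.ne_intCast_of_casimirsDiagonalisable (fun m => ?_) hm h'' h1 h2 h3
    have := F.half_neg_tensorLadder (A := -1) (a := a) hl m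
    rw [neg_neg] at this
    rw [this]
    congr 2
    simp only [Units.val_neg, Units.val_one, Int.cast_neg, Int.cast_one]
    ring

/-- The decomposition of `(γ₁,γ₂) ⊗ V_{λ,ρ}`. -/
theorem nonempty_decomposition (hl : V.AllLevels k ρ)
    (h1 : ¬ ∃ n : ℤ, -(a : ℤ) < n ∧ n < a ∧ ρ - (k : ℂ) / 2 = n)
    (h2 : ¬ ∃ n : ℤ, -(b : ℤ) < n ∧ n < b ∧ ρ + (k : ℂ) / 2 = n) :
    (∀ p : Fin (a + 1) × Fin (b + 1), V.AllLevels (twoLam a b k p) (rhoNew a b ρ p)) ∧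
    Nonempty (Decomposition (FinDim a b ⊗[ℂ] V k ρ) fun p : Fin (a + 1) × Fin (b + 1) =>
      V (twoLam a b k p) (rhoNew a b ρ p)) := by
  have ht : ∀ n : ℤ, -(b : ℤ) < n → n < b → ρ + (((1 : ℤˣ) : ℤ) : ℂ) * k / 2 ≠ n :=
    fun n h3 h4 h5 => h2 ⟨n, h3, h4, by rw [← h5]; simp⟩
  have hl' := fun q : Fin (b + 1) => F.allLevels_summand hl ht (i := q) (by omega)
  have ht' : ∀ (q : Fin (b + 1)) (n : ℤ), -(a : ℤ) < n → n < a →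
      (ρ + (((1 : ℤˣ) : ℤ) : ℂ) * ((q : ℕ) - b / 2)) +
        (((-1 : ℤˣ) : ℤ) : ℂ) * ((k + 2 * (q : ℕ) - b : ℤ) : ℂ) / 2 ≠ n :=
    fun q n h3 h4 h5 => h1 ⟨n, h3, h4, by
      rw [← h5]
      simp only [Units.val_neg, Units.val_one, Int.cast_neg, Int.cast_one]
      push_cast
      ring⟩
  obtain ⟨d⟩ := F.nonempty_decomposition hl ht
  have d' := fun q => Classical.choice (F.nonempty_decomposition (hl' q) (ht' q))
  have hK : (fun p : Fin (a + 1) × Fin (b + 1) =>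
      (k + 2 * (p.2 : ℕ) - b : ℤ) + 2 * (p.1 : ℕ) - a) = twoLam a b k := by
    funext p
    rw [twoLam]
    ring
  have hR : (fun p : Fin (a + 1) × Fin (b + 1) =>
      (ρ + (((1 : ℤˣ) : ℤ) : ℂ) * ((p.2 : ℕ) - b / 2)) +
        (((-1 : ℤˣ) : ℤ) : ℂ) * ((p.1 : ℕ) - a / 2)) = rhoNew a b ρ := by
    funext p
    rw [rhoNew]
    simp only [Units.val_neg, Units.val_one, Int.cast_neg, Int.cast_one]
    ring
  rw [← hK, ← hR]
  exact ⟨fun p => F.allLevels_summand (hl' p.2) (ht' p.2) (by omega),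
    ⟨((d.lTensor (F (-1) a)).trans d').congr (TensorProduct.assoc ℂ _ _ _).symm fun x w => by
      rw [LinearEquiv.symm_apply_eq, assoc_lie, LinearEquiv.apply_symm_apply]⟩⟩

theorem exists_not_injective : ¬ FiniteDimensional ℂ (V 0 0) ∧
    ¬ Function.Injective fun p : Fin (1 + 1) × Fin (1 + 1) =>
      casimirValues ((twoLam 1 1 0 p : ℂ) / 2, rhoNew 1 1 0 p) := by
  constructor
  · refine V.not_finiteDimensional_of_allLevels _ _ ((V.allLevels_iff 0 0).mpr fun n h => ?_)
    have h' : ((2 * (n + 1) : ℕ) : ℂ) ^ 2 = 0 := by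
      push_cast at h ⊢
      simpa using h.symm
    rw [sq_eq_zero_iff, Nat.cast_eq_zero] at h'
    omega
  · intro h
    have := @h (0, 0) (1, 1) (by simp [casimirValues, twoLam, rhoNew])
    simp at this

end

end Lorentz

open Lorentz in
theorem mainTheorem5 :
    (∀ (a b : ℕ) (k : ℤ) (ρ : ℂ), 1 ≤ a → 1 ≤ b → ¬ FiniteDimensional ℂ (V k ρ) →
      (CasimirsDiagonalisable (FinDim a b ⊗[ℂ] V k ρ) ↔
        (¬ ∃ n : ℤ, -(a : ℤ) < n ∧ n < a ∧ ρ - (k : ℂ) / 2 = n) ∧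
        (¬ ∃ n : ℤ, -(b : ℤ) < n ∧ n < b ∧ ρ + (k : ℂ) / 2 = n)) ∧
      (CasimirsDiagonalisable (FinDim a b ⊗[ℂ] V k ρ) →
        (∀ c : ℂ × ℂ,
          (∃ v : FinDim a b ⊗[ℂ] V k ρ, v ≠ 0 ∧
              casimir₁ (FinDim a b ⊗[ℂ] V k ρ) v = c.1 • v ∧
              casimir₂ (FinDim a b ⊗[ℂ] V k ρ) v = c.2 • v) ↔
            ∃ p : Fin (a + 1) × Fin (b + 1),
              c = casimirValues ((twoLam a b k p : ℂ) / 2, rhoNew a b ρ p)) ∧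
        Nonempty ((FinDim a b ⊗[ℂ] V k ρ) ≃ₗ⁅ℂ, Spin31⁆
          ⨁ p : Fin (a + 1) × Fin (b + 1), V (twoLam a b k p) (rhoNew a b ρ p)))) ∧
    ¬ ∀ (a b : ℕ) (k : ℤ) (ρ : ℂ), 1 ≤ a → 1 ≤ b → ¬ FiniteDimensional ℂ (V k ρ) →
        Function.Injective fun p : Fin (a + 1) × Fin (b + 1) =>
          casimirValues ((twoLam a b k p : ℂ) / 2, rhoNew a b ρ p) := by
  refine ⟨fun a b k ρ _ _ hinf => ?_, fun h =>
    exists_not_injective.2 (h 1 1 0 0 le_rfl le_rfl exists_not_injective.1)⟩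
  have hl := V.allLevels_of_not_finiteDimensional _ _ hinf
  refine ⟨⟨condition_of_diagonalisable hl, fun h => ?_⟩, fun h => ?_⟩
  · obtain ⟨hl', ⟨d⟩⟩ := nonempty_decomposition hl h.1 h.2
    exact d.diagonalisable hl'
  · obtain ⟨h1, h2⟩ := condition_of_diagonalisable hl h
    obtain ⟨hl', ⟨d⟩⟩ := nonempty_decomposition hl h1 h2
    exact ⟨d.exists_eigenvector_iff hl', ⟨d.equiv⟩⟩
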